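/- Let $k$ be a field containing a primitive third root of unity $r$, and let $A$ be the Hopf algebra over $k$ generated as an algebra by $a,b,x,y$ subject to the relations $$ba=ab,\quad ya=ay,\quad bx=xb,\quad yx=xy,\quad by=-yb,$$ $$x+axa^2+a^2xa-a+1=0,\qquad x^2+ax^2a^2+xaxa^2+x+axa^2=0,$$ $$y^2=x^2+x^3,\qquad b^2=a^3=1,\qquad F^3=0,$$ where $F:=xa+(r+1)ax+\frac{r+2}{3}(a-a^2)$, with coproduct $$\Delta(a)=a\otimes a,\quad \Delta(b)=b\otimes b,\quad \Delta(x)=1\otimes x+x\otimes a,\quad \Delta(y)=1\otimes y+y\otimes b$$ (so that $\varepsilon(a)=\varepsilon(b)=1$, $\varepsilon(x)=\varepsilon(y)=0$, $S(a)=a^2$, $S(b)=b$, $S(x)=-xa^2$, $S(y)=-yb$). Let $p,q\in k$ satisfy $p^2=q^2+q^3$, let $B\subset A$ be the subalgebra generated by $x+qa$ and $y+pb$, and let $C\subset A$ be the subalgebra generated by $a,b,F$. Then: 1. $B$ is a right coideal of $A$, i.e. $\Delta(B)\subseteq B\otimes A$; there is an isomorphism of $k$-algebras from the coordinate ring $k[s,t]/(s^2+s^3-t^2)$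 of the nodal cubic to $B$ with $s\mapsto x+qa$ and $t\mapsto y+pb$; and $C$ is a Hopf subalgebra of $A$. 2. Multiplication in $A$ defines a bijection $C\otimes B\to A$. Moreover $A$ is free and faithfully flat as a right $B$-module. With $B^+=B\cap\ker\varepsilon$, the left ideal $AB^+$ is a coideal of $A$; let $\pi\colon A\to D=A/AB^+$ be the quotient coalgebra and $\lambda(u)=\pi(u_{(1)})\otimes u_{(2)}$ the induced left $D$-coaction on $A$. Then $B\subset A$ is a $D$-coalgebra Galois extension, i.e. $B=\{z\in A:\lambda(uz)=\lambda(u)z\ \text{for all}\ u\in A\}$ and the canonical map $A\otimes_B A\to D\otimes A$, $u\otimes w\mapsto\lambda(u)w$, is well defined and bijective; and it is cleft, i.e. there is a left $D$-colinear, convolution invertible map $D\to A$. 3. If $\operatorname{char}(k)\neq 2$ and $I\neq 0$ is a Hopf ideal of $A$, then $B\cap I\neq 0$. -/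

import Mathlib

open scoped TensorProduct

universe u v

namespace NodalCubic

/-! ### The algebra given by generators and relations -/

/-- The four generators `a, b, x, y`. -/
inductive Gen
  | a
  | b
  | x
  | y

section Algebra

variable {k : Type u} [Field k]

/-- The expression `F = xa + (r+1)ax + (r+2)/3 (a - a²)` in an arbitrary `k`-algebra. -/
def elemF {S : Type v} [Ring S] [Algebra k S] (r : k) (a x : S) : S :=
  x * a + (r + 1) • (a * x) + ((r + 2) / 3) • (a - a ^ 2)

/-- The generators as elements of the free algebra. -/
local notation "fa" => FreeAlgebra.ι k Gen.a
local notation "fb" => FreeAlgebra.ι k Gen.b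
local notation "fx" => FreeAlgebra.ι k Gen.x
local notation "fy" => FreeAlgebra.ι k Gen.y

/-- The defining relations, on the free algebra over `a, b, x, y`. -/
inductive Rel (r : k) : FreeAlgebra k Gen → FreeAlgebra k Gen → Prop
  | ba : Rel r (fb * fa) (fa * fb)
  | ya : Rel r (fy * fa) (fa * fy)
  | bx : Rel r (fb * fx) (fx * fb)
  | yx : Rel r (fy * fx) (fx * fy)
  | bby : Rel r (fb * fy) (-(fy * fb))
  | ax1 : Rel r (fx + fa * fx * fa ^ 2 + fa ^ 2 * fx * fa - fa + 1) 0
  | ax2 : Rel r (fx ^ 2 + fa * fx ^ 2 * fa ^ 2 + fx * fa * fx * fa ^ 2 + fx + fa * fx * fa ^ 2) 0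
  | yy : Rel r (fy ^ 2) (fx ^ 2 + fx ^ 3)
  | bb : Rel r (fb ^ 2) 1
  | aaa : Rel r (fa ^ 3) 1
  | FFF : Rel r (elemF r fa fx ^ 3) 0

/-- The `k`-algebra `A` presented by the generators `a, b, x, y` and the relations above, for a
primitive third root of unity `r`. -/
def NodalHopf {r : k} (_hr : IsPrimitiveRoot r 3) : Type u :=
  RingQuot (Rel r)

variable {r : k} (hr : IsPrimitiveRoot r 3)

noncomputable instance : Ring (NodalHopf hr) := inferInstanceAs (Ring (RingQuot (Rel r)))

noncomputable instance : Algebra k (NodalHopf hr) :=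
  inferInstanceAs (Algebra k (RingQuot (Rel r)))

/-- The quotient map from the free algebra onto `A`. -/
noncomputable def mk : FreeAlgebra k Gen →ₐ[k] NodalHopf hr :=
  RingQuot.mkAlgHom k (Rel r)

/-- The generators of `A`. -/
noncomputable def genA : NodalHopf hr := mk hr fa
noncomputable def genB : NodalHopf hr := mk hr fb
noncomputable def genX : NodalHopf hr := mk hr fx
noncomputable def genY : NodalHopf hr := mk hr fy

/-- The element `F` of `A`. -/
noncomputable def genF : NodalHopf hr := elemF r (genA hr) (genX hr)

theorem mk_surjective : Function.Surjective (mk hr) := RingQuot.mkAlgHom_surjective k (Rel r)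

/-- The defining relations, for four elements of an arbitrary `k`-algebra. -/
structure Sat {S : Type v} [Ring S] [Algebra k S] (r : k) (a b x y : S) : Prop where
  ba : b * a = a * b
  ya : y * a = a * y
  bx : b * x = x * b
  yx : y * x = x * y
  bby : b * y = -(y * b)
  ax1 : x + a * x * a ^ 2 + a ^ 2 * x * a - a + 1 = 0
  ax2 : x ^ 2 + a * x ^ 2 * a ^ 2 + x * a * x * a ^ 2 + x + a * x * a ^ 2 = 0
  yy : y ^ 2 = x ^ 2 + x ^ 3
  bb : b ^ 2 = 1
  aaa : a ^ 3 = 1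
  FFF : elemF r a x ^ 3 = 0

theorem map_elemF {S T : Type*} [Ring S] [Algebra k S] [Ring T] [Algebra k T] (f : S →ₐ[k] T)
    (r : k) (a x : S) : f (elemF r a x) = elemF r (f a) (f x) := by
  simp [elemF]

theorem sat : Sat r (genA hr) (genB hr) (genX hr) (genY hr) where
  ba := by simpa using! RingQuot.mkAlgHom_rel k (Rel.ba (r := r))
  ya := by simpa using! RingQuot.mkAlgHom_rel k (Rel.ya (r := r))
  bx := by simpa using! RingQuot.mkAlgHom_rel k (Rel.bx (r := r))
  yx := by simpa using! RingQuot.mkAlgHom_rel k (Rel.yx (r := r))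
  bby := by simpa using! RingQuot.mkAlgHom_rel k (Rel.bby (r := r))
  ax1 := by simpa using! RingQuot.mkAlgHom_rel k (Rel.ax1 (r := r))
  ax2 := by simpa using! RingQuot.mkAlgHom_rel k (Rel.ax2 (r := r))
  yy := by simpa using! RingQuot.mkAlgHom_rel k (Rel.yy (r := r))
  bb := by simpa using! RingQuot.mkAlgHom_rel k (Rel.bb (r := r))
  aaa := by simpa using! RingQuot.mkAlgHom_rel k (Rel.aaa (r := r))
  FFF := by simpa [map_elemF] using! RingQuot.mkAlgHom_rel k (Rel.FFF (r := r))

/-- The images of the generators under a map out of the free algebra. -/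
def tuple {S : Type v} (a b x y : S) : Gen → S
  | .a => a
  | .b => b
  | .x => x
  | .y => y

/-- The universal property of `A`. -/
noncomputable def lift {S : Type v} [Ring S] [Algebra k S] {a b x y : S} (h : Sat r a b x y) :
    NodalHopf hr →ₐ[k] S :=
  RingQuot.liftAlgHom k (s := Rel r) ⟨FreeAlgebra.lift k (tuple a b x y), by
    intro u v huv
    induction huv with
    | ba => simpa [tuple] using h.ba
    | ya => simpa [tuple] using h.ya
    | bx => simpa [tuple] using h.bx
    | yx => simpa [tuple] using h.yx
    | bby => simpa [tuple] using h.bby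
    | ax1 => simpa [tuple] using h.ax1
    | ax2 => simpa [tuple] using h.ax2
    | yy => simpa [tuple] using h.yy
    | bb => simpa [tuple] using h.bb
    | aaa => simpa [tuple] using h.aaa
    | FFF => simpa [tuple, map_elemF] using h.FFF⟩

section lift

variable {S : Type v} [Ring S] [Algebra k S] {a b x y : S} (h : Sat r a b x y)

theorem lift_mk (w : FreeAlgebra k Gen) :
    lift hr h (mk hr w) = FreeAlgebra.lift k (tuple a b x y) w :=
  RingQuot.liftAlgHom_mkAlgHom_apply k _ _ _

@[simp] theorem lift_a : lift hr h (genA hr) = a := by simp [genA, lift_mk, tuple]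
@[simp] theorem lift_b : lift hr h (genB hr) = b := by simp [genB, lift_mk, tuple]
@[simp] theorem lift_x : lift hr h (genX hr) = x := by simp [genX, lift_mk, tuple]
@[simp] theorem lift_y : lift hr h (genY hr) = y := by simp [genY, lift_mk, tuple]

variable {hr} in
theorem hom_ext {f g : NodalHopf hr →ₐ[k] S} (ha : f (genA hr) = g (genA hr))
    (hb : f (genB hr) = g (genB hr)) (hx : f (genX hr) = g (genX hr))
    (hy : f (genY hr) = g (genY hr)) : f = g := by
  have : f.comp (mk hr) = g.comp (mk hr) := by
    apply FreeAlgebra.hom_ext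
    funext i
    cases i
    · exact ha
    · exact hb
    · exact hx
    · exact hy
  ext z
  obtain ⟨w, rfl⟩ := mk_surjective hr z
  exact congrArg (fun q => q w) this

end lift

variable {hr} in
theorem induction {P : NodalHopf hr → Prop} (hc : ∀ c : k, P (algebraMap k _ c))
    (ha : P (genA hr)) (hb : P (genB hr)) (hx : P (genX hr)) (hy : P (genY hr))
    (hadd : ∀ u v, P u → P v → P (u + v)) (hmul : ∀ u v, P u → P v → P (u * v))
    (z : NodalHopf hr) : P z := by
  obtain ⟨w, rfl⟩ := mk_surjective hr z
  induction w using FreeAlgebra.induction with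
  | grade0 c => simpa using hc c
  | grade1 i =>
    cases i
    · exact ha
    · exact hb
    · exact hx
    · exact hy
  | mul u v hu hv => simpa using hmul _ _ hu hv
  | add u v hu hv => simpa using hadd _ _ hu hv

end Algebra

/-! ### Consequences of the relations -/

section Identities

variable {k : Type u} [Field k] {r : k} {S : Type v} [Ring S] [Algebra k S] {a b x y : S}

theorem root_quadratic (hr : IsPrimitiveRoot r 3) : r ^ 2 + r + 1 = 0 := by
  have h1 : r ≠ 1 := hr.ne_one (by norm_num)
  have h3 : r ^ 3 = 1 := hr.pow_eq_one
  have : (r - 1) * (r ^ 2 + r + 1) = 0 := by linear_combination h3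
  exact (mul_eq_zero.mp this).resolve_left (sub_ne_zero.mpr h1)

theorem three_ne_zero_of_root (hr : IsPrimitiveRoot r 3) : (3 : k) ≠ 0 := by
  intro h
  have h1 : r ≠ 1 := hr.ne_one (by norm_num)
  have : (r - 1) ^ 2 = 0 := by linear_combination root_quadratic hr - r * h
  exact h1 (sub_eq_zero.mp (pow_eq_zero_iff (two_ne_zero) |>.mp this))

theorem Sat.xa (h : Sat r a b x y) : x * a + a * x + a ^ 2 * x * a ^ 2 + a - a ^ 2 = 0 := by
  have e : x * a + a * x + a ^ 2 * x * a ^ 2 + a - a ^ 2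
      = (x + a * x * a ^ 2 + a ^ 2 * x * a - a + 1) * a - a * x * (a ^ 3 - 1) := by noncomm_ring
  rw [e, h.ax1, h.aaa]; simp

theorem Sat.xaa (h : Sat r a b x y) : x * a ^ 2 + a * x * a + a ^ 2 * x + a ^ 2 = 1 := by
  have e : x * a ^ 2 + a * x * a + a ^ 2 * x + a ^ 2 - 1
      = (x + a * x * a ^ 2 + a ^ 2 * x * a - a + 1) * a ^ 2 - a * x * a * (a ^ 3 - 1)
        - (a ^ 2 * x - 1) * (a ^ 3 - 1) := by noncomm_ring
  rw [← sub_eq_zero, e, h.ax1, h.aaa]; simp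

theorem Sat.xxa (h : Sat r a b x y) :
    x ^ 2 * a + x * a * x + a * x ^ 2 + x * a + a * x = 0 := by
  have e : x ^ 2 * a + x * a * x + a * x ^ 2 + x * a + a * x
      = (x ^ 2 + a * x ^ 2 * a ^ 2 + x * a * x * a ^ 2 + x + a * x * a ^ 2) * a
        - (a * x ^ 2 + x * a * x + a * x) * (a ^ 3 - 1) := by noncomm_ring
  rw [e, h.ax2, h.aaa]; simp

theorem Sat.aF (hr : IsPrimitiveRoot r 3) (h : Sat r a b x y) :
    a * elemF r a x = r ^ 2 • (elemF r a x * a) := by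
  have h2 := root_quadratic hr
  have h3 := three_ne_zero_of_root hr
  have e : a * elemF r a x - r ^ 2 • (elemF r a x * a)
      = (r + 1) • (x * a ^ 2 + a * x * a + a ^ 2 * x + a ^ 2 - 1) := by
    have c1 : r ^ 2 = -r - 1 := by linear_combination h2
    have c2 : (r + 2) / 3 = 1 + (r - 1) / 3 := by field_simp; ring
    have haa : a ^ 2 * a = 1 := by rw [← pow_succ, h.aaa]
    have haa' : a * a ^ 2 = 1 := by rw [← pow_succ', h.aaa]
    simp only [elemF, mul_add, add_mul, mul_sub, sub_mul, mul_smul_comm, smul_mul_assoc, haa,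
      haa', ← mul_assoc, ← pow_two]
    simp only [mul_assoc, ← pow_two]
    match_scalars
    · linear_combination (-r) * h2
    · linear_combination (0 : k) * h2
    · field_simp; linear_combination (-r - 1) * h2
    · field_simp; linear_combination (r + 1) * h2
    · field_simp; linear_combination -h2
  rw [← sub_eq_zero, e, h.xaa]; simp

end Identities

/-! ### The Hopf algebra structure -/

section Hopf

variable {k : Type u} [Field k] {r : k} (hr : IsPrimitiveRoot r 3)

section ComulIdentities

variable {S : Type v} [Ring S] [Algebra k S] {a b x y : S}

theorem comul_elemF (r : k) (a x : S) :
    elemF r (a ⊗ₜ[k] a) ((1 : S) ⊗ₜ[k] x + x ⊗ₜ[k] a)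
      = a ⊗ₜ[k] elemF r a x + elemF r a x ⊗ₜ[k] (a ^ 2) := by
  simp only [elemF, mul_add, add_mul, Algebra.TensorProduct.tmul_mul_tmul,
    Algebra.TensorProduct.tmul_pow, TensorProduct.tmul_add, TensorProduct.add_tmul,
    TensorProduct.tmul_sub, TensorProduct.sub_tmul, TensorProduct.tmul_smul,
    ← TensorProduct.smul_tmul', one_mul, mul_one, ← pow_two]
  module

theorem Sat.comul (hr : IsPrimitiveRoot r 3) (h : Sat r a b x y) :
    Sat r (a ⊗ₜ[k] a) (b ⊗ₜ[k] b) ((1 : S) ⊗ₜ[k] x + x ⊗ₜ[k] a)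
      ((1 : S) ⊗ₜ[k] y + y ⊗ₜ[k] b) where
  ba := by simp [h.ba]
  ya := by simp [mul_add, add_mul, h.ya, h.ba]
  bx := by simp [mul_add, add_mul, h.bx, h.ba]
  yx := by simp [mul_add, add_mul, h.yx, h.ba, h.ya, h.bx]; abel
  bby := by simp [mul_add, add_mul, h.bby, TensorProduct.tmul_neg, TensorProduct.neg_tmul]; abel
  ax1 := by
    have e1 : a * x * a ^ 2 + a ^ 2 * x * a + x = a - 1 := by
      rw [← sub_eq_zero, ← h.ax1]; abel
    have e2 : a * a * a ^ 2 = a := by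
      rw [mul_assoc, ← pow_succ', h.aaa, mul_one]
    have e4 : a * a ^ 2 = 1 := by rw [← pow_succ', h.aaa]
    have e5 : a ^ 2 * a = 1 := by rw [← pow_succ, h.aaa]
    have : ((1 : S) ⊗ₜ[k] x + x ⊗ₜ[k] a) + (a ⊗ₜ[k] a) * ((1 : S) ⊗ₜ[k] x + x ⊗ₜ[k] a)
          * (a ⊗ₜ[k] a) ^ 2 + (a ⊗ₜ[k] a) ^ 2 * ((1 : S) ⊗ₜ[k] x + x ⊗ₜ[k] a) * (a ⊗ₜ[k] a)
        = (1 : S) ⊗ₜ[k] (a * x * a ^ 2 + a ^ 2 * x * a + x)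
          + (a * x * a ^ 2 + a ^ 2 * x * a + x) ⊗ₜ[k] a := by
      simp only [mul_add, add_mul, Algebra.TensorProduct.tmul_mul_tmul,
        Algebra.TensorProduct.tmul_pow, TensorProduct.tmul_add, TensorProduct.add_tmul,
        one_mul, mul_one, e2, e4, e5]
      abel
    rw [this, e1]
    simp only [TensorProduct.tmul_sub, TensorProduct.sub_tmul, Algebra.TensorProduct.one_def]
    abel
  ax2 := by
    have e4 : a * a ^ 2 = 1 := by rw [← pow_succ', h.aaa]
    have e5 : a ^ 2 * a = 1 := by rw [← pow_succ, h.aaa]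
    have : ((1 : S) ⊗ₜ[k] x + x ⊗ₜ[k] a) ^ 2
          + (a ⊗ₜ[k] a) * ((1 : S) ⊗ₜ[k] x + x ⊗ₜ[k] a) ^ 2 * (a ⊗ₜ[k] a) ^ 2
          + ((1 : S) ⊗ₜ[k] x + x ⊗ₜ[k] a) * (a ⊗ₜ[k] a) * ((1 : S) ⊗ₜ[k] x + x ⊗ₜ[k] a)
            * (a ⊗ₜ[k] a) ^ 2
          + ((1 : S) ⊗ₜ[k] x + x ⊗ₜ[k] a)
          + (a ⊗ₜ[k] a) * ((1 : S) ⊗ₜ[k] x + x ⊗ₜ[k] a) * (a ⊗ₜ[k] a) ^ 2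
        = (1 : S) ⊗ₜ[k] (x ^ 2 + a * x ^ 2 * a ^ 2 + x * a * x * a ^ 2 + x + a * x * a ^ 2)
          + x ⊗ₜ[k] (x * a + a * x + a ^ 2 * x * a ^ 2 + a - a ^ 2)
          + (a * x * a ^ 2) ⊗ₜ[k] (x * a + a * x + a ^ 2 * x * a ^ 2 + a - a ^ 2)
          + (x ^ 2 + a * x ^ 2 * a ^ 2 + x * a * x * a ^ 2 + x + a * x * a ^ 2)
            ⊗ₜ[k] (a ^ 2) := by
      have q1 : a * (x * a) * a ^ 2 = a * x := by
        rw [mul_assoc, mul_assoc, e4, mul_one]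
      have q2 : a * (a * x) * a ^ 2 = a ^ 2 * x * a ^ 2 := by noncomm_ring
      have q3 : x * a * a ^ 2 = x := by rw [mul_assoc, e4, mul_one]
      have q4 : x * a * a * a ^ 2 = x * a := by rw [mul_assoc, e4, mul_one]
      have q5 : a ^ 2 * a ^ 2 = a := by rw [pow_two, mul_assoc, ← pow_two a, e4, mul_one]
      simp only [pow_two ((1 : S) ⊗ₜ[k] x + x ⊗ₜ[k] a), mul_add, add_mul,
        Algebra.TensorProduct.tmul_mul_tmul,
        Algebra.TensorProduct.tmul_pow, TensorProduct.tmul_add, TensorProduct.add_tmul,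
        TensorProduct.tmul_sub,
        one_mul, mul_one, e4, e5, q1, q2, q3, q4, q5, ← pow_two x, ← pow_two a]
      abel
    rw [this, h.ax2, h.xa]
    simp
  yy := by
    have e1 : ((1 : S) ⊗ₜ[k] y + y ⊗ₜ[k] b) ^ 2 = (1 : S) ⊗ₜ[k] (y ^ 2) + (y ^ 2) ⊗ₜ[k] 1 := by
      have : ((1 : S) ⊗ₜ[k] y + y ⊗ₜ[k] b) ^ 2
          = (1 : S) ⊗ₜ[k] (y ^ 2) + y ⊗ₜ[k] (y * b + b * y) + (y ^ 2) ⊗ₜ[k] (b ^ 2) := by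
        simp only [pow_two, mul_add, add_mul, Algebra.TensorProduct.tmul_mul_tmul,
          TensorProduct.tmul_add, one_mul, mul_one]
        abel
      rw [this, h.bby, h.bb]
      simp
    have e2 : ((1 : S) ⊗ₜ[k] x + x ⊗ₜ[k] a) ^ 2 + ((1 : S) ⊗ₜ[k] x + x ⊗ₜ[k] a) ^ 3
        = (1 : S) ⊗ₜ[k] (x ^ 2 + x ^ 3)
          + x ⊗ₜ[k] (x ^ 2 * a + x * a * x + a * x ^ 2 + x * a + a * x)
          + (x ^ 2) ⊗ₜ[k] (x * a ^ 2 + a * x * a + a ^ 2 * x + a ^ 2)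
          + (x ^ 3) ⊗ₜ[k] (a ^ 3) := by
      simp only [pow_succ, pow_zero, mul_add, add_mul, Algebra.TensorProduct.tmul_mul_tmul,
        TensorProduct.tmul_add, one_mul, mul_one, mul_assoc]
      abel
    rw [e1, e2, h.xxa, h.xaa, h.aaa, h.yy]
    simp only [TensorProduct.tmul_add, TensorProduct.add_tmul, TensorProduct.tmul_zero]
    abel
  bb := by simp [h.bb, Algebra.TensorProduct.one_def]
  aaa := by simp [h.aaa, Algebra.TensorProduct.one_def]
  FFF := by
    rw [comul_elemF]
    have hF := h.aF hr
    have hF3 := h.FFF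
    have h2 := root_quadratic hr
    have h3 : r ^ 3 = 1 := hr.pow_eq_one
    generalize elemF r a x = F at hF hF3
    have hF2 : a ^ 2 * F = r • (F * a ^ 2) := by
      rw [pow_two, mul_assoc, hF, mul_smul_comm, ← mul_assoc, hF, smul_mul_assoc, smul_smul,
        mul_assoc]
      congr 1
      linear_combination r * h3
    -- the two summands commute up to a primitive third root of unity
    have huv : (a ⊗ₜ[k] F) * (F ⊗ₜ[k] (a ^ 2)) = r • ((F ⊗ₜ[k] (a ^ 2)) * (a ⊗ₜ[k] F)) := by
      rw [Algebra.TensorProduct.tmul_mul_tmul, Algebra.TensorProduct.tmul_mul_tmul, hF, hF2,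
        TensorProduct.tmul_smul, ← TensorProduct.smul_tmul', smul_smul, pow_two]
    have hu : (a ⊗ₜ[k] F) ^ 3 = 0 := by
      rw [Algebra.TensorProduct.tmul_pow, hF3, TensorProduct.tmul_zero]
    have hv : (F ⊗ₜ[k] (a ^ 2)) ^ 3 = 0 := by
      rw [Algebra.TensorProduct.tmul_pow, hF3, TensorProduct.zero_tmul]
    generalize a ⊗ₜ[k] F = U at huv hu
    generalize F ⊗ₜ[k] (a ^ 2) = V at huv hv
    have e : (U + V) ^ 3 = U ^ 3 + V ^ 3 + (U * (U * V) + U * V * U + V * U * U)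
        + (U * V * V + V * (U * V) + V * V * U) := by noncomm_ring
    have e1 : U * (U * V) = (r ^ 2) • (V * U * U) := by
      rw [huv, mul_smul_comm, ← mul_assoc, huv, smul_mul_assoc, smul_smul, pow_two]
    have e2 : U * V * U = r • (V * U * U) := by rw [huv, smul_mul_assoc]
    have e3 : U * V * V = (r ^ 2) • (V * V * U) := by
      rw [huv, smul_mul_assoc, mul_assoc, huv, mul_smul_comm, smul_smul, pow_two, mul_assoc]
    have e4 : V * (U * V) = r • (V * V * U) := by rw [huv, mul_smul_comm, mul_assoc]
    rw [e, hu, hv, e1, e2, e3, e4]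
    match_scalars
    · linear_combination h2
    · linear_combination h2

theorem Sat.conj (h : Sat r a b x y) :
    a ^ 2 * x * a = a - 1 - x - a * x * a ^ 2 := by
  rw [← sub_eq_zero, ← h.ax1]; abel

theorem Sat.ax2' (h : Sat r a b x y) :
    x ^ 2 + (a * x * a ^ 2) ^ 2 + x * (a * x * a ^ 2) + x + a * x * a ^ 2 = 0 := by
  have e : (a * x * a ^ 2) ^ 2 = a * x ^ 2 * a ^ 2 := by
    have : (a * x * a ^ 2) ^ 2 = a * x * a ^ 3 * x * a ^ 2 := by noncomm_ring
    rw [this, h.aaa]; noncomm_ring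
  rw [e, ← h.ax2]; simp only [mul_assoc]

theorem Sat.ax2'' (h : Sat r a b x y) :
    (a ^ 2 * x * a) ^ 2 + x ^ 2 + a ^ 2 * x * a * x + a ^ 2 * x * a + x = 0 := by
  have e : a ^ 2 * (x ^ 2 + a * x ^ 2 * a ^ 2 + x * a * x * a ^ 2 + x + a * x * a ^ 2) * a
      = a ^ 2 * x * x * a + a ^ 3 * x ^ 2 * a ^ 3 + a ^ 2 * x * a * x * a ^ 3 + a ^ 2 * x * a
        + a ^ 3 * x * a ^ 3 := by noncomm_ring
  have e' : (a ^ 2 * x * a) ^ 2 = a ^ 2 * x * a ^ 3 * x * a := by noncomm_ring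
  rw [h.ax2, h.aaa] at e
  rw [e', h.aaa]
  simp only [mul_zero, zero_mul, one_mul, mul_one] at e ⊢
  rw [e]

theorem Sat.antipode (h : Sat r a b x y) :
    Sat r (MulOpposite.op (a ^ 2)) (MulOpposite.op b) (MulOpposite.op (-(x * a ^ 2)))
      (MulOpposite.op (-(y * b))) where
  ba := by
    apply MulOpposite.unop_injective
    simp only [MulOpposite.unop_mul, MulOpposite.unop_op, pow_two, mul_assoc, ← h.ba]
    rw [← mul_assoc b, h.ba, mul_assoc, h.ba]
  ya := by
    apply MulOpposite.unop_injective
    have e : a * (y * b) = y * b * a := by rw [← mul_assoc, ← h.ya, mul_assoc, mul_assoc, h.ba]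
    simp only [MulOpposite.unop_mul, MulOpposite.unop_op, pow_two, mul_neg, neg_mul]
    rw [mul_assoc, e, ← mul_assoc, e, mul_assoc]
  bx := by
    apply MulOpposite.unop_injective
    simp only [MulOpposite.unop_mul, MulOpposite.unop_op, pow_two, mul_neg, neg_mul]
    have e : b * (x * (a * a)) = x * (a * a) * b := by
      rw [← mul_assoc, h.bx, mul_assoc, ← mul_assoc b, h.ba, mul_assoc a, h.ba]
      simp only [mul_assoc]
    rw [e]
  yx := by
    apply MulOpposite.unop_injective
    simp only [MulOpposite.unop_mul, MulOpposite.unop_op, pow_two, mul_neg, neg_mul, neg_neg]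
    have e : b * (x * (a * a)) = x * (a * a) * b := by
      rw [← mul_assoc, h.bx, mul_assoc, ← mul_assoc b, h.ba, mul_assoc a, h.ba]
      simp only [mul_assoc]
    have e' : y * (x * (a * a)) = x * (a * a) * y := by
      rw [← mul_assoc, h.yx, mul_assoc, ← mul_assoc y, h.ya, mul_assoc a, h.ya]
      simp only [mul_assoc]
    rw [mul_assoc y, e, ← mul_assoc y, e', mul_assoc _ y b]
  bby := by
    apply MulOpposite.unop_injective
    simp only [MulOpposite.unop_mul, MulOpposite.unop_op, MulOpposite.unop_neg, mul_neg, neg_mul,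
      neg_neg]
    rw [← mul_assoc b, h.bby]
    simp
  ax1 := by
    apply MulOpposite.unop_injective
    have e : a * (-(x * a ^ 2)) = -(a * x * a ^ 2) := by noncomm_ring
    have e4 : a ^ 2 * a ^ 2 = a := by
      rw [← pow_add, show 2 + 2 = 3 + 1 from rfl, pow_succ, h.aaa, one_mul]
    have e5 : a ^ 2 * a = 1 := by rw [← pow_succ, h.aaa]
    simp only [MulOpposite.unop_mul, MulOpposite.unop_op, MulOpposite.unop_add,
      MulOpposite.unop_sub, MulOpposite.unop_pow, MulOpposite.unop_one, MulOpposite.unop_zero,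
      pow_two (a ^ 2), e4, mul_neg, neg_mul, mul_assoc, e5, mul_one]
    have h1 := h.xaa
    rw [mul_assoc] at h1
    rw [← h1]
    abel
  ax2 := by
    apply MulOpposite.unop_injective
    have e4 : a ^ 2 * a ^ 2 = a := by
      rw [← pow_add, show 2 + 2 = 3 + 1 from rfl, pow_succ, h.aaa, one_mul]
    simp only [MulOpposite.unop_mul, MulOpposite.unop_op, MulOpposite.unop_add,
      MulOpposite.unop_pow, MulOpposite.unop_zero, pow_two (a ^ 2), e4]
    have h2 := h.ax2'
    have hw := h.conj
    have i1 : (-(x * a ^ 2)) ^ 2 = x * (a ^ 2 * x * a) * a := by noncomm_ring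
    have i2 : a * ((x * (a ^ 2 * x * a) * a) * a ^ 2) = a * x * a ^ 2 * x * a := by
      have : a * ((x * (a ^ 2 * x * a) * a) * a ^ 2) = a * x * a ^ 2 * x * (a * a ^ 3) := by
        noncomm_ring
      rw [this, h.aaa, mul_one]
    have i3 : a * (-(x * a ^ 2) * (a ^ 2 * -(x * a ^ 2)))
        = a * x * a ^ 2 * (a ^ 2 * x * a) * a := by noncomm_ring
    have i4 : a * (-(x * a ^ 2) * a ^ 2) = -(a * x * a ^ 2 * a * a) := by noncomm_ring
    have i5 : -(x * a ^ 2) = -(x * a * a) := by noncomm_ring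
    rw [i1, i2, i3, i4, i5, hw]
    generalize a * x * a ^ 2 = v at h2
    have : x * (a - 1 - x - v) * a + v * x * a + v * (a - 1 - x - v) * a + -(x * a * a)
        + -(v * a * a) = -((x ^ 2 + v ^ 2 + x * v + x + v) * a) := by noncomm_ring
    rw [this, h2]
    simp
  yy := by
    apply MulOpposite.unop_injective
    simp only [MulOpposite.unop_op, MulOpposite.unop_add, MulOpposite.unop_pow]
    have hy : (-(y * b)) ^ 2 = -(y ^ 2) := by
      have : (-(y * b)) ^ 2 = y * (b * y) * b := by noncomm_ring
      rw [this, h.bby]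
      have : y * (-(y * b)) * b = -(y ^ 2 * b ^ 2) := by noncomm_ring
      rw [this, h.bb, mul_one]
    rw [hy, h.yy]
    have h2 := h.ax2''
    have hw := h.conj
    have i1 : (-(x * a ^ 2)) ^ 2 = x * (a ^ 2 * x * a) * a := by noncomm_ring
    have i2 : (-(x * a ^ 2)) ^ 3 = -(x * (a ^ 2 * x * a) * (a * x * a ^ 2)) := by noncomm_ring
    have hv : a * x * a ^ 2 = a - 1 - x - a ^ 2 * x * a := by rw [hw]; abel
    rw [i1, i2, hv]
    generalize a ^ 2 * x * a = w at h2
    have : x * w * a + -(x * w * (a - 1 - x - w))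
        = x * (w ^ 2 + x ^ 2 + w * x + w + x) - (x ^ 2 + x ^ 3) := by noncomm_ring
    rw [this, h2]
    simp
  bb := by
    apply MulOpposite.unop_injective
    simp [h.bb]
  aaa := by
    apply MulOpposite.unop_injective
    simp only [MulOpposite.unop_op, MulOpposite.unop_pow, MulOpposite.unop_one]
    rw [← pow_mul, mul_comm 2 3, pow_mul, h.aaa, one_pow]
  FFF := by
    apply MulOpposite.unop_injective
    have e4 : a ^ 2 * a ^ 2 = a := by
      rw [← pow_add, show 2 + 2 = 3 + 1 from rfl, pow_succ, h.aaa, one_mul]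
    have e5 : a ^ 2 * a = 1 := by rw [← pow_succ, h.aaa]
    have e6 : a * a ^ 2 = 1 := by rw [← pow_succ', h.aaa]
    have e : (elemF r (MulOpposite.op (a ^ 2)) (MulOpposite.op (-(x * a ^ 2)))).unop
        = -(a ^ 2 * elemF r a x * a) := by
      have e7 : a ^ 2 * (a * x) * a = x * a := by rw [← mul_assoc, e5, one_mul]
      have e8 : a ^ 2 * (x * a) * a = a ^ 2 * (x * a ^ 2) := by noncomm_ring
      simp only [elemF, MulOpposite.unop_mul, MulOpposite.unop_op, MulOpposite.unop_add,
        MulOpposite.unop_sub, MulOpposite.unop_pow, MulOpposite.unop_smul, pow_two (a ^ 2), e4,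
        mul_add, add_mul, mul_sub, sub_mul, mul_smul_comm, smul_mul_assoc, e7, e8, e5, one_mul,
        mul_neg, neg_mul, mul_assoc x]
      rw [← pow_two]
      module
    rw [MulOpposite.unop_pow, e]
    have e7 : ∀ F : S, (-(a ^ 2 * F * a)) ^ 3
        = -(a ^ 2 * F * (a * a ^ 2) * F * (a * a ^ 2) * F * a) := by
      intro F; noncomm_ring
    have e8 : ∀ F : S, a ^ 2 * F * 1 * F * 1 * F * a = a ^ 2 * F ^ 3 * a := by
      intro F; noncomm_ring
    rw [e7, e6, e8, h.FFF]
    simp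

end ComulIdentities

/-- The comultiplication: `a, b` are group-like, `Δ(x) = 1 ⊗ x + x ⊗ a`,
`Δ(y) = 1 ⊗ y + y ⊗ b`. -/
noncomputable def comulHom : NodalHopf hr →ₐ[k] NodalHopf hr ⊗[k] NodalHopf hr :=
  lift hr ((sat hr).comul hr)

theorem sat_counit (r : k) : Sat r (1 : k) 1 0 0 := by
  constructor <;> simp [elemF]

/-- The counit: `ε(a) = ε(b) = 1`, `ε(x) = ε(y) = 0`. -/
noncomputable def counitHom : NodalHopf hr →ₐ[k] k := lift hr (sat_counit r)

noncomputable instance : Bialgebra k (NodalHopf hr) :=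
  Bialgebra.ofAlgHom (comulHom hr) (counitHom hr)
    (by apply hom_ext <;> simp [comulHom, TensorProduct.tmul_add, TensorProduct.add_tmul,
          Algebra.TensorProduct.one_def, add_assoc])
    (by apply hom_ext <;> simp [comulHom, counitHom])
    (by apply hom_ext <;> simp [comulHom, counitHom])

@[simp] theorem comul_a : Coalgebra.comul (R := k) (genA hr) = genA hr ⊗ₜ[k] genA hr :=
  lift_a hr _
@[simp] theorem comul_b : Coalgebra.comul (R := k) (genB hr) = genB hr ⊗ₜ[k] genB hr :=
  lift_b hr _
@[simp] theorem comul_x :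
    Coalgebra.comul (R := k) (genX hr) = 1 ⊗ₜ[k] genX hr + genX hr ⊗ₜ[k] genA hr :=
  lift_x hr _
@[simp] theorem comul_y :
    Coalgebra.comul (R := k) (genY hr) = 1 ⊗ₜ[k] genY hr + genY hr ⊗ₜ[k] genB hr :=
  lift_y hr _
@[simp] theorem counit_a : Coalgebra.counit (R := k) (genA hr) = 1 := lift_a hr _
@[simp] theorem counit_b : Coalgebra.counit (R := k) (genB hr) = 1 := lift_b hr _
@[simp] theorem counit_x : Coalgebra.counit (R := k) (genX hr) = 0 := lift_x hr _
@[simp] theorem counit_y : Coalgebra.counit (R := k) (genY hr) = 0 := lift_y hr _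

/-- The antipode as an algebra map to the opposite algebra: `S(a) = a²`, `S(b) = b`,
`S(x) = -xa²`, `S(y) = -yb`. -/
noncomputable def antipodeHom : NodalHopf hr →ₐ[k] (NodalHopf hr)ᵐᵒᵖ :=
  lift hr (sat hr).antipode

/-- The antipode as a linear map. -/
noncomputable def antipodeLin : NodalHopf hr →ₗ[k] NodalHopf hr :=
  (MulOpposite.opLinearEquiv k).symm.toLinearMap ∘ₗ (antipodeHom hr).toLinearMap

theorem antipodeLin_apply (z : NodalHopf hr) :
    antipodeLin hr z = (antipodeHom hr z).unop := rfl

theorem antipodeLin_mul (z w : NodalHopf hr) :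
    antipodeLin hr (z * w) = antipodeLin hr w * antipodeLin hr z := by
  simp [antipodeLin_apply]

theorem conv_left_mul {u v : NodalHopf hr ⊗[k] NodalHopf hr} {c : k}
    (hu : LinearMap.mul' k _ ((antipodeLin hr).rTensor _ u) = algebraMap k _ c) :
    LinearMap.mul' k _ ((antipodeLin hr).rTensor _ (u * v))
      = c • LinearMap.mul' k _ ((antipodeLin hr).rTensor _ v) := by
  induction v with
  | zero => simp
  | add v w hv hw => simp only [mul_add, map_add, hv, hw, smul_add]
  | tmul v w =>
    have : ∀ u : NodalHopf hr ⊗[k] NodalHopf hr,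
        LinearMap.mul' k _ ((antipodeLin hr).rTensor _ (u * v ⊗ₜ[k] w))
          = antipodeLin hr v * LinearMap.mul' k _ ((antipodeLin hr).rTensor _ u) * w := by
      intro u
      induction u with
      | zero => simp
      | add s t hs ht => simp only [add_mul, mul_add, map_add, hs, ht]
      | tmul s t => simp [antipodeLin_mul, mul_assoc]
    rw [this, hu, ← Algebra.commutes, mul_assoc, ← Algebra.smul_def]
    simp

theorem conv_right_mul {u v : NodalHopf hr ⊗[k] NodalHopf hr} {c : k}
    (hv : LinearMap.mul' k _ ((antipodeLin hr).lTensor _ v) = algebraMap k _ c) :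
    LinearMap.mul' k _ ((antipodeLin hr).lTensor _ (u * v))
      = c • LinearMap.mul' k _ ((antipodeLin hr).lTensor _ u) := by
  induction u with
  | zero => simp
  | add u w hu hw => simp only [add_mul, map_add, hu, hw, smul_add]
  | tmul s t =>
    have : ∀ v : NodalHopf hr ⊗[k] NodalHopf hr,
        LinearMap.mul' k _ ((antipodeLin hr).lTensor _ (s ⊗ₜ[k] t * v))
          = s * LinearMap.mul' k _ ((antipodeLin hr).lTensor _ v) * antipodeLin hr t := by
      intro v
      induction v with
      | zero => simp
      | add v w hv hw => simp only [mul_add, add_mul, map_add, hv, hw]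
      | tmul v w => simp [antipodeLin_mul, mul_assoc]
    rw [this, hv, ← Algebra.commutes, mul_assoc, ← Algebra.smul_def]
    simp

theorem conv_left (z : NodalHopf hr) :
    LinearMap.mul' k _ ((antipodeLin hr).rTensor _ (Coalgebra.comul (R := k) z))
      = algebraMap k _ (Coalgebra.counit (R := k) z) := by
  have h := sat hr
  induction z using induction with
  | hc c => simp [antipodeLin_apply, Algebra.TensorProduct.algebraMap_apply]
  | ha => simp [antipodeLin_apply, antipodeHom, ← pow_succ, h.aaa]
  | hb => simp [antipodeLin_apply, antipodeHom, ← pow_two, h.bb]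
  | hx => simp [antipodeLin_apply, antipodeHom, mul_assoc, ← pow_succ, h.aaa]
  | hy => simp [antipodeLin_apply, antipodeHom, mul_assoc, ← pow_two, h.bb]
  | hadd u v hu hv => simp only [map_add, hu, hv]
  | hmul u v hu hv =>
    rw [Bialgebra.comul_mul, conv_left_mul hr hu, hv, Bialgebra.counit_mul, map_mul,
      Algebra.smul_def]

theorem conv_right (z : NodalHopf hr) :
    LinearMap.mul' k _ ((antipodeLin hr).lTensor _ (Coalgebra.comul (R := k) z))
      = algebraMap k _ (Coalgebra.counit (R := k) z) := by
  have h := sat hr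
  induction z using induction with
  | hc c => simp [antipodeLin_apply, Algebra.TensorProduct.algebraMap_apply]
  | ha => simp [antipodeLin_apply, antipodeHom, ← pow_succ', h.aaa]
  | hb => simp [antipodeLin_apply, antipodeHom, ← pow_two, h.bb]
  | hx => simp [antipodeLin_apply, antipodeHom]
  | hy => simp [antipodeLin_apply, antipodeHom]
  | hadd u v hu hv => simp only [map_add, hu, hv]
  | hmul u v hu hv =>
    rw [Bialgebra.comul_mul, conv_right_mul hr hv, hu, Bialgebra.counit_mul, map_mul,
      Algebra.smul_def, Algebra.commutes]

noncomputable instance : HopfAlgebra k (NodalHopf hr) where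
  antipode := antipodeLin hr
  mul_antipode_rTensor_comul := LinearMap.ext (conv_left hr)
  mul_antipode_lTensor_comul := LinearMap.ext (conv_right hr)

end Hopf

/-! ### Coideal subalgebras, Hopf subalgebras, coalgebra Galois extensions -/

section General

variable {k : Type u} [Field k] {A : Type v} [Ring A]

/-- A right coideal subalgebra: `Δ(B) ⊆ B ⊗ A`. -/
def IsRightCoideal [Bialgebra k A] (B : Subalgebra k A) : Prop :=
  ∀ z ∈ B, Coalgebra.comul (R := k) z ∈
    LinearMap.range ((Subalgebra.toSubmodule B).subtype.rTensor A)

/-- A Hopf subalgebra: `Δ(C) ⊆ C ⊗ C` and `S(C) ⊆ C`. -/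
def IsHopfSubalgebra [HopfAlgebra k A] (C : Subalgebra k A) : Prop :=
  (∀ z ∈ C, Coalgebra.comul (R := k) z ∈ LinearMap.range
    (TensorProduct.map (Subalgebra.toSubmodule C).subtype (Subalgebra.toSubmodule C).subtype)) ∧
  ∀ z ∈ C, HopfAlgebra.antipode k z ∈ C

/-- The left ideal `A B⁺` generated by `B⁺ = B ∩ ker ε`, as a `k`-subspace of `A`. -/
def leftAug [Bialgebra k A] (B : Subalgebra k A) : Submodule k A :=
  (Ideal.span {z : A | z ∈ B ∧ Coalgebra.counit (R := k) z = 0}).restrictScalars k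

/-- `A` is free as a right `B`-module. -/
def IsRightFree [Algebra k A] (B : Subalgebra k A) : Prop :=
  Module.Free B.op A

/-- `B` is commutative and `A` is faithfully flat as a right `B`-module. -/
def IsRightFaithfullyFlat [Algebra k A] (B : Subalgebra k A) : Prop :=
  ∃ hB : ∀ z w : B.op, z * w = w * z,
    letI : CommRing B.op := { (inferInstance : Ring B.op) with mul_comm := hB }
    Module.FaithfullyFlat B.op A

/-- The subspace of `A ⊗ A` spanned by all `ub ⊗ w - u ⊗ bw` with `b` in `B`. -/
def balancing [Algebra k A] (B : Subalgebra k A) : Submodule k (A ⊗[k] A) :=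
  Submodule.span k {t | ∃ u w : A, ∃ z ∈ B, t = (u * z) ⊗ₜ[k] w - u ⊗ₜ[k] (z * w)}

/-- The tensor product `A ⊗_B A` of `A` as a right and as a left `B`-module. -/
abbrev BalancedTensor [Algebra k A] (B : Subalgebra k A) : Type _ :=
  (A ⊗[k] A) ⧸ balancing B

variable {D : Type v} [AddCommGroup D] [Module k D] [Coalgebra k D]

/-- The left `D`-coaction `u ↦ π(u₁) ⊗ u₂` on `A` given by a coalgebra map `π : A → D`. -/
noncomputable def leftCoaction [Bialgebra k A] (π : A →ₗc[k] D) : A →ₗ[k] D ⊗[k] A :=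
  π.toLinearMap.rTensor A ∘ₗ Coalgebra.comul

/-- The map `A ⊗ A → D ⊗ A`, `u ⊗ w ↦ π(u₁) ⊗ u₂ w`. -/
noncomputable def preCanonical [Bialgebra k A] (π : A →ₗc[k] D) : A ⊗[k] A →ₗ[k] D ⊗[k] A :=
  (LinearMap.mul' k A).lTensor D ∘ₗ (TensorProduct.assoc k D A A).toLinearMap ∘ₗ
    (leftCoaction π).rTensor A

/-- `B ⊆ A` is a `D`-coalgebra Galois extension: `B` is the algebra of coinvariants, i.e. consists
of all `z` for which the coaction commutes with right multiplication by `z`, and the canonical map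
`A ⊗_B A → D ⊗ A`, `u ⊗ w ↦ π(u₁) ⊗ u₂ w` is (well defined and) bijective. -/
def IsCoalgebraGalois [Bialgebra k A] (B : Subalgebra k A) (π : A →ₗc[k] D) : Prop :=
  (∀ z : A, z ∈ B ↔ ∀ u : A,
    leftCoaction π (u * z) = (LinearMap.mulRight k z).lTensor D (leftCoaction π u)) ∧
  ∃ can : BalancedTensor B →ₗ[k] D ⊗[k] A,
    can ∘ₗ (balancing B).mkQ = preCanonical π ∧ Function.Bijective can

/-- There is a cleaving map: a left `D`-colinear, convolution invertible map `γ : D → A`. -/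
def HasCleavingMap [Bialgebra k A] (π : A →ₗc[k] D) : Prop :=
  ∃ γ : D →ₗ[k] A,
    leftCoaction π ∘ₗ γ = γ.lTensor D ∘ₗ Coalgebra.comul ∧ IsUnit (WithConv.toConv γ)

end General

/-! ### The nodal cubic and the two subalgebras -/

section Nodal

/-- The coordinate ring `k[s,t]/(s² + s³ - t²)` of the nodal cubic. -/
abbrev CoordRing (k : Type u) [Field k] : Type u :=
  MvPolynomial (Fin 2) k ⧸ (Ideal.span {MvPolynomial.X 0 ^ 2 + MvPolynomial.X 0 ^ 3
    - MvPolynomial.X 1 ^ 2} : Ideal (MvPolynomial (Fin 2) k))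

variable {k : Type u} [Field k] {r : k} (hr : IsPrimitiveRoot r 3)

/-- The subalgebra `B` generated by `x + qa` and `y + pb`. -/
noncomputable def subB (p q : k) : Subalgebra k (NodalHopf hr) :=
  Algebra.adjoin k {genX hr + q • genA hr, genY hr + p • genB hr}

/-- The subalgebra `C` generated by `a`, `b` and `F`. -/
noncomputable def subC : Subalgebra k (NodalHopf hr) :=
  Algebra.adjoin k {genA hr, genB hr, genF hr}

end Nodal

end NodalCubic

/-!
The relations that involve only `a` and `x` say that `x = u + v + (a - 1) / 3` for two eigenvectors
`u`, `v` of the conjugation by `a`, with eigenvalues `r`, `r²`, that satisfy the quantum Weyl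
relation `u v - r² v u = (1 - a²) / (3 (1 - r))`, together with `v³ = 0`; here `F = (1 - r) v a`
(`Sat.isWeyl`, `IsWeyl.sat`). Hence `C` is spanned by the 18 monomials `vˡ aⁱ bʲ`. Elements of `C`
can be moved to the left past `x + qa` and `y + pb` at the cost of further elements of `C`, so the
products of `C` with `B` span `A` (`mulMap_surjective`).

For linear independence, `A` acts on the free module of rank 18 over the coordinate ring `k[s, t]`
of the cubic, with basis the monomials (`Model`, `rep`). On the basis vector of `1` the elements
`x + qa` and `y + pb` act as the scalars `s` and `t`, so that evaluation there is inverse to the map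
that sends a family `f_{lij}` in `k[s, t]` to `∑ vˡ aⁱ bʲ f_{lij}(x + qa, y + pb)`. This gives
`B ≅ k[s, t]`, the bijectivity of `C ⊗ B → A` and the freeness of `A` over `B`.

The Galois property and the cleaving map are formal: if `B` is a right coideal subalgebra and `C` a
subcoalgebra of a Hopf algebra `A` with `C ⊗ B → A` bijective, then `c f ↦ ε(f) c` induces a section
`γ` of `A → D = A / A B⁺` which identifies `D` with `C` as a coalgebra. It is left colinear, its
convolution inverse is `S ∘ γ`, and the inverse of the canonical map is
`d ⊗ w ↦ γ(d)₁ ⊗ S(γ(d)₂) w`.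

For a nonzero Hopf ideal `I` when `2 ≠ 0`, the central element `y² = x² + x³` is primitive. Let `T`
be the ideal of all `w` with `f(y²) w ∈ I` for a nonzero polynomial `f`. As `Δ(f(y²))` is
`f(y² ⊗ 1 + 1 ⊗ y²)`, the ideal `T` is prime with respect to the comultiplication: if a multiple
`P Δ(w) R` with `w ∈ T` is a pure tensor `α ⊗ β`, then `α ∈ T` or `β ∈ T`
(`mem_torsionIdeal_or_mem`). Lowest terms in `v`, and commutators and anticommutators with `y`, give
`v² e ∈ T` for some primitive idempotent `e` of `k[a]`, because `k[x, y]` is a domain that is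
integral over `k[y²]`. Primality and twisted commutators with `u` then bring the two idempotents of
eigenvalues `r`, `r²` into `T`, hence `1 - a`, `x`, `y²` and `1` (`one_mem_torsionIdeal`). So
`f(y²) ∈ I` with `f ≠ 0`, and `f(y²)` is a nonzero element of `B` because `y² = (y + pb)² - p²`.
-/

namespace NodalCubic

/-! ### Right coideal subalgebras with a complementary subcoalgebra -/

section CoidealSubalgebra

variable {k : Type u} [Field k] {A : Type v} [Ring A]

section Bialgebra

variable [Bialgebra k A] {B : Subalgebra k A}

theorem mkQ_leftAug_mul (w : A) {z : A} (hz : z ∈ B) :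
    (leftAug B).mkQ (w * z) = Coalgebra.counit (R := k) z • (leftAug B).mkQ w := by
  rw [← map_smul, ← sub_eq_zero, ← map_sub, Submodule.mkQ_apply, Submodule.Quotient.mk_eq_zero]
  have : w * z - Coalgebra.counit (R := k) z • w
      = w * (z - algebraMap k A (Coalgebra.counit (R := k) z)) := by
    rw [mul_sub, ← Algebra.commutes, ← Algebra.smul_def]
  rw [this]
  refine Ideal.mul_mem_left _ _ (Ideal.subset_span ⟨?_, ?_⟩)
  · exact B.sub_mem hz (B.algebraMap_mem _)
  · simp

/-- The induced coaction `u ↦ π(u₁) ⊗ u₂` commutes with right multiplication by elements of a right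
coideal subalgebra `B`. -/
theorem mkQ_rTensor_comul_mul (hB : IsRightCoideal B) (w : A) {z : A} (hz : z ∈ B) :
    (leftAug B).mkQ.rTensor A (Coalgebra.comul (R := k) (w * z))
      = (LinearMap.mulRight k z).lTensor _
          ((leftAug B).mkQ.rTensor A (Coalgebra.comul (R := k) w)) := by
  obtain ⟨s, hs⟩ := hB z hz
  have key : ∀ (t : A ⊗[k] A) (s : Subalgebra.toSubmodule B ⊗[k] A),
      (leftAug B).mkQ.rTensor A (t * (Subalgebra.toSubmodule B).subtype.rTensor A s)
        = (LinearMap.mulRight k (TensorProduct.lid k A ((Coalgebra.counit (R := k)).rTensor A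
            ((Subalgebra.toSubmodule B).subtype.rTensor A s)))).lTensor _
          ((leftAug B).mkQ.rTensor A t) := by
    intro t s
    induction t with
    | zero => simp
    | add t t' h h' => simp only [add_mul, map_add, h, h']
    | tmul p q =>
      induction s with
      | zero => simp
      | add s s' h h' =>
        simp only [mul_add, map_add, h, h', LinearMap.rTensor_tmul, LinearMap.lTensor_tmul,
          LinearMap.mulRight_apply, TensorProduct.tmul_add]
      | tmul b w =>
        simp only [LinearMap.rTensor_tmul, LinearMap.lTensor_tmul, Submodule.subtype_apply,
          Algebra.TensorProduct.tmul_mul_tmul, TensorProduct.lid_tmul, LinearMap.mulRight_apply]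
        rw [mkQ_leftAug_mul p b.2, ← TensorProduct.smul_tmul', mul_smul_comm,
          TensorProduct.tmul_smul]
  rw [Bialgebra.comul_mul, ← hs, key, hs]
  simp

theorem leftAug_isCoideal (hB : IsRightCoideal B) : (leftAug B).IsCoideal := by
  have key : ∀ x ∈ leftAug B, ∀ u : A, Coalgebra.counit (R := k) (u * x) = 0 ∧
      TensorProduct.map (leftAug B).mkQ (leftAug B).mkQ (Coalgebra.comul (R := k) (u * x)) = 0 := by
    intro x hx
    induction hx using Submodule.span_induction with
    | mem z hz =>
      intro u
      refine ⟨by simp [hz.2], ?_⟩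
      rw [← LinearMap.lTensor_comp_rTensor, LinearMap.comp_apply, mkQ_rTensor_comul_mul hB u hz.1,
        ← LinearMap.comp_apply (LinearMap.lTensor _ _) (LinearMap.lTensor _ _),
        ← LinearMap.lTensor_comp]
      have : (leftAug B).mkQ ∘ₗ LinearMap.mulRight k z = 0 := by
        ext w
        simp only [LinearMap.comp_apply, LinearMap.mulRight_apply, mkQ_leftAug_mul w hz.1]
        rw [hz.2, zero_smul, LinearMap.zero_apply]
      rw [this]; simp
    | zero => simp
    | add y z _ _ hy hz =>
      intro u
      simp only [mul_add, map_add, (hy u).1, (hz u).1, (hy u).2, (hz u).2, add_zero, and_self]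
    | smul c z _ hz =>
      intro u
      rw [smul_eq_mul, ← mul_assoc]
      exact hz (u * c)
  exact ⟨fun x hx => by simpa using (key x hx 1).1, fun x hx => by simpa using (key x hx 1).2⟩

variable {D : Type v} [AddCommGroup D] [Module k D] [Coalgebra k D]

theorem preCanonical_tmul (π : A →ₗc[k] D) (u w : A) :
    preCanonical π (u ⊗ₜ[k] w) = (LinearMap.mulRight k w).lTensor D (leftCoaction π u) := by
  simp only [preCanonical, LinearMap.comp_apply, LinearMap.rTensor_tmul]
  generalize leftCoaction π u = t
  induction t with
  | zero => simp
  | add s t hs ht =>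
    simp only [TensorProduct.add_tmul, map_add, hs, ht]
  | tmul d a => simp

/-- The endomorphism `u ⊗ w ↦ u₁ ⊗ f(u₂) w` of `A ⊗ A`. -/
noncomputable def twistedGalois (f : A →ₗ[k] A) : A ⊗[k] A →ₗ[k] A ⊗[k] A :=
  (LinearMap.mul' k A).lTensor A ∘ₗ (TensorProduct.assoc k A A A).toLinearMap ∘ₗ
    (f.lTensor A ∘ₗ Coalgebra.comul).rTensor A

theorem twistedGalois_tmul (f : A →ₗ[k] A) (u w : A) :
    twistedGalois f (u ⊗ₜ[k] w)
      = (LinearMap.mulRight k w ∘ₗ f).lTensor A (Coalgebra.comul (R := k) u) := by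
  simp only [twistedGalois, LinearMap.comp_apply, LinearMap.rTensor_tmul]
  generalize Coalgebra.comul (R := k) u = t
  induction t with
  | zero => simp
  | add s t hs ht => simp only [TensorProduct.add_tmul, map_add, hs, ht]
  | tmul d a => simp

/-- For `f` and `g` with `f * g = ε` in the convolution algebra, the endomorphism of `f` is a left
inverse of that of `g`. -/
theorem twistedGalois_twistedGalois (f g : A →ₗ[k] A)
    (h : ∀ a : A, LinearMap.mul' k A (TensorProduct.map f g (Coalgebra.comul (R := k) a))
      = algebraMap k A (Coalgebra.counit (R := k) a)) (t : A ⊗[k] A) :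
    twistedGalois f (twistedGalois g t) = t := by
  induction t with
  | zero => simp
  | add s t hs ht => simp only [map_add, hs, ht]
  | tmul u w =>
    let L : A ⊗[k] (A ⊗[k] A) →ₗ[k] A ⊗[k] A :=
      (LinearMap.mulRight k w ∘ₗ LinearMap.mul' k A ∘ₗ TensorProduct.map f g).lTensor A
    have h1 : ∀ t : A ⊗[k] A,
        twistedGalois f ((LinearMap.mulRight k w ∘ₗ g).lTensor A t)
          = L (TensorProduct.assoc k A A A ((Coalgebra.comul (R := k)).rTensor A t)) := by
      intro t
      induction t with
      | zero => simp
      | add s t hs ht => simp only [map_add, hs, ht]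
      | tmul p q =>
        simp only [LinearMap.lTensor_tmul, LinearMap.rTensor_tmul, twistedGalois_tmul]
        generalize Coalgebra.comul (R := k) p = t
        induction t with
        | zero => simp
        | add s t hs ht => simp only [TensorProduct.add_tmul, map_add, hs, ht]
        | tmul p q => simp [L, mul_assoc]
    rw [twistedGalois_tmul, h1, Coalgebra.coassoc_apply]
    have h2 : ∀ t : A ⊗[k] A, L ((Coalgebra.comul (R := k)).lTensor A t)
        = (LinearMap.mulRight k w ∘ₗ Algebra.linearMap k A).lTensor A
            ((Coalgebra.counit (R := k)).lTensor A t) := by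
      intro t
      induction t with
      | zero => simp
      | add s t hs ht => simp only [map_add, hs, ht]
      | tmul p q => simp [L, h]
    rw [h2]
    simp

end Bialgebra

section Hopf

variable [HopfAlgebra k A] {B C : Subalgebra k A}

theorem map_eq_of_mem_range {M N : Type*} [AddCommGroup M] [Module k M] [AddCommGroup N]
    [Module k N] {f f' : A →ₗ[k] M} {g g' : A →ₗ[k] N} (hf : ∀ c ∈ C, f c = f' c)
    (hg : ∀ c ∈ C, g c = g' c) {t : A ⊗[k] A}
    (ht : t ∈ LinearMap.range
      (TensorProduct.map (Subalgebra.toSubmodule C).subtype (Subalgebra.toSubmodule C).subtype)) :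
    TensorProduct.map f g t = TensorProduct.map f' g' t := by
  obtain ⟨s, rfl⟩ := ht
  induction s with
  | zero => simp
  | add s t hs ht => simp only [map_add, hs, ht]
  | tmul p q => simp [hf p p.2, hg q q.2]

section Decomposition

variable (hbij : Function.Bijective
  (Submodule.mulMap (Subalgebra.toSubmodule C) (Subalgebra.toSubmodule B)))

/-- The linear equivalence `C ⊗ B ≃ A` given by multiplication. -/
noncomputable def mulEquiv : Subalgebra.toSubmodule C ⊗[k] Subalgebra.toSubmodule B ≃ₗ[k] A :=
  LinearEquiv.ofBijective _ hbij

theorem mulEquiv_symm_mul {c f : A} (hc : c ∈ C) (hf : f ∈ B) :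
    (mulEquiv hbij).symm (c * f) = (⟨c, hc⟩ : Subalgebra.toSubmodule C) ⊗ₜ[k]
      (⟨f, hf⟩ : Subalgebra.toSubmodule B) := by
  rw [LinearEquiv.symm_apply_eq]
  rfl

/-- The projection `cf ↦ ε(f) c` of `A = C ⊗ B` onto `C`. -/
noncomputable def projLeft : A →ₗ[k] A :=
  (TensorProduct.rid k A).toLinearMap ∘ₗ TensorProduct.map (Subalgebra.toSubmodule C).subtype
    (Coalgebra.counit (R := k) ∘ₗ (Subalgebra.toSubmodule B).subtype) ∘ₗ
    (mulEquiv hbij).symm.toLinearMap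

/-- The projection `cf ↦ ε(c) f` of `A = C ⊗ B` onto `B`. -/
noncomputable def projRight : A →ₗ[k] A :=
  (TensorProduct.lid k A).toLinearMap ∘ₗ TensorProduct.map
    (Coalgebra.counit (R := k) ∘ₗ (Subalgebra.toSubmodule C).subtype)
    (Subalgebra.toSubmodule B).subtype ∘ₗ (mulEquiv hbij).symm.toLinearMap

theorem projLeft_mul {c f : A} (hc : c ∈ C) (hf : f ∈ B) :
    projLeft hbij (c * f) = Coalgebra.counit (R := k) f • c := by
  simp [projLeft, mulEquiv_symm_mul hbij hc hf]

theorem projRight_mul {c f : A} (hc : c ∈ C) (hf : f ∈ B) :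
    projRight hbij (c * f) = Coalgebra.counit (R := k) c • f := by
  simp [projRight, mulEquiv_symm_mul hbij hc hf]

theorem induction_mul (hbij : Function.Bijective
    (Submodule.mulMap (Subalgebra.toSubmodule C) (Subalgebra.toSubmodule B)))
    {P : A → Prop} (h0 : P 0) (hadd : ∀ u v, P u → P v → P (u + v))
    (hmul : ∀ c ∈ C, ∀ f ∈ B, P (c * f)) (z : A) : P z := by
  obtain ⟨s, rfl⟩ := hbij.2 z
  induction s with
  | zero => simpa using h0
  | add s t hs ht => simpa using hadd _ _ hs ht
  | tmul c f => simpa using hmul _ c.2 _ f.2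

theorem projLeft_mem (z : A) : projLeft hbij z ∈ C := by
  induction z using induction_mul hbij with
  | h0 => simp
  | hadd u v hu hv => rw [map_add]; exact C.add_mem hu hv
  | hmul c hc f hf => rw [projLeft_mul hbij hc hf]; exact C.smul_mem hc _

theorem projRight_mem (z : A) : projRight hbij z ∈ B := by
  induction z using induction_mul hbij with
  | h0 => simp
  | hadd u v hu hv => rw [map_add]; exact B.add_mem hu hv
  | hmul c hc f hf => rw [projRight_mul hbij hc hf]; exact B.smul_mem hf _

theorem leftAug_le_ker_projLeft : leftAug B ≤ LinearMap.ker (projLeft hbij) := by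
  intro x hx
  suffices h : ∀ u : A, projLeft hbij (u * x) = 0 by simpa using h 1
  induction hx using Submodule.span_induction with
  | mem z hz =>
    intro u
    induction u using induction_mul hbij with
    | h0 => simp
    | hadd u v hu hv => rw [add_mul, map_add, hu, hv, add_zero]
    | hmul c hc f hf =>
      rw [mul_assoc, projLeft_mul hbij hc (B.mul_mem hf hz.1), Bialgebra.counit_mul, hz.2,
        mul_zero, zero_smul]
  | zero => simp
  | add y z _ _ hy hz => intro u; rw [mul_add, map_add, hy, hz, add_zero]
  | smul c z _ hz => intro u; rw [smul_eq_mul, ← mul_assoc]; exact hz _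

/-- The section `D = A / AB⁺ → A` of the quotient map whose image is `C`. -/
noncomputable def cleaving : A ⧸ leftAug B →ₗ[k] A :=
  (leftAug B).liftQ (projLeft hbij) (leftAug_le_ker_projLeft hbij)

theorem cleaving_mkQ (z : A) : cleaving hbij ((leftAug B).mkQ z) = projLeft hbij z := rfl

theorem cleaving_mem (d : A ⧸ leftAug B) : cleaving hbij d ∈ C := by
  obtain ⟨z, rfl⟩ := (leftAug B).mkQ_surjective d
  exact projLeft_mem hbij z

theorem cleaving_mkQ_of_mem {c : A} (hc : c ∈ C) : cleaving hbij ((leftAug B).mkQ c) = c := by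
  rw [cleaving_mkQ]
  simpa using projLeft_mul hbij hc B.one_mem

theorem mkQ_cleaving (d : A ⧸ leftAug B) : (leftAug B).mkQ (cleaving hbij d) = d := by
  obtain ⟨z, rfl⟩ := (leftAug B).mkQ_surjective d
  rw [cleaving_mkQ]
  induction z using induction_mul hbij with
  | h0 => simp
  | hadd u v hu hv => rw [map_add, map_add, map_add, hu, hv]
  | hmul c hc f hf => rw [projLeft_mul hbij hc hf, map_smul, mkQ_leftAug_mul c hf]

/-- The inverse `d ⊗ w ↦ c₁ ⊗ S(c₂) w` of the canonical map, where `c` in `C` lifts `d`. -/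
noncomputable def canonicalInv : (A ⧸ leftAug B) ⊗[k] A →ₗ[k] BalancedTensor B :=
  (balancing B).mkQ ∘ₗ twistedGalois (HopfAlgebra.antipode k) ∘ₗ (cleaving hbij).rTensor A

theorem canonicalInv_apply (t : (A ⧸ leftAug B) ⊗[k] A) :
    canonicalInv hbij t = (balancing B).mkQ
      (twistedGalois (HopfAlgebra.antipode k) ((cleaving hbij).rTensor A t)) := rfl

variable [(leftAug B).IsCoideal]

/-- An element `z` is recovered from the coaction `π(z₁) ⊗ z₂` by applying the section
`A / AB⁺ → C` to the first and the projection onto `B` to the second factor. -/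
theorem mul_cleaving_projRight (hB : IsRightCoideal B)
    (hC : ∀ z ∈ C, Coalgebra.comul (R := k) z ∈ LinearMap.range
      (TensorProduct.map (Subalgebra.toSubmodule C).subtype (Subalgebra.toSubmodule C).subtype))
    (z : A) :
    LinearMap.mul' k A (TensorProduct.map (cleaving hbij) (projRight hbij)
      (leftCoaction (Coalgebra.Quotient.mkQCoalgHom (leftAug B)) z)) = z := by
  change LinearMap.mul' k A (TensorProduct.map (cleaving hbij) (projRight hbij)
      ((leftAug B).mkQ.rTensor A (Coalgebra.comul (R := k) z))) = z
  induction z using induction_mul hbij with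
  | h0 => simp
  | hadd u v hu hv => simp only [map_add, hu, hv]
  | hmul c hc f hf =>
    rw [mkQ_rTensor_comul_mul hB c hf]
    have h1 : ∀ t : A ⊗[k] A, TensorProduct.map (cleaving hbij) (projRight hbij)
        ((LinearMap.mulRight k f).lTensor _ ((leftAug B).mkQ.rTensor A t))
        = TensorProduct.map (cleaving hbij ∘ₗ (leftAug B).mkQ)
            (projRight hbij ∘ₗ LinearMap.mulRight k f) t := by
      intro t
      induction t with
      | zero => simp
      | add s t hs ht => simp only [map_add, hs, ht]
      | tmul p q => simp
    rw [h1, map_eq_of_mem_range (f' := LinearMap.id)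
      (g' := (LinearMap.id (R := k)).smulRight f ∘ₗ Coalgebra.counit (R := k)) _ _ (hC c hc)]
    · have h2 : ∀ t : A ⊗[k] A, LinearMap.mul' k A (TensorProduct.map LinearMap.id
          ((LinearMap.id (R := k)).smulRight f ∘ₗ Coalgebra.counit (R := k)) t)
          = TensorProduct.rid k A ((Coalgebra.counit (R := k)).lTensor A t) * f := by
        intro t
        induction t with
        | zero => simp
        | add s t hs ht => simp only [map_add, add_mul, hs, ht]
        | tmul p q => simp
      rw [h2]
      simp
    · intro c hc
      exact cleaving_mkQ_of_mem hbij hc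
    · intro c hc
      simp [projRight_mul hbij hc hf]

theorem leftCoaction_mkQ_mul (hB : IsRightCoideal B) (u : A) {z : A} (hz : z ∈ B) :
    leftCoaction (Coalgebra.Quotient.mkQCoalgHom (leftAug B)) (u * z)
      = (LinearMap.mulRight k z).lTensor _
          (leftCoaction (Coalgebra.Quotient.mkQCoalgHom (leftAug B)) u) :=
  mkQ_rTensor_comul_mul hB u hz

theorem balancing_le_ker_preCanonical (hB : IsRightCoideal B) :
    balancing B ≤ LinearMap.ker (preCanonical (Coalgebra.Quotient.mkQCoalgHom (leftAug B))) := by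
  refine Submodule.span_le.mpr ?_
  rintro _ ⟨u, w, z, hz, rfl⟩
  rw [SetLike.mem_coe, LinearMap.mem_ker, map_sub, preCanonical_tmul, preCanonical_tmul,
    leftCoaction_mkQ_mul hB u hz, ← LinearMap.comp_apply, ← LinearMap.lTensor_comp, sub_eq_zero]
  congr 2
  ext a
  simp [mul_assoc]

theorem preCanonical_mkQ (t : A ⊗[k] A) :
    preCanonical (Coalgebra.Quotient.mkQCoalgHom (leftAug B)) t
      = (leftAug B).mkQ.rTensor A (twistedGalois LinearMap.id t) := by
  induction t with
  | zero => simp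
  | add s t hs ht => simp only [map_add, hs, ht]
  | tmul u w =>
    rw [preCanonical_tmul, twistedGalois_tmul, LinearMap.comp_id]
    change (LinearMap.mulRight k w).lTensor _ ((leftAug B).mkQ.rTensor A _) = _
    rw [← LinearMap.comp_apply (LinearMap.lTensor _ _), LinearMap.lTensor_comp_rTensor,
      ← LinearMap.comp_apply (LinearMap.rTensor _ _), LinearMap.rTensor_comp_lTensor]

theorem twistedGalois_id_antipode (t : A ⊗[k] A) :
    twistedGalois LinearMap.id (twistedGalois (HopfAlgebra.antipode k) t) = t :=
  twistedGalois_twistedGalois _ _ HopfAlgebra.mul_antipode_lTensor_comul_apply t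

theorem twistedGalois_antipode_id (t : A ⊗[k] A) :
    twistedGalois (HopfAlgebra.antipode k) (twistedGalois LinearMap.id t) = t :=
  twistedGalois_twistedGalois _ _ HopfAlgebra.mul_antipode_rTensor_comul_apply t

theorem canonicalInv_preCanonical_of_mem (hC : ∀ z ∈ C, Coalgebra.comul (R := k) z ∈ LinearMap.range
      (TensorProduct.map (Subalgebra.toSubmodule C).subtype (Subalgebra.toSubmodule C).subtype))
    {c : A} (hc : c ∈ C) (w : A) :
    canonicalInv hbij (preCanonical (Coalgebra.Quotient.mkQCoalgHom (leftAug B)) (c ⊗ₜ[k] w))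
      = (balancing B).mkQ (c ⊗ₜ[k] w) := by
  have : (cleaving hbij).rTensor A ((leftAug B).mkQ.rTensor A
      (twistedGalois LinearMap.id (c ⊗ₜ[k] w))) = twistedGalois LinearMap.id (c ⊗ₜ[k] w) := by
    rw [twistedGalois_tmul, ← LinearMap.comp_apply, ← LinearMap.rTensor_comp,
      ← LinearMap.comp_apply, LinearMap.rTensor_comp_lTensor]
    exact map_eq_of_mem_range (f := cleaving hbij ∘ₗ (leftAug B).mkQ) (f' := LinearMap.id)
      (g := LinearMap.mulRight k w ∘ₗ LinearMap.id) (g' := LinearMap.mulRight k w ∘ₗ LinearMap.id)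
      (fun c hc => cleaving_mkQ_of_mem hbij hc) (fun c hc => rfl) (hC c hc)
  rw [preCanonical_mkQ, canonicalInv_apply, this, twistedGalois_antipode_id]

theorem canonicalInv_preCanonical (hB : IsRightCoideal B)
    (hC : ∀ z ∈ C, Coalgebra.comul (R := k) z ∈ LinearMap.range
      (TensorProduct.map (Subalgebra.toSubmodule C).subtype (Subalgebra.toSubmodule C).subtype))
    (t : A ⊗[k] A) :
    canonicalInv hbij (preCanonical (Coalgebra.Quotient.mkQCoalgHom (leftAug B)) t)
      = (balancing B).mkQ t := by
  induction t with
  | zero => simp only [map_zero]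
  | add s t hs ht => simp only [map_add, hs, ht]
  | tmul u w =>
    induction u using induction_mul hbij with
    | h0 => simp only [TensorProduct.zero_tmul, map_zero]
    | hadd u v hu hv => simp only [TensorProduct.add_tmul, map_add, hu, hv]
    | hmul c hc f hf =>
      have hmem : (c * f) ⊗ₜ[k] w - c ⊗ₜ[k] (f * w) ∈ balancing B :=
        Submodule.subset_span ⟨c, w, f, hf, rfl⟩
      have e1 := LinearMap.mem_ker.mp (balancing_le_ker_preCanonical hB hmem)
      rw [map_sub, sub_eq_zero] at e1
      have e2 := (Submodule.Quotient.eq (balancing B)).mpr hmem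
      rw [e1, canonicalInv_preCanonical_of_mem hbij hC hc, Submodule.mkQ_apply,
        Submodule.mkQ_apply, e2]

theorem liftQ_preCanonical_canonicalInv (hB : IsRightCoideal B) (t : (A ⧸ leftAug B) ⊗[k] A) :
    (balancing B).liftQ _ (balancing_le_ker_preCanonical hB) (canonicalInv hbij t) = t := by
  rw [canonicalInv_apply, Submodule.mkQ_apply, Submodule.liftQ_apply, preCanonical_mkQ,
    twistedGalois_id_antipode, ← LinearMap.comp_apply, ← LinearMap.rTensor_comp]
  have : (leftAug B).mkQ ∘ₗ cleaving hbij = LinearMap.id := LinearMap.ext (mkQ_cleaving hbij)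
  rw [this, LinearMap.rTensor_id, LinearMap.id_apply]

/-- A right coideal subalgebra with a complementary subcoalgebra `C` gives a coalgebra Galois
extension. -/
theorem isCoalgebraGalois_of_mulMap_bijective (hbij : Function.Bijective
    (Submodule.mulMap (Subalgebra.toSubmodule C) (Subalgebra.toSubmodule B)))
    (hB : IsRightCoideal B)
    (hC : ∀ z ∈ C, Coalgebra.comul (R := k) z ∈ LinearMap.range
      (TensorProduct.map (Subalgebra.toSubmodule C).subtype (Subalgebra.toSubmodule C).subtype)) :
    IsCoalgebraGalois B (Coalgebra.Quotient.mkQCoalgHom (leftAug B)) := by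
  refine ⟨fun z => ⟨fun hz u => leftCoaction_mkQ_mul hB u hz, fun h => ?_⟩,
    (balancing B).liftQ _ (balancing_le_ker_preCanonical hB), Submodule.liftQ_mkQ _ _ _, ?_⟩
  · have h1 := h 1
    rw [one_mul] at h1
    have h2 := mul_cleaving_projRight hbij hB hC z
    have h3 : leftCoaction (Coalgebra.Quotient.mkQCoalgHom (leftAug B)) (1 : A)
        = (leftAug B).mkQ 1 ⊗ₜ[k] 1 := by
      simp [leftCoaction, Algebra.TensorProduct.one_def]
    rw [h1, h3] at h2
    simp only [LinearMap.lTensor_tmul, LinearMap.mulRight_apply, one_mul, TensorProduct.map_tmul,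
      LinearMap.mul'_apply, cleaving_mkQ_of_mem hbij C.one_mem] at h2
    exact h2 ▸ projRight_mem hbij z
  · refine Function.bijective_iff_has_inverse.mpr ⟨canonicalInv hbij, fun t => ?_,
      liftQ_preCanonical_canonicalInv hbij hB⟩
    obtain ⟨s, rfl⟩ := (balancing B).mkQ_surjective t
    exact canonicalInv_preCanonical hbij hB hC s

/-- The section of `A → A / AB⁺` with image `C` is a cleaving map: it is a coalgebra isomorphism
onto `C`, so composition with the antipode gives a convolution inverse. -/
theorem hasCleavingMap_of_mulMap_bijective (hbij : Function.Bijective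
    (Submodule.mulMap (Subalgebra.toSubmodule C) (Subalgebra.toSubmodule B)))
    (hC : ∀ z ∈ C, Coalgebra.comul (R := k) z ∈ LinearMap.range
      (TensorProduct.map (Subalgebra.toSubmodule C).subtype (Subalgebra.toSubmodule C).subtype)) :
    HasCleavingMap (Coalgebra.Quotient.mkQCoalgHom (leftAug B)) := by
  have hlift : ∀ d : A ⧸ leftAug B, ∃ c ∈ C, (leftAug B).mkQ c = d :=
    fun d => ⟨_, cleaving_mem hbij d, mkQ_cleaving hbij d⟩
  have hid : ∀ c ∈ C, (cleaving hbij ∘ₗ (leftAug B).mkQ) c = LinearMap.id (R := k) c :=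
    fun c hc => cleaving_mkQ_of_mem hbij hc
  have hcomul : ∀ c : A, Coalgebra.comul (R := k) ((leftAug B).mkQ c)
      = TensorProduct.map (leftAug B).mkQ (leftAug B).mkQ (Coalgebra.comul (R := k) c) :=
    fun c => rfl
  have hl : ∀ c ∈ C, LinearMap.mul' k A (TensorProduct.map (cleaving hbij)
      (HopfAlgebra.antipode k ∘ₗ cleaving hbij) (Coalgebra.comul (R := k) ((leftAug B).mkQ c)))
      = algebraMap k A (Coalgebra.counit (R := k) c) := by
    intro c hc
    have := map_eq_of_mem_range (f := cleaving hbij ∘ₗ (leftAug B).mkQ) (f' := LinearMap.id)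
      (g := (HopfAlgebra.antipode k ∘ₗ cleaving hbij) ∘ₗ (leftAug B).mkQ)
      (g' := HopfAlgebra.antipode k) hid
      (fun c hc => congrArg (HopfAlgebra.antipode k (A := A)) (hid c hc)) (hC c hc)
    rw [TensorProduct.map_comp, LinearMap.comp_apply] at this
    rw [hcomul, this]
    exact HopfAlgebra.mul_antipode_lTensor_comul_apply (R := k) c
  have hr : ∀ c ∈ C, LinearMap.mul' k A (TensorProduct.map
      (HopfAlgebra.antipode k ∘ₗ cleaving hbij) (cleaving hbij)
      (Coalgebra.comul (R := k) ((leftAug B).mkQ c)))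
      = algebraMap k A (Coalgebra.counit (R := k) c) := by
    intro c hc
    have := map_eq_of_mem_range (f := (HopfAlgebra.antipode k ∘ₗ cleaving hbij) ∘ₗ (leftAug B).mkQ)
      (f' := HopfAlgebra.antipode k) (g := cleaving hbij ∘ₗ (leftAug B).mkQ) (g' := LinearMap.id)
      (fun c hc => congrArg (HopfAlgebra.antipode k (A := A)) (hid c hc)) hid (hC c hc)
    rw [TensorProduct.map_comp, LinearMap.comp_apply] at this
    rw [hcomul, this]
    exact HopfAlgebra.mul_antipode_rTensor_comul_apply (R := k) c
  have hunit : IsUnit (WithConv.toConv (cleaving hbij)) := by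
    refine ⟨⟨WithConv.toConv (cleaving hbij),
      WithConv.toConv (HopfAlgebra.antipode k ∘ₗ cleaving hbij), ?_, ?_⟩, rfl⟩
    · refine WithConv.ofConv_injective (LinearMap.ext fun d => ?_)
      obtain ⟨c, hc, rfl⟩ := hlift d
      exact hl c hc
    · refine WithConv.ofConv_injective (LinearMap.ext fun d => ?_)
      obtain ⟨c, hc, rfl⟩ := hlift d
      exact hr c hc
  refine ⟨cleaving hbij, ?_, hunit⟩
  ext c'
  obtain ⟨c, hc, h⟩ := hlift ((leftAug B).mkQ c')
  change leftCoaction _ (cleaving hbij ((leftAug B).mkQ c'))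
    = (cleaving hbij).lTensor _ (Coalgebra.comul ((leftAug B).mkQ c'))
  rw [← h, cleaving_mkQ_of_mem hbij hc, hcomul, ← LinearMap.comp_apply,
    LinearMap.lTensor_comp_map]
  exact (map_eq_of_mem_range (f := (leftAug B).mkQ) (f' := (leftAug B).mkQ)
    (g := cleaving hbij ∘ₗ (leftAug B).mkQ) (g' := LinearMap.id)
    (fun _ _ => rfl) hid (hC c hc)).symm

end Decomposition

end Hopf

end CoidealSubalgebra

/-! ### A quantum Weyl algebra presentation -/

section Weyl

variable {k : Type u} [Field k] {r : k} {S : Type v} [Ring S] [Algebra k S] {a b x y u v : S}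

/-- The relations of a quantum Weyl-type algebra: `a` has order three and scales `u` and `v` by the
inverse roots of unity `r` and `r²`, the element `v` is nilpotent of order three, and
`uv - r² vu = (1 - a²) / (3 (1 - r))`. -/
structure IsWeyl (r : k) (a u v : S) : Prop where
  aaa : a ^ 3 = 1
  au : a * u = r • (u * a)
  av : a * v = r ^ 2 • (v * a)
  uv : u * v = r ^ 2 • (v * u) + (3 * (1 - r))⁻¹ • (1 - a ^ 2)
  vvv : v ^ 3 = 0

theorem one_sub_root_ne_zero (hr : IsPrimitiveRoot r 3) : 1 - r ≠ 0 :=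
  sub_ne_zero.mpr (hr.ne_one (by norm_num)).symm

theorem elemF_add (hr : IsPrimitiveRoot r 3) (au : a * u = r • (u * a))
    (av : a * v = r ^ 2 • (v * a)) :
    elemF r a (u + v + (3 : k)⁻¹ • (a - 1)) = (1 - r) • (v * a) := by
  have h2 := root_quadratic hr
  have h3 := three_ne_zero_of_root hr
  simp only [elemF, mul_add, add_mul, mul_smul_comm, smul_mul_assoc, au, av, mul_sub, sub_mul,
    mul_one, one_mul, pow_two]
  match_scalars <;> field_simp
  · linear_combination h2
  · linear_combination r * h2
  · ring
  · ring

theorem expand_ax1 (hr : IsPrimitiveRoot r 3) (aaa : a ^ 3 = 1) (au : a * u = r • (u * a))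
    (av : a * v = r ^ 2 • (v * a)) :
    (u + v + (3 : k)⁻¹ • (a - 1)) + a * (u + v + (3 : k)⁻¹ • (a - 1)) * a ^ 2
      + a ^ 2 * (u + v + (3 : k)⁻¹ • (a - 1)) * a - a + 1 = 0 := by
  have h2 := root_quadratic hr
  have h3 := three_ne_zero_of_root hr
  have aaa' : a * (a * a) = 1 := by rw [← aaa]; noncomm_ring
  have au' : ∀ w, a * (u * w) = r • (u * (a * w)) := fun w => by
    rw [← mul_assoc, au, smul_mul_assoc, mul_assoc]
  have av' : ∀ w, a * (v * w) = r ^ 2 • (v * (a * w)) := fun w => by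
    rw [← mul_assoc, av, smul_mul_assoc, mul_assoc]
  simp only [mul_add, add_mul, mul_smul_comm, smul_mul_assoc, au, av, au', av', mul_sub, sub_mul,
    mul_one, one_mul, pow_two, mul_assoc, aaa', smul_smul]
  match_scalars <;> field_simp
  · linear_combination h2
  · linear_combination (r ^ 2 - r + 1) * h2
  · ring
  · ring

theorem expand_ax2 (hr : IsPrimitiveRoot r 3) (aaa : a ^ 3 = 1) (au : a * u = r • (u * a))
    (av : a * v = r ^ 2 • (v * a)) (hx : x = u + v + (3 : k)⁻¹ • (a - 1)) :
    x ^ 2 + a * x ^ 2 * a ^ 2 + x * a * x * a ^ 2 + x + a * x * a ^ 2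
      = (1 - r) • (u * v - r ^ 2 • (v * u) - (3 * (1 - r))⁻¹ • (1 - a ^ 2)) := by
  have h2 := root_quadratic hr
  have h3 := three_ne_zero_of_root hr
  have h4 := one_sub_root_ne_zero hr
  have aaa' : a * (a * a) = 1 := by rw [← aaa]; noncomm_ring
  have au' : ∀ w, a * (u * w) = r • (u * (a * w)) := fun w => by
    rw [← mul_assoc, au, smul_mul_assoc, mul_assoc]
  have av' : ∀ w, a * (v * w) = r ^ 2 • (v * (a * w)) := fun w => by
    rw [← mul_assoc, av, smul_mul_assoc, mul_assoc]
  have r3 : r ^ 3 = 1 := hr.pow_eq_one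
  subst hx
  simp only [mul_add, add_mul, mul_smul_comm, smul_mul_assoc, au, av, au', av', mul_sub, sub_mul,
    mul_one, one_mul, pow_two, mul_assoc, aaa', smul_smul, smul_add, smul_sub]
  match_scalars <;> field_simp <;> grind

theorem mul_pow_three_eq (hr : IsPrimitiveRoot r 3) (aaa : a ^ 3 = 1)
    (av : a * v = r ^ 2 • (v * a)) : (v * a) ^ 3 = v ^ 3 := by
  have e : (v * a) ^ 3 = v * (a * v) * (a * v) * a := by noncomm_ring
  have e' : v * (v * a) * (v * a) * a = v * v * (a * v) * a ^ 2 := by noncomm_ring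
  have e'' : v * v * (v * a) * a ^ 2 = v ^ 3 * a ^ 3 := by noncomm_ring
  rw [e, av]
  simp only [mul_smul_comm, smul_mul_assoc]
  rw [e', av]
  simp only [mul_smul_comm, smul_mul_assoc]
  rw [e'', aaa, mul_one, smul_smul, smul_smul]
  have : r ^ 2 * (r ^ 2 * r ^ 2) = 1 := by linear_combination (r ^ 3 + 1) * hr.pow_eq_one
  rw [mul_assoc, this, one_smul]

/-- The Weyl relations imply the defining relations of `A` in which only `a` and `x` occur. -/
theorem IsWeyl.sat (hr : IsPrimitiveRoot r 3) (h : IsWeyl r a u v)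
    (hx : x = u + v + (3 : k)⁻¹ • (a - 1)) (ba : b * a = a * b) (ya : y * a = a * y)
    (bx : b * x = x * b) (yx : y * x = x * y) (bby : b * y = -(y * b))
    (yy : y ^ 2 = x ^ 2 + x ^ 3) (bb : b ^ 2 = 1) : Sat r a b x y where
  ba := ba
  ya := ya
  bx := bx
  yx := yx
  bby := bby
  ax1 := by rw [hx]; exact expand_ax1 hr h.aaa h.au h.av
  ax2 := by
    rw [expand_ax2 hr h.aaa h.au h.av hx, h.uv]
    simp
  yy := yy
  bb := bb
  aaa := h.aaa
  FFF := by
    rw [hx, elemF_add hr h.au h.av]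
    rw [smul_pow, mul_pow_three_eq hr h.aaa h.av, h.vvv, smul_zero]

/-- The defining relations imply the Weyl relations for `v = F a² / (1 - r)` and
`u = x - v - (a - 1) / 3`. -/
theorem Sat.isWeyl (hr : IsPrimitiveRoot r 3) (h : Sat r a b x y)
    (hv : v = (1 - r)⁻¹ • (elemF r a x * a ^ 2)) (hu : u = x - v - (3 : k)⁻¹ • (a - 1)) :
    IsWeyl r a u v := by
  have h2 := root_quadratic hr
  have h3 := three_ne_zero_of_root hr
  have h4 := one_sub_root_ne_zero hr
  have haF := h.aF hr
  have hva : (1 - r) • (v * a) = elemF r a x := by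
    rw [hv, smul_mul_assoc, smul_smul, mul_inv_cancel₀ h4, one_smul, mul_assoc, ← pow_succ, h.aaa,
      mul_one]
  have av : a * v = r ^ 2 • (v * a) := by
    rw [hv, mul_smul_comm, ← mul_assoc, haF, smul_mul_assoc, smul_comm, smul_mul_assoc, mul_assoc,
      mul_assoc, ← pow_succ, ← pow_succ']
  have au : a * u = r • (u * a) := by
    have e : a * x - r • (x * a) = (r * (r + 2) / 3) • (a - a ^ 2) - (r * (1 - r)) • (v * a) := by
      rw [mul_smul, hva, elemF]
      match_scalars <;> grind
    have e' : a * u - r • (u * a) = (a * x - r • (x * a)) - (a * v - r • (v * a))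
        - ((1 - r) / 3) • (a ^ 2 - a) := by
      rw [hu]
      simp only [mul_sub, sub_mul, mul_smul_comm, smul_mul_assoc, mul_one, one_mul, pow_two]
      match_scalars <;> field_simp
      ring
    rw [← sub_eq_zero, e', e, av]
    match_scalars <;> field_simp <;> grind
  refine ⟨h.aaa, au, av, ?_, ?_⟩
  · have e := expand_ax2 hr h.aaa au av (x := x) (by rw [hu]; abel)
    rw [h.ax2] at e
    have := (smul_eq_zero.mp e.symm).resolve_left h4
    rw [sub_sub, sub_eq_zero] at this
    exact this
  · have e : (v * a) ^ 3 = 0 := by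
      have : ((1 - r) • (v * a)) ^ 3 = 0 := by rw [hva, h.FFF]
      rw [smul_pow] at this
      exact (smul_eq_zero.mp this).resolve_left (pow_ne_zero _ h4)
    rw [← mul_pow_three_eq hr h.aaa av, e]

theorem IsWeyl.xxa (hr : IsPrimitiveRoot r 3) (h : IsWeyl r a u v)
    (hx : x = u + v + (3 : k)⁻¹ • (a - 1)) :
    x ^ 2 * a + x * a * x + a * x ^ 2 + x * a + a * x = 0 := by
  have e : x ^ 2 * a + x * a * x + a * x ^ 2 + x * a + a * x
      = (x ^ 2 + a * x ^ 2 * a ^ 2 + x * a * x * a ^ 2 + x + a * x * a ^ 2) * a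
        - (a * x ^ 2 + x * a * x + a * x) * (a ^ 3 - 1) := by noncomm_ring
  rw [e, expand_ax2 hr h.aaa h.au h.av hx, h.uv, h.aaa]
  simp

theorem IsWeyl.xaa (hr : IsPrimitiveRoot r 3) (h : IsWeyl r a u v)
    (hx : x = u + v + (3 : k)⁻¹ • (a - 1)) :
    x * a ^ 2 + a * x * a + a ^ 2 * x + a ^ 2 = 1 := by
  have e : x * a ^ 2 + a * x * a + a ^ 2 * x + a ^ 2 - 1
      = (x + a * x * a ^ 2 + a ^ 2 * x * a - a + 1) * a ^ 2 - a * x * a * (a ^ 3 - 1)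
        - (a ^ 2 * x - 1) * (a ^ 3 - 1) := by noncomm_ring
  rw [← sub_eq_zero, e, hx, expand_ax1 hr h.aaa h.au h.av, h.aaa]
  simp

theorem sq_add_cube_add_smul {q : k} (aaa : a ^ 3 = 1)
    (hxxa : x ^ 2 * a + x * a * x + a * x ^ 2 + x * a + a * x = 0)
    (hxaa : x * a ^ 2 + a * x * a + a ^ 2 * x + a ^ 2 = 1) :
    (x + q • a) ^ 2 + (x + q • a) ^ 3 = x ^ 2 + x ^ 3 + (q ^ 2 + q ^ 3) • 1 := by
  have e : (x + q • a) ^ 2 + (x + q • a) ^ 3 = x ^ 2 + x ^ 3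
      + q • (x ^ 2 * a + x * a * x + a * x ^ 2 + x * a + a * x)
      + q ^ 2 • (x * a ^ 2 + a * x * a + a ^ 2 * x + a ^ 2) + q ^ 3 • a ^ 3 := by
    simp only [pow_succ, pow_zero, one_mul, mul_add, add_mul, mul_smul_comm, smul_mul_assoc,
      mul_assoc]
    module
  rw [e, hxxa, hxaa, aaa]
  module

theorem commute_sq_add_cube (hxxa : x ^ 2 * a + x * a * x + a * x ^ 2 + x * a + a * x = 0) :
    Commute (x ^ 2 + x ^ 3) a := by
  have e : (x ^ 2 + x ^ 3) * a - a * (x ^ 2 + x ^ 3)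
      = x * (x ^ 2 * a + x * a * x + a * x ^ 2 + x * a + a * x)
        - (x ^ 2 * a + x * a * x + a * x ^ 2 + x * a + a * x) * x := by noncomm_ring
  rw [Commute, SemiconjBy, ← sub_eq_zero, e, hxxa]
  simp

theorem IsWeyl.commute_sq_add_cube (hr : IsPrimitiveRoot r 3) (h : IsWeyl r a u v)
    (hx : x = u + v + (3 : k)⁻¹ • (a - 1)) : Commute (x ^ 2 + x ^ 3) v := by
  have ha := NodalCubic.commute_sq_add_cube (h.xxa hr hx)
  have hxx : Commute (x ^ 2 + x ^ 3) x :=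
    ((Commute.refl x).pow_left 2).add_left ((Commute.refl x).pow_left 3)
  have hF : Commute (x ^ 2 + x ^ 3) (elemF r a x) := by
    have e : elemF r a x = x * a + (r + 1) • (a * x) + ((r + 2) / 3) • (a - a ^ 2) := rfl
    rw [e]
    exact ((hxx.mul_right ha).add_right ((ha.mul_right hxx).smul_right _)).add_right
      ((ha.sub_right (ha.pow_right 2)).smul_right _)
  rw [hx, elemF_add hr h.au h.av, ← hx] at hF
  have hva := hF.smul_right (1 - r)⁻¹
  rw [smul_smul, inv_mul_cancel₀ (one_sub_root_ne_zero hr), one_smul] at hva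
  have e : v = v * a * a ^ 2 := by rw [mul_assoc, ← pow_succ', h.aaa, mul_one]
  rw [e]
  exact hva.mul_right (ha.pow_right 2)

end Weyl

/-! ### A faithful representation -/

section Model

variable {k : Type u} [Field k] (R : Type v) [CommRing R] [Algebra k R]

/-- The free `R`-module of rank 18 with basis indexed by the monomials `vˡ aⁱ bʲ`. -/
abbrev Model : Type v := Fin 3 → Fin 3 → Fin 2 → R

namespace Model

/-- The basis vector of the monomial `vˡ aⁱ bʲ`. -/
def e (l i : Fin 3) (j : Fin 2) : Model R :=
  fun l' i' j' => if l' = l ∧ i' = i ∧ j' = j then 1 else 0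

/-- Left multiplication by `a`. -/
def opA (r : k) : Module.End R (Model R) where
  toFun f l i j := (r ^ 2) ^ (l : ℕ) • f l (i + 2) j
  map_add' f g := by ext; simp
  map_smul' c f := by ext; simp

/-- Left multiplication by `v`. -/
def opV : Module.End R (Model R) where
  toFun f l i j := ![0, f 0 i j, f 1 i j] l
  map_add' f g := by ext l; fin_cases l <;> simp
  map_smul' c f := by ext l; fin_cases l <;> simp

/-- Multiplication by `b`. -/
def opB : Module.End R (Model R) where
  toFun f l i j := f l i (j + 1)
  map_add' f g := by ext; simp
  map_smul' c f := by ext; simp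

/-- The automorphism `σ` with `σ(a) = r² a`, `σ(v) = r² v`. -/
def opSigma (r : k) : Module.End R (Model R) where
  toFun f l i j := ((r ^ 2) ^ (l : ℕ) * (r ^ 2) ^ (i : ℕ)) • f l i j
  map_add' f g := by ext; simp
  map_smul' c f := by ext; simp

/-- The `σ`-derivation `δ` with `δ(a) = 0`, `δ(v) = (1 - a²) / (3 (1 - r))`, so that
`uh = σ(h) u + δ(h)`. -/
def opDelta (r : k) : Module.End R (Model R) where
  toFun f l i j := (3 * (1 - r))⁻¹ •
    ![f 1 i j - f 1 (i + 1) j, f 2 (i + 1) j - r • f 2 i j, 0] l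
  map_add' f g := by ext l; fin_cases l <;> simp [← smul_add] <;> congr 1 <;> module
  map_smul' c f := by ext l; fin_cases l <;> simp [mul_sub, smul_sub]

/-- Right multiplication by `a`. -/
def opRA : Module.End R (Model R) where
  toFun f l i j := f l (i + 2) j
  map_add' f g := by ext; simp
  map_smul' c f := by ext; simp

/-- Right multiplication by `v`. -/
def opRV (r : k) : Module.End R (Model R) where
  toFun f l i j := (r ^ 2) ^ (i : ℕ) • ![0, f 0 i j, f 1 i j] l
  map_add' f g := by ext l; fin_cases l <;> simp
  map_smul' c f := by ext l; fin_cases l <;> simp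

/-- The action of `y + pb`, which sends `h` to `ht` and `hb` to `-hbt + 2ph` for `h` in the span
of the `vˡ aⁱ`. -/
def opY (p : k) (t : R) : Module.End R (Model R) where
  toFun f l i j := ![t * f l i 0 + (2 * p) • f l i 1, -(t * f l i 1)] j
  map_add' f g := by ext l i j; fin_cases j <;> simp <;> ring
  map_smul' c f := by
    ext l i j
    fin_cases j
    · simp [mul_add]; ring
    · simp; ring

/-- The action of `u`: it sends `h` to `σ(h) (s - w) + δ(h)`, where `w = v + (a - 1)/3 + qa` is
the difference of `x + qa` and `u`. -/
def opU (r q : k) (s : R) : Module.End R (Model R) :=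
  (s • (1 : Module.End R (Model R))
    - (opRV R r + (3 : k)⁻¹ • (opRA R - 1) + q • opRA R)) * opSigma R r + opDelta R r

variable {r : k}

theorem opA_cube (hr : IsPrimitiveRoot r 3) : opA R r ^ 3 = 1 := by
  have h3 := hr.pow_eq_one
  apply LinearMap.ext; intro f
  ext l i j
  fin_cases l <;> fin_cases i <;> simp [pow_succ, opA, smul_smul] <;> match_scalars <;> grind

theorem opV_cube : opV R ^ 3 = 0 := by
  apply LinearMap.ext; intro f
  ext l i j
  fin_cases l <;> simp [pow_succ, opV]

theorem opA_mul_opV : opA R r * opV R = r ^ 2 • (opV R * opA R r) := by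
  apply LinearMap.ext; intro f
  ext l i j
  fin_cases l <;> simp [opA, opV, smul_smul, pow_succ]

theorem opA_mul_opSigma (hr : IsPrimitiveRoot r 3) :
    opA R r * opSigma R r = r • (opSigma R r * opA R r) := by
  have h3 := hr.pow_eq_one
  apply LinearMap.ext; intro f
  ext l i j
  fin_cases l <;> fin_cases i <;> simp [opA, opSigma, smul_smul] <;> match_scalars <;> grind

theorem opSigma_mul_opV :
    opSigma R r * opV R = r ^ 2 • (opV R * opSigma R r) := by
  apply LinearMap.ext; intro f
  ext l i j
  fin_cases l <;> simp [opV, opSigma, smul_smul]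
  all_goals match_scalars; ring

theorem opA_mul_opDelta (hr : IsPrimitiveRoot r 3) :
    opA R r * opDelta R r = r • (opDelta R r * opA R r) := by
  have h3 := hr.pow_eq_one
  apply LinearMap.ext; intro f
  ext l i j
  fin_cases l <;> fin_cases i <;> simp [opA, opDelta] <;> match_scalars <;> grind

theorem opDelta_mul_opV (hr : IsPrimitiveRoot r 3) :
    opDelta R r * opV R
      = r ^ 2 • (opV R * opDelta R r) + (3 * (1 - r))⁻¹ • (1 - opA R r ^ 2) := by
  have h3 := root_quadratic hr
  apply LinearMap.ext; intro f
  ext l i j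
  fin_cases l <;> fin_cases i <;> simp [opA, opV, opDelta, pow_succ] <;> match_scalars <;> grind

theorem commute_opA_opRA : Commute (opA R r) (opRA R) := by
  apply LinearMap.ext; intro f
  ext l i j
  simp [opA, opRA]

theorem commute_opA_opRV (hr : IsPrimitiveRoot r 3) : Commute (opA R r) (opRV R r) := by
  have h3 := hr.pow_eq_one
  apply LinearMap.ext; intro f
  ext l i j
  fin_cases l <;> fin_cases i <;> simp [opA, opRV] <;> match_scalars <;> grind

theorem commute_opV_opRA : Commute (opV R) (opRA R) := by
  apply LinearMap.ext; intro f
  ext l i j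
  simp [opV, opRA]

theorem commute_opV_opRV : Commute (opV R) (opRV R r) := by
  apply LinearMap.ext; intro f
  ext l i j
  fin_cases l <;> simp [opV, opRV]

theorem commute_opA_smul_sub (hr : IsPrimitiveRoot r 3) (q : k) (s : R) :
    Commute (opA R r) (s • (1 : Module.End R (Model R))
      - (opRV R r + (3 : k)⁻¹ • (opRA R - 1) + q • opRA R)) := by
  refine ((Commute.one_right _).smul_right _).sub_right (((commute_opA_opRV R hr).add_right
    (((commute_opA_opRA R).sub_right (Commute.one_right _)).smul_right _)).add_right
      ((commute_opA_opRA R).smul_right _))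

theorem commute_opV_smul_sub (q : k) (s : R) :
    Commute (opV R) (s • (1 : Module.End R (Model R))
      - (opRV R r + (3 : k)⁻¹ • (opRA R - 1) + q • opRA R)) := by
  refine ((Commute.one_right _).smul_right _).sub_right (((commute_opV_opRV R).add_right
    (((commute_opV_opRA R).sub_right (Commute.one_right _)).smul_right _)).add_right
      ((commute_opV_opRA R).smul_right _))

theorem isWeyl (hr : IsPrimitiveRoot r 3) (q : k) (s : R) :
    IsWeyl r (opA R r) (opU R r q s) (opV R) where
  aaa := opA_cube R hr
  au := by
    rw [opU, mul_add, ← mul_assoc, (commute_opA_smul_sub R hr q s).eq, mul_assoc,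
      opA_mul_opSigma R hr, opA_mul_opDelta R hr, mul_smul_comm, ← smul_add, add_mul, mul_assoc]
  av := opA_mul_opV R
  uv := by
    rw [opU, add_mul, mul_assoc, opSigma_mul_opV, opDelta_mul_opV R hr, mul_smul_comm,
      ← mul_assoc _ (opV R), ← (commute_opV_smul_sub R q s).eq, ← add_assoc, ← smul_add,
      mul_assoc, ← mul_add]
  vvv := opV_cube R

/-- The action of `x`. -/
def opX (r q : k) (s : R) : Module.End R (Model R) :=
  opU R r q s + opV R + (3 : k)⁻¹ • (opA R r - 1)

theorem opX_def (r q : k) (s : R) :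
    opX R r q s = opU R r q s + opV R + (3 : k)⁻¹ • (opA R r - 1) := rfl

theorem commute_opB_opA : Commute (opB R) (opA R r) := by
  apply LinearMap.ext; intro f
  ext l i j
  simp [opA, opB]

theorem commute_opB_opX (q : k) (s : R) : Commute (opB R) (opX R r q s) := by
  apply LinearMap.ext; intro f
  ext l i j
  simp [opX, opU, opRV, opRA, opSigma, opDelta, opV, opA, opB]

theorem commute_opY_opA (p : k) (t : R) : Commute (opY R p t) (opA R r) := by
  apply LinearMap.ext; intro f
  ext l i j
  fin_cases j <;> simp [opA, opY, smul_comm (2 * p)]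

theorem commute_opY_opV (p : k) (t : R) : Commute (opY R p t) (opV R) := by
  apply LinearMap.ext; intro f
  ext l i j
  fin_cases l <;> fin_cases j <;> simp [opV, opY]

theorem commute_opY_opRA (p : k) (t : R) : Commute (opY R p t) (opRA R) := by
  apply LinearMap.ext; intro f
  ext l i j
  fin_cases j <;> simp [opRA, opY]

theorem commute_opY_opRV (p : k) (t : R) : Commute (opY R p t) (opRV R r) := by
  apply LinearMap.ext; intro f
  ext l i j
  fin_cases l <;> fin_cases j <;> simp [opRV, opY, smul_comm (2 * p)]

theorem commute_opY_opSigma (p : k) (t : R) : Commute (opY R p t) (opSigma R r) := by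
  apply LinearMap.ext; intro f
  ext l i j
  fin_cases j <;> simp [opSigma, opY, smul_comm (2 * p)]

theorem commute_opY_opDelta (p : k) (t : R) : Commute (opY R p t) (opDelta R r) := by
  apply LinearMap.ext; intro f
  ext l i j
  fin_cases l <;> fin_cases j <;> simp [opDelta, opY, mul_sub, smul_sub]
  all_goals module

theorem commute_opY_opX (p q : k) (s t : R) : Commute (opY R p t) (opX R r q s) := by
  have h1 := Commute.one_right (opY R p t)
  refine ((Commute.add_right (Commute.mul_right ?_ (commute_opY_opSigma R p t))
    (commute_opY_opDelta R p t)).add_right (commute_opY_opV R p t)).add_right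
      (((commute_opY_opA R p t).sub_right h1).smul_right _)
  exact (h1.smul_right _).sub_right (((commute_opY_opRV R p t).add_right
    (((commute_opY_opRA R p t).sub_right h1).smul_right _)).add_right
      ((commute_opY_opRA R p t).smul_right _))

theorem opB_mul_opY (p : k) (t : R) :
    opB R * opY R p t = -(opY R p t * opB R) + (2 * p) • 1 := by
  apply LinearMap.ext; intro f
  ext l i j
  fin_cases j <;> simp [opB, opY]

theorem opY_sq (p : k) (t : R) : opY R p t ^ 2 = (t ^ 2) • 1 := by
  apply LinearMap.ext; intro f
  ext l i j
  fin_cases j <;> simp [opY, pow_two, mul_add, mul_assoc]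

theorem opB_sq : opB R ^ 2 = 1 := by
  apply LinearMap.ext; intro f
  ext l i j
  fin_cases j <;> simp [opB, pow_two]

theorem opA_e (i : Fin 3) (j : Fin 2) : opA R r (e R 0 i j) = e R 0 (i + 1) j := by
  ext l' i' j'
  fin_cases l' <;> fin_cases i <;> fin_cases i' <;> simp [opA, e]

theorem opV_e (i : Fin 3) (j : Fin 2) : opV R (e R 0 i j) = e R 1 i j := by
  ext l' i' j'
  fin_cases l' <;> simp [opV, e]

theorem opV_e' (i : Fin 3) (j : Fin 2) : opV R (e R 1 i j) = e R 2 i j := by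
  ext l' i' j'
  fin_cases l' <;> simp [opV, e]

theorem opB_e (l i : Fin 3) : opB R (e R l i 0) = e R l i 1 := by
  ext l' i' j'
  fin_cases j' <;> simp [opB, e]

theorem monomial_e (l i : Fin 3) (j : Fin 2) :
    (opV R ^ (l : ℕ) * opA R r ^ (i : ℕ) * opB R ^ (j : ℕ)) (e R 0 0 0) = e R l i j := by
  have h1 : (opB R ^ (j : ℕ)) (e R 0 0 0) = e R 0 0 j := by
    fin_cases j <;> simp [opB_e]
  have h2 : (opA R r ^ (i : ℕ)) (e R 0 0 j) = e R 0 i j := by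
    fin_cases i <;> simp [opA_e, pow_two]
  have h3 : (opV R ^ (l : ℕ)) (e R 0 i j) = e R l i j := by
    fin_cases l <;> simp [opV_e, opV_e', pow_two]
  rw [Module.End.mul_apply, Module.End.mul_apply, h1, h2, h3]

theorem sum_smul_e_apply (f : Model R) (l i : Fin 3) (j : Fin 2) :
    (∑ l', ∑ i', ∑ j', f l' i' j' • e R l' i' j') l i j = f l i j := by
  simp only [Finset.sum_apply, Pi.smul_apply, e, smul_eq_mul, mul_ite, mul_one, mul_zero]
  rw [Finset.sum_eq_single l, Finset.sum_eq_single i, Finset.sum_eq_single j]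
  · simp
  all_goals simp +contextual [eq_comm]

theorem eq_sum_smul_e (f : Model R) : f = ∑ l, ∑ i, ∑ j, f l i j • e R l i j := by
  ext l i j
  rw [sum_smul_e_apply]

/-- An endomorphism commuting with the actions of `v`, `a` and `b` is determined by its value on
the basis vector of the monomial `1`. -/
theorem ext_of_commute {Z W : Module.End R (Model R)} (hA : Commute Z (opA R r))
    (hV : Commute Z (opV R)) (hB : Commute Z (opB R)) (hA' : Commute W (opA R r))
    (hV' : Commute W (opV R)) (hB' : Commute W (opB R)) (h : Z (e R 0 0 0) = W (e R 0 0 0)) :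
    Z = W := by
  apply LinearMap.ext
  intro f
  rw [eq_sum_smul_e R f]
  simp only [map_sum, map_smul]
  refine Finset.sum_congr rfl fun l _ => Finset.sum_congr rfl fun i _ =>
    Finset.sum_congr rfl fun j _ => ?_
  have h1 := (((hV.pow_right (l : ℕ)).mul_right (hA.pow_right (i : ℕ))).mul_right
    (hB.pow_right (j : ℕ))).eq
  have h2 := (((hV'.pow_right (l : ℕ)).mul_right (hA'.pow_right (i : ℕ))).mul_right
    (hB'.pow_right (j : ℕ))).eq
  rw [← monomial_e R (r := r)]
  congr 1
  exact (LinearMap.congr_fun h1 _).trans ((congrArg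
    (opV R ^ (l : ℕ) * opA R r ^ (i : ℕ) * opB R ^ (j : ℕ)) h).trans
    (LinearMap.congr_fun h2 _).symm)

theorem opX_add_e (q : k) (s : R) :
    (opX R r q s + q • opA R r) (e R 0 0 0) = s • e R 0 0 0 := by
  have h1 : opSigma R r (e R 0 0 0) = e R 0 0 0 := by
    ext l i j
    simp only [opSigma, e, LinearMap.coe_mk, AddHom.coe_mk]
    split_ifs with h
    · simp [h.1, h.2.1]
    · simp
  have h2 : opDelta R r (e R 0 0 0) = 0 := by
    ext l i j
    fin_cases l <;> simp [opDelta, e]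
  have h3 : opRA R (e R 0 0 0) = opA R r (e R 0 0 0) := by
    ext l i j
    fin_cases l <;> simp [opRA, opA, e]
  have h4 : opRV R r (e R 0 0 0) = opV R (e R 0 0 0) := by
    ext l i j
    fin_cases l <;> fin_cases i <;> simp [opRV, opV, e]
  simp only [opX, opU, LinearMap.add_apply, LinearMap.sub_apply, LinearMap.smul_apply,
    Module.End.mul_apply, Module.End.one_apply, h1, h2, h3, h4]
  abel

theorem opY_e (p : k) (t : R) : opY R p t (e R 0 0 0) = t • e R 0 0 0 := by
  ext l i j
  fin_cases j <;> simp [opY, e]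

/-- Both sides commute with the actions of `v`, `a` and `b`, so it suffices to evaluate them at the
basis vector of `1`, on which `x + qa` acts as `s`. -/
theorem opX_sq_add_cube (hr : IsPrimitiveRoot r 3) (q : k) (s : R) :
    opX R r q s ^ 2 + opX R r q s ^ 3
      = (s ^ 2 + s ^ 3) • (1 : Module.End R (Model R)) - (q ^ 2 + q ^ 3) • 1 := by
  have hW := isWeyl R hr q s
  have hX := opX_def R r q s
  have h1 : ∀ T : Module.End R (Model R),
      Commute ((s ^ 2 + s ^ 3) • (1 : Module.End R (Model R))) T :=
    fun T => (Commute.one_left T).smul_left _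
  have hk : ∀ T : Module.End R (Model R),
      Commute ((q ^ 2 + q ^ 3) • (1 : Module.End R (Model R))) T :=
    fun T => (Commute.one_left T).smul_left (q ^ 2 + q ^ 3)
  have hB := commute_opB_opX R (r := r) q s
  have hT := opX_add_e R (r := r) q s
  have key := sq_add_cube_add_smul (q := q) hW.aaa (hW.xxa hr hX) (hW.xaa hr hX)
  rw [eq_sub_iff_add_eq]
  refine ext_of_commute (r := r) R ((commute_sq_add_cube (hW.xxa hr hX)).add_left (hk _))
    ((hW.commute_sq_add_cube hr hX).add_left (hk _))
    (((hB.pow_right 2).add_right (hB.pow_right 3)).symm.add_left (hk _))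
    (h1 _) (h1 _) (h1 _) ?_
  rw [← key]
  obtain ⟨T, h⟩ : ∃ T, T = opX R r q s + q • opA R r := ⟨_, rfl⟩
  rw [← h] at hT ⊢
  simp only [pow_succ, pow_zero, one_mul, LinearMap.add_apply, Module.End.mul_apply, hT, map_smul,
    LinearMap.smul_apply, Module.End.one_apply]
  module

theorem opB_mul_opY_sub (p : k) (t : R) :
    opB R * (opY R p t - p • opB R) = -((opY R p t - p • opB R) * opB R) := by
  rw [mul_sub, sub_mul, opB_mul_opY, mul_smul_comm, smul_mul_assoc, ← pow_two, opB_sq]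
  module

theorem opY_sub_sq (p : k) (t : R) :
    (opY R p t - p • opB R) ^ 2 = (t ^ 2) • 1 - (p ^ 2) • 1 := by
  have e : (opY R p t - p • opB R) ^ 2 = opY R p t ^ 2
      - p • (opY R p t * opB R + opB R * opY R p t) + p ^ 2 • opB R ^ 2 := by
    simp only [pow_two, mul_sub, sub_mul, mul_smul_comm, smul_mul_assoc]
    module
  rw [e, opB_mul_opY, opY_sq, opB_sq, add_neg_cancel_left, smul_smul,
    show p * (2 * p) = p ^ 2 + p ^ 2 by ring, add_smul]
  abel

theorem sat (hr : IsPrimitiveRoot r 3) {p q : k} (hpq : p ^ 2 = q ^ 2 + q ^ 3) {s t : R}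
    (hst : t ^ 2 = s ^ 2 + s ^ 3) :
    Sat r (opA R r) (opB R) (opX R r q s) (opY R p t - p • opB R) := by
  refine (isWeyl R hr q s).sat hr (opX_def R r q s) (commute_opB_opA R)
    ((commute_opY_opA R p t).sub_left ((commute_opB_opA R).smul_left p)) (commute_opB_opX R q s)
    ((commute_opY_opX R p q s t).sub_left ((commute_opB_opX R q s).smul_left p))
    (opB_mul_opY_sub R p t) ?_ (opB_sq R)
  rw [opX_sq_add_cube R hr, opY_sub_sq, hst, hpq]

end Model

end Model

/-! ### The coideal property of `B` and `C` -/

section Coideals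

variable {k : Type u} [Field k] {r : k} (hr : IsPrimitiveRoot r 3) (p q : k)

theorem comul_genF : Coalgebra.comul (R := k) (genF hr)
    = genA hr ⊗ₜ[k] genF hr + genF hr ⊗ₜ[k] (genA hr ^ 2) := by
  have h : Coalgebra.comul (R := k) (genF hr) = comulHom hr (elemF r (genA hr) (genX hr)) := rfl
  rw [h, map_elemF, comulHom, lift_a, lift_x, comul_elemF]
  rfl

theorem genA_mem_subC : genA hr ∈ subC hr := Algebra.subset_adjoin (by simp)
theorem genB_mem_subC : genB hr ∈ subC hr := Algebra.subset_adjoin (by simp)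
theorem genF_mem_subC : genF hr ∈ subC hr := Algebra.subset_adjoin (by simp)

theorem genX_add_mem_subB : genX hr + q • genA hr ∈ subB hr p q := Algebra.subset_adjoin (by simp)
theorem genY_add_mem_subB : genY hr + p • genB hr ∈ subB hr p q := Algebra.subset_adjoin (by simp)

theorem subB_isRightCoideal : IsRightCoideal (subB hr p q) := by
  let f : subB hr p q ⊗[k] NodalHopf hr →ₐ[k] NodalHopf hr ⊗[k] NodalHopf hr :=
    Algebra.TensorProduct.map (subB hr p q).val (AlgHom.id k _)
  have h : subB hr p q ≤ f.range.comap (Bialgebra.comulAlgHom k (NodalHopf hr)) := by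
    refine Algebra.adjoin_le ?_
    rintro z (rfl | rfl)
    · refine ⟨1 ⊗ₜ genX hr + ⟨_, genX_add_mem_subB hr p q⟩ ⊗ₜ genA hr, ?_⟩
      simp [f, TensorProduct.add_tmul, TensorProduct.smul_tmul', add_assoc]
    · refine ⟨1 ⊗ₜ genY hr + ⟨_, genY_add_mem_subB hr p q⟩ ⊗ₜ genB hr, ?_⟩
      simp [f, TensorProduct.add_tmul, TensorProduct.smul_tmul', add_assoc]
  intro z hz
  obtain ⟨t, ht⟩ := h hz
  exact ⟨t, ht⟩

theorem subC_comul : ∀ z ∈ subC hr, Coalgebra.comul (R := k) z ∈ LinearMap.range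
    (TensorProduct.map (Subalgebra.toSubmodule (subC hr)).subtype
      (Subalgebra.toSubmodule (subC hr)).subtype) := by
  let f : subC hr ⊗[k] subC hr →ₐ[k] NodalHopf hr ⊗[k] NodalHopf hr :=
    Algebra.TensorProduct.map (subC hr).val (subC hr).val
  have h : subC hr ≤ f.range.comap (Bialgebra.comulAlgHom k (NodalHopf hr)) := by
    refine Algebra.adjoin_le ?_
    rintro z (rfl | rfl | rfl)
    · exact ⟨⟨_, genA_mem_subC hr⟩ ⊗ₜ ⟨_, genA_mem_subC hr⟩, by simp [f]⟩
    · exact ⟨⟨_, genB_mem_subC hr⟩ ⊗ₜ ⟨_, genB_mem_subC hr⟩, by simp [f]⟩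
    · exact ⟨⟨_, genA_mem_subC hr⟩ ⊗ₜ ⟨_, genF_mem_subC hr⟩
        + ⟨_, genF_mem_subC hr⟩ ⊗ₜ (⟨_, genA_mem_subC hr⟩ ^ 2), by simp [f, comul_genF]⟩
  intro z hz
  obtain ⟨t, ht⟩ := h hz
  exact ⟨t, ht⟩

theorem counit_genF : Coalgebra.counit (R := k) (genF hr) = 0 := by
  have h : Coalgebra.counit (R := k) (genF hr) = counitHom hr (elemF r (genA hr) (genX hr)) := rfl
  rw [h, map_elemF, counitHom, lift_a, lift_x]
  simp [elemF]

theorem antipode_genA : HopfAlgebra.antipode k (genA hr) = genA hr ^ 2 := by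
  change antipodeLin hr (genA hr) = _
  simp [antipodeLin_apply, antipodeHom]

theorem antipode_genF : HopfAlgebra.antipode k (genF hr) = -(genA hr ^ 2 * genF hr * genA hr) := by
  have h := HopfAlgebra.mul_antipode_rTensor_comul_apply (R := k) (genF hr)
  rw [comul_genF, counit_genF] at h
  simp only [map_add, LinearMap.rTensor_tmul, LinearMap.mul'_apply, map_zero, antipode_genA] at h
  have e : HopfAlgebra.antipode k (genF hr)
      = HopfAlgebra.antipode k (genF hr) * genA hr ^ 2 * genA hr := by
    rw [mul_assoc, ← pow_succ, (sat hr).aaa, mul_one]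
  rw [e, eq_neg_of_add_eq_zero_right h, neg_mul]

theorem subC_isHopfSubalgebra : IsHopfSubalgebra (subC hr) := by
  refine ⟨subC_comul hr, fun z hz => ?_⟩
  induction hz using Algebra.adjoin_induction with
  | mem z hz =>
    rcases hz with rfl | rfl | rfl
    · rw [antipode_genA]; exact pow_mem (genA_mem_subC hr) 2
    · change antipodeLin hr (genB hr) ∈ _
      simpa [antipodeLin_apply, antipodeHom] using genB_mem_subC hr
    · rw [antipode_genF]
      exact neg_mem (mul_mem (mul_mem (pow_mem (genA_mem_subC hr) 2) (genF_mem_subC hr))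
        (genA_mem_subC hr))
  | algebraMap c =>
    change antipodeLin hr (algebraMap k _ c) ∈ _
    simp [antipodeLin_apply]
  | add z w _ _ hz hw => rw [map_add]; exact add_mem hz hw
  | mul z w _ _ hz hw =>
    change antipodeLin hr (z * w) ∈ _
    rw [antipodeLin_mul]
    exact mul_mem hw hz

end Coideals

/-! ### Generators of Weyl type -/

section Generators

variable {k : Type u} [Field k] {r : k} (hr : IsPrimitiveRoot r 3)

/-- The element `v = F a² / (1 - r)`, a skew-primitive eigenvector of conjugation by `a`. -/
noncomputable def genV : NodalHopf hr := (1 - r)⁻¹ • (genF hr * genA hr ^ 2)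

/-- The element `u = x - v - (a - 1) / 3`, a skew-primitive eigenvector of conjugation by `a`. -/
noncomputable def genU : NodalHopf hr := genX hr - genV hr - (3 : k)⁻¹ • (genA hr - 1)

theorem genX_eq : genX hr = genU hr + genV hr + (3 : k)⁻¹ • (genA hr - 1) := by
  rw [genU]; abel

theorem isWeyl_gen : IsWeyl r (genA hr) (genU hr) (genV hr) := (sat hr).isWeyl hr rfl rfl

theorem genF_eq : genF hr = (1 - r) • (genV hr * genA hr) := by
  rw [genF, genX_eq]
  exact elemF_add hr (isWeyl_gen hr).au (isWeyl_gen hr).av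

theorem genV_mem_subC : genV hr ∈ subC hr :=
  (subC hr).smul_mem (mul_mem (genF_mem_subC hr) (pow_mem (genA_mem_subC hr) 2)) _

theorem commute_genB_genA : Commute (genB hr) (genA hr) := (sat hr).ba
theorem commute_genY_genA : Commute (genY hr) (genA hr) := (sat hr).ya
theorem commute_genB_genX : Commute (genB hr) (genX hr) := (sat hr).bx
theorem commute_genY_genX : Commute (genY hr) (genX hr) := (sat hr).yx

theorem Commute.elemF_right {S : Type v} [Ring S] [Algebra k S] {w a x : S} (ha : Commute w a)
    (hx : Commute w x) : Commute w (elemF r a x) :=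
  ((hx.mul_right ha).add_right ((ha.mul_right hx).smul_right _)).add_right
    ((ha.sub_right (ha.pow_right 2)).smul_right _)

theorem commute_genB_genF : Commute (genB hr) (genF hr) :=
  Commute.elemF_right (commute_genB_genA hr) (commute_genB_genX hr)

theorem commute_genY_genF : Commute (genY hr) (genF hr) :=
  Commute.elemF_right (commute_genY_genA hr) (commute_genY_genX hr)

theorem commute_genB_genV : Commute (genB hr) (genV hr) :=
  ((commute_genB_genF hr).mul_right ((commute_genB_genA hr).pow_right 2)).smul_right _

theorem commute_genY_genV : Commute (genY hr) (genV hr) :=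
  ((commute_genY_genF hr).mul_right ((commute_genY_genA hr).pow_right 2)).smul_right _

/-- The monomials `vˡ aⁱ bʲ`, which form a basis of the subalgebra `C`. -/
noncomputable def monomial (l i j : ℕ) : NodalHopf hr := genV hr ^ l * genA hr ^ i * genB hr ^ j

theorem monomial_mem_subC (l i j : ℕ) : monomial hr l i j ∈ subC hr :=
  mul_mem (mul_mem (pow_mem (genV_mem_subC hr) l) (pow_mem (genA_mem_subC hr) i))
    (pow_mem (genB_mem_subC hr) j)

theorem genA_mul_monomial (l i j : ℕ) :
    genA hr * monomial hr l i j = (r ^ 2) ^ l • monomial hr l (i + 1) j := by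
  have h : genA hr * genV hr ^ l = (r ^ 2) ^ l • (genV hr ^ l * genA hr) := by
    induction l with
    | zero => simp
    | succ l ih =>
      rw [pow_succ, ← mul_assoc, ih, smul_mul_assoc, mul_assoc, (isWeyl_gen hr).av, mul_smul_comm,
        smul_smul, ← pow_succ, mul_assoc]
  rw [monomial, ← mul_assoc, ← mul_assoc, h, smul_mul_assoc, smul_mul_assoc, mul_assoc _ (genA hr),
    ← pow_succ', monomial]

theorem genV_mul_monomial (l i j : ℕ) :
    genV hr * monomial hr l i j = monomial hr (l + 1) i j := by
  rw [monomial, ← mul_assoc, ← mul_assoc, ← pow_succ', monomial]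

theorem genB_mul_monomial (l i j : ℕ) :
    genB hr * monomial hr l i j = monomial hr l i (j + 1) := by
  have h := ((commute_genB_genV hr).pow_right l).mul_right ((commute_genB_genA hr).pow_right i)
  rw [monomial, ← mul_assoc, h.eq, mul_assoc, ← pow_succ', monomial]

theorem monomial_mem_span (l i j : ℕ) : monomial hr l i j ∈ Submodule.span k
    (Set.range fun n : Fin 3 × Fin 3 × Fin 2 => monomial hr n.1 n.2.1 n.2.2) := by
  rcases lt_or_ge l 3 with hl | hl
  · have ha : genA hr ^ i = genA hr ^ (i % 3) := pow_eq_pow_mod i (sat hr).aaa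
    have hb : genB hr ^ j = genB hr ^ (j % 2) := pow_eq_pow_mod j (sat hr).bb
    refine Submodule.subset_span ⟨⟨⟨l, hl⟩, ⟨i % 3, Nat.mod_lt _ (by norm_num)⟩,
      ⟨j % 2, Nat.mod_lt _ (by norm_num)⟩⟩, ?_⟩
    simp only [monomial, ha, hb]
  · rw [monomial, pow_eq_zero_of_le hl (isWeyl_gen hr).vvv, zero_mul, zero_mul]
    exact zero_mem _

theorem mem_span_monomial {c : NodalHopf hr} (hc : c ∈ subC hr) : c ∈ Submodule.span k
    (Set.range fun n : Fin 3 × Fin 3 × Fin 2 => monomial hr n.1 n.2.1 n.2.2) := by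
  set T := Submodule.span k
    (Set.range fun n : Fin 3 × Fin 3 × Fin 2 => monomial hr n.1 n.2.1 n.2.2)
  -- a left multiplication maps the span to itself if it maps each monomial into the span
  have hT : ∀ z : NodalHopf hr, (∀ l i j : ℕ, z * monomial hr l i j ∈ T) → ∀ w ∈ T, z * w ∈ T := by
    intro z hz w hw
    induction hw using Submodule.span_induction with
    | mem w hw => obtain ⟨n, rfl⟩ := hw; exact hz _ _ _
    | zero => simp
    | add v w _ _ hv hw => rw [mul_add]; exact add_mem hv hw
    | smul c w _ hw => rw [mul_smul_comm]; exact T.smul_mem _ hw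
  suffices h : ∀ w ∈ T, c * w ∈ T by
    simpa [monomial] using h _ (monomial_mem_span hr 0 0 0)
  induction hc using Algebra.adjoin_induction with
  | mem z hz =>
    refine hT z fun l i j => ?_
    rcases hz with rfl | rfl | rfl
    · rw [genA_mul_monomial]; exact T.smul_mem _ (monomial_mem_span hr _ _ _)
    · rw [genB_mul_monomial]; exact monomial_mem_span hr _ _ _
    · rw [genF_eq, smul_mul_assoc, mul_assoc, genA_mul_monomial, mul_smul_comm, genV_mul_monomial]
      exact T.smul_mem _ (T.smul_mem _ (monomial_mem_span hr _ _ _))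
  | algebraMap c => intro w hw; rw [← Algebra.smul_def]; exact T.smul_mem _ hw
  | add z w _ _ hz hw => intro t ht; rw [add_mul]; exact add_mem (hz t ht) (hw t ht)
  | mul z w _ _ hz hw => intro t ht; rw [mul_assoc]; exact hz _ (hw t ht)

end Generators

/-! ### `A` is spanned by products of elements of `C` and `B` -/

section Spanning

/-- Right multiplication of `x` by an element of an algebra `C` lands in `Cx + C` if this holds for
generators of `C`. -/
theorem adjoin_mul_eq {k : Type u} [Field k] {S : Type v} [Ring S] [Algebra k S] {G : Set S} {x : S}
    (h : ∀ g ∈ G, ∃ c ∈ Algebra.adjoin k G, ∃ d ∈ Algebra.adjoin k G, x * g = c * x + d) :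
    ∀ g ∈ Algebra.adjoin k G, ∃ c ∈ Algebra.adjoin k G, ∃ d ∈ Algebra.adjoin k G,
      x * g = c * x + d := by
  intro g hg
  induction hg using Algebra.adjoin_induction with
  | mem g hg => exact h g hg
  | algebraMap c =>
    exact ⟨_, Subalgebra.algebraMap_mem _ c, 0, zero_mem _, by rw [Algebra.commutes, add_zero]⟩
  | add z w _ _ hz hw =>
    obtain ⟨c, hc, d, hd, e⟩ := hz
    obtain ⟨c', hc', d', hd', e'⟩ := hw
    exact ⟨c + c', add_mem hc hc', d + d', add_mem hd hd', by rw [mul_add, e, e']; noncomm_ring⟩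
  | mul z w _ hw' hz hw =>
    obtain ⟨c, hc, d, hd, e⟩ := hz
    obtain ⟨c', hc', d', hd', e'⟩ := hw
    refine ⟨c * c', mul_mem hc hc', c * d' + d * w, add_mem (mul_mem hc hd') (mul_mem hd hw'), ?_⟩
    rw [← mul_assoc, e, add_mul, mul_assoc, e']
    noncomm_ring

variable {k : Type u} [Field k] {r : k} (hr : IsPrimitiveRoot r 3) (p q : k)

theorem genX_add_mul_mem : ∀ g ∈ subC hr, ∃ c ∈ subC hr, ∃ d ∈ subC hr,
    (genX hr + q • genA hr) * g = c * (genX hr + q • genA hr) + d := by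
  have ha := genA_mem_subC hr
  have hv := genV_mem_subC hr
  have hW := isWeyl_gen hr
  have h3 : (3 : k)⁻¹ • (genA hr - 1) ∈ subC hr :=
    Subalgebra.smul_mem _ (sub_mem ha (one_mem _)) _
  have ua : genU hr * genA hr = r ^ 2 • (genA hr * genU hr) := by
    rw [hW.au, smul_smul, ← pow_succ, hr.pow_eq_one, one_smul]
  -- the difference of `x + qa` and `u`
  obtain ⟨w, hw, e⟩ : ∃ w ∈ subC hr, genX hr + q • genA hr = genU hr + w :=
    ⟨genV hr + (3 : k)⁻¹ • (genA hr - 1) + q • genA hr,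
      add_mem (add_mem hv h3) (Subalgebra.smul_mem _ ha _), by rw [genX_eq]; abel⟩
  have hA : ∃ c ∈ subC hr, ∃ d ∈ subC hr,
      (genX hr + q • genA hr) * genA hr = c * (genX hr + q • genA hr) + d := by
    refine ⟨r ^ 2 • genA hr, Subalgebra.smul_mem _ ha _, w * genA hr - r ^ 2 • (genA hr * w),
      sub_mem (mul_mem hw ha) (Subalgebra.smul_mem _ (mul_mem ha hw) _), ?_⟩
    rw [e, add_mul, ua, mul_add, smul_mul_assoc, smul_mul_assoc]
    abel
  have hV : ∃ c ∈ subC hr, ∃ d ∈ subC hr,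
      (genX hr + q • genA hr) * genV hr = c * (genX hr + q • genA hr) + d := by
    refine ⟨r ^ 2 • genV hr, Subalgebra.smul_mem _ hv _, w * genV hr - r ^ 2 • (genV hr * w)
      + (3 * (1 - r))⁻¹ • (1 - genA hr ^ 2), add_mem (sub_mem (mul_mem hw hv)
        (Subalgebra.smul_mem _ (mul_mem hv hw) _))
        (Subalgebra.smul_mem _ (sub_mem (one_mem _) (pow_mem ha 2)) _), ?_⟩
    rw [e, add_mul, hW.uv, mul_add, smul_mul_assoc, smul_mul_assoc]
    abel
  refine adjoin_mul_eq ?_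
  rintro z (rfl | rfl | rfl)
  · exact hA
  · have hb := ((commute_genB_genX hr).add_right ((commute_genB_genA hr).smul_right q)).eq
    exact ⟨_, genB_mem_subC hr, 0, zero_mem _, by rw [← hb, add_zero]⟩
  · obtain ⟨c, hc, d, hd, h⟩ := hV
    obtain ⟨c', hc', d', hd', h'⟩ := hA
    refine ⟨(1 - r) • (c * c'), Subalgebra.smul_mem _ (mul_mem hc hc') _,
      (1 - r) • (c * d' + d * genA hr),
      Subalgebra.smul_mem _ (add_mem (mul_mem hc hd') (mul_mem hd ha)) _, ?_⟩
    rw [genF_eq, mul_smul_comm, ← mul_assoc, h, add_mul, mul_assoc, h', smul_mul_assoc, ← smul_add]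
    congr 1
    noncomm_ring

theorem genY_add_mul_mem : ∀ g ∈ subC hr, ∃ c ∈ subC hr, ∃ d ∈ subC hr,
    (genY hr + p • genB hr) * g = c * (genY hr + p • genB hr) + d := by
  have hcom : ∀ z ∈ subC hr, Commute (genY hr) z → Commute (genB hr) z →
      ∃ c ∈ subC hr, ∃ d ∈ subC hr,
        (genY hr + p • genB hr) * z = c * (genY hr + p • genB hr) + d :=
    fun z hz h h' => ⟨z, hz, 0, zero_mem _, by rw [add_zero, (h.add_left (h'.smul_left p)).eq]⟩
  refine adjoin_mul_eq ?_
  rintro z (rfl | rfl | rfl)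
  · exact hcom _ (genA_mem_subC hr) (commute_genY_genA hr) (commute_genB_genA hr)
  · refine ⟨-genB hr, neg_mem (genB_mem_subC hr), (2 * p) • 1,
      Subalgebra.smul_mem _ (one_mem _) _, ?_⟩
    have h := (sat hr).bby
    rw [add_mul, neg_mul, mul_add, mul_smul_comm, smul_mul_assoc, ← pow_two, (sat hr).bb, h]
    module
  · exact hcom _ (genF_mem_subC hr) (commute_genY_genF hr) (commute_genB_genF hr)

theorem mulMap_surjective : Function.Surjective (Submodule.mulMap
    (Subalgebra.toSubmodule (subC hr)) (Subalgebra.toSubmodule (subB hr p q))) := by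
  rw [← LinearMap.range_eq_top, Submodule.mulMap_range, eq_top_iff]
  rintro z -
  set N := Subalgebra.toSubmodule (subC hr) * Subalgebra.toSubmodule (subB hr p q)
  have hC : ∀ c ∈ subC hr, ∀ w ∈ N, c * w ∈ N := by
    intro c hc w hw
    refine Submodule.mul_induction_on hw (fun d hd f hf => ?_) (fun v w hv hw => ?_)
    · rw [← mul_assoc]; exact Submodule.mul_mem_mul ((subC hr).mul_mem hc hd) hf
    · rw [mul_add]; exact add_mem hv hw
  have hO : ∀ x ∈ subB hr p q, (∀ g ∈ subC hr, ∃ c ∈ subC hr, ∃ d ∈ subC hr,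
      x * g = c * x + d) → ∀ w ∈ N, x * w ∈ N := by
    intro x hx h w hw
    refine Submodule.mul_induction_on hw (fun g hg f hf => ?_) (fun v w hv hw => ?_)
    · obtain ⟨c, hc, d, hd, e⟩ := h g hg
      rw [← mul_assoc, e, add_mul, mul_assoc]
      exact add_mem (Submodule.mul_mem_mul hc ((subB hr p q).mul_mem hx hf))
        (Submodule.mul_mem_mul hd hf)
    · rw [mul_add]; exact add_mem hv hw
  suffices h : ∀ w ∈ N, z * w ∈ N by
    have h1 : (1 : NodalHopf hr) * 1 ∈ N :=
      Submodule.mul_mem_mul (one_mem (subC hr)) (one_mem (subB hr p q))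
    rw [mul_one] at h1
    simpa using h 1 h1
  induction z using induction with
  | hc c => exact hC _ ((subC hr).algebraMap_mem c)
  | ha => exact hC _ (genA_mem_subC hr)
  | hb => exact hC _ (genB_mem_subC hr)
  | hx =>
    intro w hw
    have e : genX hr * w = (genX hr + q • genA hr) * w - q • (genA hr * w) := by
      rw [add_mul, smul_mul_assoc]; abel
    rw [e]
    exact sub_mem (hO _ (genX_add_mem_subB hr p q) (genX_add_mul_mem hr q) w hw)
      (N.smul_mem _ (hC _ (genA_mem_subC hr) w hw))
  | hy =>
    intro w hw
    have e : genY hr * w = (genY hr + p • genB hr) * w - p • (genB hr * w) := by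
      rw [add_mul, smul_mul_assoc]; abel
    rw [e]
    exact sub_mem (hO _ (genY_add_mem_subB hr p q) (genY_add_mul_mem hr p) w hw)
      (N.smul_mem _ (hC _ (genB_mem_subC hr) w hw))
  | hadd u v hu hv => intro w hw; rw [add_mul]; exact add_mem (hu w hw) (hv w hw)
  | hmul u v hu hv => intro w hw; rw [mul_assoc]; exact hu _ (hv w hw)

end Spanning

/-! ### The coordinate ring of the nodal cubic and the basis of `A` over `B` -/

section Basis

variable {k : Type u} [Field k]

/-- The image of `s` in the coordinate ring of the nodal cubic. -/
noncomputable def coordS (k : Type u) [Field k] : CoordRing k :=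
  Ideal.Quotient.mk _ (MvPolynomial.X 0)

/-- The image of `t` in the coordinate ring of the nodal cubic. -/
noncomputable def coordT (k : Type u) [Field k] : CoordRing k :=
  Ideal.Quotient.mk _ (MvPolynomial.X 1)

theorem coordT_sq : coordT k ^ 2 = coordS k ^ 2 + coordS k ^ 3 := by
  rw [eq_comm, ← sub_eq_zero]
  exact Ideal.Quotient.eq_zero_iff_mem.mpr (Ideal.subset_span rfl)

variable {r : k} (hr : IsPrimitiveRoot r 3) {p q : k} (hpq : p ^ 2 = q ^ 2 + q ^ 3)

theorem genX_add_sq_add_cube : (genX hr + q • genA hr) ^ 2 + (genX hr + q • genA hr) ^ 3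
    = genX hr ^ 2 + genX hr ^ 3 + (q ^ 2 + q ^ 3) • 1 :=
  sq_add_cube_add_smul (sat hr).aaa (sat hr).xxa (sat hr).xaa

theorem genY_add_sq : (genY hr + p • genB hr) ^ 2 = genY hr ^ 2 + p ^ 2 • 1 := by
  have h := sat hr
  have hb : genB hr * genB hr = 1 := by rw [← pow_two, h.bb]
  simp only [pow_two, add_mul, mul_add, smul_mul_assoc, mul_smul_comm, h.bby, hb]
  module

theorem genY_add_sq_eq (hpq : p ^ 2 = q ^ 2 + q ^ 3) : (genY hr + p • genB hr) ^ 2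
    = (genX hr + q • genA hr) ^ 2 + (genX hr + q • genA hr) ^ 3 := by
  rw [genX_add_sq_add_cube, genY_add_sq, (sat hr).yy, hpq]

theorem subB_mul_comm (p q : k) (z w : subB hr p q) : z * w = w * z := by
  have h : Commute (genY hr + p • genB hr) (genX hr + q • genA hr) :=
    ((commute_genY_genX hr).add_right ((commute_genY_genA hr).smul_right q)).add_left
      (((commute_genB_genX hr).add_right ((commute_genB_genA hr).smul_right q)).smul_left p)
  have hB : IsMulCommutative (subB hr p q) := by
    refine Algebra.isMulCommutative_adjoin k ?_
    rintro _ (rfl | rfl) _ (rfl | rfl)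
    exacts [rfl, h.symm.eq, h.eq, rfl]
  exact hB.is_comm.comm z w

/-- The algebra map from the coordinate ring of the nodal cubic to `B` with `s ↦ x + qa` and
`t ↦ y + pb`. -/
noncomputable def coordHom : CoordRing k →ₐ[k] subB hr p q :=
  letI : CommRing (subB hr p q) :=
    { (inferInstance : Ring (subB hr p q)) with mul_comm := subB_mul_comm hr p q }
  Ideal.Quotient.liftₐ _ (MvPolynomial.aeval
    ![(⟨_, genX_add_mem_subB hr p q⟩ : subB hr p q), ⟨_, genY_add_mem_subB hr p q⟩]) (by
      intro g hg
      refine (Ideal.span_le (I := RingHom.ker _)).mpr ?_ hg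
      rintro _ rfl
      rw [SetLike.mem_coe, RingHom.mem_ker]
      simp only [map_sub, map_add, map_pow, MvPolynomial.aeval_X, Matrix.cons_val_zero,
        Matrix.cons_val_one]
      rw [sub_eq_zero]
      exact Subtype.ext (genY_add_sq_eq hr hpq).symm)

theorem coordHom_coordS : (coordHom hr hpq (coordS k) : NodalHopf hr) = genX hr + q • genA hr := by
  let _ : CommRing (subB hr p q) :=
    { (inferInstance : Ring (subB hr p q)) with mul_comm := subB_mul_comm hr p q }
  have : coordHom hr hpq (coordS k) = ⟨_, genX_add_mem_subB hr p q⟩ :=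
    MvPolynomial.aeval_X _ (0 : Fin 2)
  rw [this]

theorem coordHom_coordT : (coordHom hr hpq (coordT k) : NodalHopf hr) = genY hr + p • genB hr := by
  let _ : CommRing (subB hr p q) :=
    { (inferInstance : Ring (subB hr p q)) with mul_comm := subB_mul_comm hr p q }
  have : coordHom hr hpq (coordT k) = ⟨_, genY_add_mem_subB hr p q⟩ :=
    MvPolynomial.aeval_X _ (1 : Fin 2)
  rw [this]

theorem coordHom_surjective : Function.Surjective (coordHom hr hpq) := by
  rintro ⟨z, hz⟩
  have h : subB hr p q ≤ ((subB hr p q).val.comp (coordHom hr hpq)).range := by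
    refine Algebra.adjoin_le ?_
    rintro _ (rfl | rfl)
    · exact ⟨coordS k, coordHom_coordS hr hpq⟩
    · exact ⟨coordT k, coordHom_coordT hr hpq⟩
  obtain ⟨g, hg⟩ := h hz
  exact ⟨g, Subtype.ext hg⟩

theorem CoordRing.induction {P : CoordRing k → Prop} (hc : ∀ c : k, P (algebraMap k _ c))
    (hadd : ∀ g h, P g → P h → P (g + h)) (hS : ∀ g, P g → P (g * coordS k))
    (hT : ∀ g, P g → P (g * coordT k)) (g : CoordRing k) : P g := by
  obtain ⟨g, rfl⟩ := Ideal.Quotient.mk_surjective g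
  induction g using MvPolynomial.induction_on with
  | C c => exact hc c
  | add g h hg hh => rw [map_add]; exact hadd _ _ hg hh
  | mul_X g i hg =>
    rw [map_mul]
    fin_cases i
    exacts [hS _ hg, hT _ hg]

/-- The action of `A` on the free module of rank 18 over the coordinate ring, in which `x + qa`
and `y + pb` act on the basis vector of the monomial `1` as the scalars `s` and `t`. -/
noncomputable def rep : NodalHopf hr →ₐ[k] Module.End (CoordRing k) (Model (CoordRing k)) :=
  lift hr (Model.sat (CoordRing k) hr hpq coordT_sq)

theorem rep_genX_add : rep hr hpq (genX hr + q • genA hr)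
    = Model.opX (CoordRing k) r q (coordS k) + q • Model.opA (CoordRing k) r := by
  rw [map_add, map_smul, rep, lift_x, lift_a]

theorem rep_genY_add : rep hr hpq (genY hr + p • genB hr)
    = Model.opY (CoordRing k) p (coordT k) := by
  rw [map_add, map_smul, rep, lift_y, lift_b, sub_add_cancel]

theorem rep_genV : rep hr hpq (genV hr) = Model.opV (CoordRing k) := by
  have hW := Model.isWeyl (CoordRing k) hr q (coordS k)
  have h : rep hr hpq (genF hr)
      = (1 - r) • (Model.opV (CoordRing k) * Model.opA (CoordRing k) r) := by
    rw [genF, map_elemF, rep, lift_a, lift_x, Model.opX_def, elemF_add hr hW.au hW.av]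
  rw [genV, map_smul, map_mul, h, map_pow, smul_mul_assoc, smul_smul,
    inv_mul_cancel₀ (one_sub_root_ne_zero hr), one_smul, rep, lift_a, mul_assoc, ← pow_succ',
    hW.aaa, mul_one]

theorem rep_coordHom (g : CoordRing k) :
    rep hr hpq (coordHom hr hpq g) (Model.e _ 0 0 0) = g • Model.e _ 0 0 0 := by
  induction g using CoordRing.induction with
  | hc c =>
    rw [AlgHom.commutes, Subalgebra.coe_algebraMap, AlgHom.commutes, algebraMap_smul]
    rfl
  | hadd g h hg hh =>
    rw [map_add, Subalgebra.coe_add, map_add, LinearMap.add_apply, hg, hh, add_smul]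
  | hS g hg =>
    rw [map_mul, Subalgebra.coe_mul, map_mul, Module.End.mul_apply, coordHom_coordS, rep_genX_add,
      Model.opX_add_e, map_smul, hg, smul_smul, mul_comm]
  | hT g hg =>
    rw [map_mul, Subalgebra.coe_mul, map_mul, Module.End.mul_apply, coordHom_coordT, rep_genY_add,
      Model.opY_e, map_smul, hg, smul_smul, mul_comm]

theorem rep_monomial_mul (l i : Fin 3) (j : Fin 2) (g : CoordRing k) :
    rep hr hpq (monomial hr l i j * coordHom hr hpq g) (Model.e _ 0 0 0) = g • Model.e _ l i j := by
  have h : rep hr hpq (monomial hr l i j) = Model.opV (CoordRing k) ^ (l : ℕ)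
      * Model.opA (CoordRing k) r ^ (i : ℕ) * Model.opB (CoordRing k) ^ (j : ℕ) := by
    rw [monomial, map_mul, map_mul, map_pow, map_pow, map_pow, rep_genV, rep, lift_a, lift_b]
  rw [map_mul, Module.End.mul_apply, rep_coordHom, map_smul, h, Model.monomial_e]

theorem coordHom_injective : Function.Injective (coordHom hr hpq) := by
  intro g g' h
  have h1 := rep_coordHom hr hpq g
  rw [h, rep_coordHom] at h1
  simpa [Model.e] using (congrFun (congrFun (congrFun h1 0) 0) 0).symm

/-- The element `∑ vˡ aⁱ bʲ f_{lij}(x + qa, y + pb)` of `A`. -/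
noncomputable def expand : Model (CoordRing k) →ₗ[k] NodalHopf hr where
  toFun f := ∑ n : Fin 3 × Fin 3 × Fin 2,
    monomial hr n.1 n.2.1 n.2.2 * coordHom hr hpq (f n.1 n.2.1 n.2.2)
  map_add' f g := by simp [mul_add, Finset.sum_add_distrib]
  map_smul' c f := by simp [Finset.smul_sum]

theorem rep_expand (f : Model (CoordRing k)) :
    rep hr hpq (expand hr hpq f) (Model.e _ 0 0 0) = f := by
  have h : expand hr hpq f = ∑ n : Fin 3 × Fin 3 × Fin 2,
    monomial hr n.1 n.2.1 n.2.2 * coordHom hr hpq (f n.1 n.2.1 n.2.2) := rfl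
  rw [h, map_sum, LinearMap.sum_apply,
    Finset.sum_congr rfl fun n _ => rep_monomial_mul hr hpq _ _ _ _]
  conv_rhs => rw [Model.eq_sum_smul_e _ f]
  rw [Fintype.sum_prod_type]
  exact Finset.sum_congr rfl fun l _ => Fintype.sum_prod_type _

theorem expand_injective : Function.Injective (expand hr hpq) :=
  fun f g h => by rw [← rep_expand hr hpq f, h, rep_expand]

theorem exists_eq_sum_monomial_tmul (s : Subalgebra.toSubmodule (subC hr) ⊗[k]
      Subalgebra.toSubmodule (subB hr p q)) : ∃ f : Model (CoordRing k),
    s = ∑ n : Fin 3 × Fin 3 × Fin 2, (⟨monomial hr n.1 n.2.1 n.2.2, monomial_mem_subC hr _ _ _⟩ :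
      Subalgebra.toSubmodule (subC hr)) ⊗ₜ[k]
        (coordHom hr hpq (f n.1 n.2.1 n.2.2) : subB hr p q) := by
  induction s with
  | zero => exact ⟨0, by simp⟩
  | add s t hs ht =>
    obtain ⟨f, rfl⟩ := hs
    obtain ⟨g, rfl⟩ := ht
    refine ⟨f + g, ?_⟩
    rw [← Finset.sum_add_distrib]
    refine Finset.sum_congr rfl fun n _ => ?_
    rw [← TensorProduct.tmul_add]
    congr 1
    exact (map_add (coordHom hr hpq) _ _).symm
  | tmul c z =>
    obtain ⟨g, rfl⟩ := coordHom_surjective hr hpq z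
    obtain ⟨c, hc⟩ := c
    obtain ⟨α, hα⟩ := (Submodule.mem_span_range_iff_exists_fun k).mp (mem_span_monomial hr hc)
    refine ⟨fun l i j => α (l, i, j) • g, ?_⟩
    have h : (⟨c, hc⟩ : Subalgebra.toSubmodule (subC hr)) = ∑ n : Fin 3 × Fin 3 × Fin 2,
        α n • ⟨monomial hr n.1 n.2.1 n.2.2, monomial_mem_subC hr _ _ _⟩ :=
      Subtype.ext (by simp [← hα])
    rw [h, TensorProduct.sum_tmul]
    refine Finset.sum_congr rfl fun n _ => ?_
    rw [TensorProduct.smul_tmul]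
    congr 1
    exact (map_smul (coordHom hr hpq) _ _).symm

theorem mulMap_bijective (hpq : p ^ 2 = q ^ 2 + q ^ 3) : Function.Bijective (Submodule.mulMap
    (Subalgebra.toSubmodule (subC hr)) (Subalgebra.toSubmodule (subB hr p q))) := by
  refine ⟨fun s t h => ?_, mulMap_surjective hr p q⟩
  obtain ⟨f, rfl⟩ := exists_eq_sum_monomial_tmul hr hpq s
  obtain ⟨g, rfl⟩ := exists_eq_sum_monomial_tmul hr hpq t
  rw [map_sum, map_sum] at h
  rw [expand_injective hr hpq h]

theorem expand_surjective : Function.Surjective (expand hr hpq) := by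
  intro z
  obtain ⟨s, rfl⟩ := mulMap_surjective hr p q z
  obtain ⟨f, rfl⟩ := exists_eq_sum_monomial_tmul hr hpq s
  exact ⟨f, by rw [map_sum]; rfl⟩

theorem isRightFree (hpq : p ^ 2 = q ^ 2 + q ^ 3) : IsRightFree (subB hr p q) := by
  let L := Fintype.linearCombination (subB hr p q).op
    (fun n : Fin 3 × Fin 3 × Fin 2 => monomial hr n.1 n.2.1 n.2.2)
  have hL : ∀ f : Model (CoordRing k), L (fun n => ⟨MulOpposite.op
      (coordHom hr hpq (f n.1 n.2.1 n.2.2) : NodalHopf hr),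
        (coordHom hr hpq (f n.1 n.2.1 n.2.2)).2⟩) = expand hr hpq f := fun f =>
    (Fintype.linearCombination_apply _ _ _).trans (Finset.sum_congr rfl fun n _ => rfl)
  have hs : ∀ g : Fin 3 × Fin 3 × Fin 2 → (subB hr p q).op, ∃ f : Model (CoordRing k),
      g = fun n => ⟨MulOpposite.op
      (coordHom hr hpq (f n.1 n.2.1 n.2.2) : NodalHopf hr),
        (coordHom hr hpq (f n.1 n.2.1 n.2.2)).2⟩ := by
    intro g
    choose f hf using fun n => coordHom_surjective hr hpq ⟨(g n).1.unop, (g n).2⟩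
    exact ⟨fun l i j => f (l, i, j), funext fun n => Subtype.ext (by simp [hf])⟩
  refine Module.Free.of_equiv (LinearEquiv.ofBijective L ⟨fun g g' h => ?_, fun z => ?_⟩)
  · obtain ⟨f, rfl⟩ := hs g
    obtain ⟨f', rfl⟩ := hs g'
    rw [hL, hL] at h
    rw [expand_injective hr hpq h]
  · obtain ⟨f, rfl⟩ := expand_surjective hr hpq z
    exact ⟨_, hL f⟩

theorem isRightFaithfullyFlat (hpq : p ^ 2 = q ^ 2 + q ^ 3) :
    IsRightFaithfullyFlat (subB hr p q) := by
  refine ⟨fun z w => Subtype.ext (MulOpposite.unop_injective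
    (congrArg Subtype.val (subB_mul_comm hr p q ⟨w.1.unop, w.2⟩ ⟨z.1.unop, z.2⟩))), ?_⟩
  have : Module.Free (subB hr p q).op (NodalHopf hr) := isRightFree hr hpq
  have : Nontrivial (NodalHopf hr) := (counitHom hr).toRingHom.domain_nontrivial
  exact @Module.FaithfullyFlat.instOfNontrivialOfFree (subB hr p q).op (NodalHopf hr)
    { (inferInstance : Ring (subB hr p q).op) with mul_comm := _ } _ _ ‹_› ‹_›

/-- The isomorphism from the coordinate ring of the nodal cubic to `B`. -/
noncomputable def coordEquiv : CoordRing k ≃ₐ[k] subB hr p q :=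
  AlgEquiv.ofBijective (coordHom hr hpq) ⟨coordHom_injective hr hpq, coordHom_surjective hr hpq⟩

end Basis

/-! ### The normalization of the nodal cubic -/

section Normalization

open Polynomial

variable {k : Type u} [Field k]

/-- The parametrization `s ↦ w² - 1`, `t ↦ w³ - w` of the nodal cubic by the affine line. -/
noncomputable def normalization (k : Type u) [Field k] : CoordRing k →ₐ[k] k[X] :=
  Ideal.Quotient.liftₐ _ (MvPolynomial.aeval ![X ^ 2 - 1, X ^ 3 - X]) (by
    intro g hg
    refine (Ideal.span_le (I := RingHom.ker _)).mpr ?_ hg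
    rintro _ rfl
    rw [SetLike.mem_coe, RingHom.mem_ker]
    simp only [map_sub, map_add, map_pow, MvPolynomial.aeval_X, Matrix.cons_val_zero,
      Matrix.cons_val_one]
    ring)

theorem normalization_coordS : normalization k (coordS k) = X ^ 2 - 1 :=
  MvPolynomial.aeval_X _ (0 : Fin 2)

theorem normalization_coordT : normalization k (coordT k) = X ^ 3 - X :=
  MvPolynomial.aeval_X _ (1 : Fin 2)

theorem CoordRing.exists_eq_add_mul (g : CoordRing k) :
    ∃ α β : k[X], g = aeval (coordS k) α + aeval (coordS k) β * coordT k := by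
  induction g using CoordRing.induction with
  | hc c => exact ⟨C c, 0, by simp⟩
  | hadd g h hg hh =>
    obtain ⟨α, β, rfl⟩ := hg
    obtain ⟨α', β', rfl⟩ := hh
    exact ⟨α + α', β + β', by rw [map_add, map_add]; ring⟩
  | hS g hg =>
    obtain ⟨α, β, rfl⟩ := hg
    exact ⟨α * X, β * X, by rw [map_mul, map_mul, aeval_X]; ring⟩
  | hT g hg =>
    obtain ⟨α, β, rfl⟩ := hg
    refine ⟨β * (X ^ 2 + X ^ 3), α, ?_⟩
    rw [map_mul, map_add, map_pow, map_pow, aeval_X, ← coordT_sq]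
    ring

/-- The two summands of the image of `α(s) + β(s) t` have degrees of different parity. -/
theorem normalization_injective : Function.Injective (normalization k) := by
  rw [injective_iff_map_eq_zero]
  intro g hg
  obtain ⟨α, β, rfl⟩ := g.exists_eq_add_mul
  have h2 : (X ^ 2 - 1 : k[X]).natDegree = 2 := natDegree_X_pow_sub_C (r := (1 : k))
  have h3 : (X ^ 3 - X : k[X]).natDegree = 3 := by compute_degree!
  have e : ∀ γ : k[X], normalization k (aeval (coordS k) γ) = γ.comp (X ^ 2 - 1) := fun γ => by
    rw [← aeval_algHom_apply, normalization_coordS]; rfl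
  rw [map_add, map_mul, e, e, normalization_coordT] at hg
  have h0 : ∀ γ : k[X], γ.comp (X ^ 2 - 1) = 0 → γ = 0 := by
    intro γ hγ
    rcases comp_eq_zero_iff.mp hγ with h | ⟨-, h⟩
    · exact h
    · rw [h, natDegree_C] at h2; omega
  have hβ : β = 0 := by
    by_contra hβ
    have hd := congrArg natDegree (eq_neg_of_add_eq_zero_left hg)
    rw [natDegree_neg, natDegree_mul (fun h => hβ (h0 β h)) (fun h => by simp [h] at h3),
      natDegree_comp, natDegree_comp, h2, h3] at hd
    omega
  rw [hβ, zero_comp, zero_mul, add_zero] at hg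
  rw [hβ, h0 α hg]
  simp

instance : IsDomain (CoordRing k) :=
  Function.Injective.isDomain (normalization k).toRingHom normalization_injective

/-- The coordinate ring is integral over `k[t²]`, so that every nonzero element divides a nonzero
polynomial in `t²`. -/
theorem CoordRing.exists_aeval_eq_mul {g : CoordRing k} (hg : g ≠ 0) :
    ∃ f : k[X], f ≠ 0 ∧ ∃ h, aeval (coordT k ^ 2) f = g * h := by
  let _ : Algebra k[X] (CoordRing k) := (aeval (coordT k ^ 2)).toRingHom.toAlgebra
  have hmap : ∀ f : k[X], algebraMap k[X] (CoordRing k) f = aeval (coordT k ^ 2) f := fun _ => rfl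
  have hS : IsIntegral k[X] (coordS k) := by
    refine ⟨X ^ 3 + X ^ 2 - C X, by monicity!, ?_⟩
    simp [hmap, coordT_sq, add_comm]
  have hT : IsIntegral k[X] (coordT k) := by
    refine ⟨X ^ 2 - C X, by monicity!, ?_⟩
    simp [hmap]
  have hint : ∀ g : CoordRing k, IsIntegral k[X] g := by
    intro g
    induction g using CoordRing.induction with
    | hc c =>
      have : algebraMap k (CoordRing k) c = algebraMap k[X] _ (C c) := by rw [hmap, aeval_C]
      rw [this]
      exact isIntegral_algebraMap
    | hadd g h hg hh => exact hg.add hh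
    | hS g hg => exact hg.mul hS
    | hT g hg => exact hg.mul hT
  have hne := Ideal.comap_ne_bot_of_integral_mem hg (Ideal.mem_span_singleton_self g) (hint g)
  obtain ⟨f, hf, hf0⟩ := Submodule.exists_mem_ne_zero_of_ne_bot hne
  obtain ⟨h, hh⟩ := Ideal.mem_span_singleton.mp (Ideal.mem_comap.mp hf)
  exact ⟨f, hf0, h, hh⟩

end Normalization

/-! ### Torsion modulo a bi-ideal with respect to a central primitive element -/

section Torsion

open Polynomial

variable {k : Type u} [Field k] {A : Type v} [Ring A]

theorem commute_aeval [Algebra k A] {z : A} (hz : ∀ w, Commute z w) (f : k[X]) (w : A) :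
    Commute (aeval z f) w := by
  induction f using Polynomial.induction_on' with
  | add f g hf hg => rw [map_add]; exact hf.add_left hg
  | monomial n c =>
    rw [aeval_monomial]
    exact Commute.mul_left (Algebra.commutes c w) ((hz w).pow_left n)

/-- The ideal of all elements that are annihilated modulo `I` by a nonzero polynomial in a central
element `z`. -/
def torsionIdeal (k : Type u) [Field k] [Algebra k A] (I : Ideal A) {z : A}
    (hz : ∀ w, Commute z w) : Ideal A where
  carrier := {w | ∃ f : k[X], f ≠ 0 ∧ aeval z f * w ∈ I}
  zero_mem' := ⟨1, one_ne_zero, by simp⟩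
  add_mem' := by
    rintro w w' ⟨f, hf, h⟩ ⟨f', hf', h'⟩
    refine ⟨f * f', mul_ne_zero hf hf', ?_⟩
    rw [mul_add]
    refine I.add_mem ?_ ?_
    · rw [mul_comm f, map_mul, mul_assoc]; exact I.mul_mem_left _ h
    · rw [map_mul, mul_assoc]; exact I.mul_mem_left _ h'
  smul_mem' := by
    rintro c w ⟨f, hf, h⟩
    refine ⟨f, hf, ?_⟩
    rw [smul_eq_mul, ← mul_assoc, (commute_aeval hz f c).eq, mul_assoc]
    exact I.mul_mem_left _ h

theorem torsionIdeal_isTwoSided [Algebra k A] (I : Ideal A) [I.IsTwoSided] {z : A}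
    (hz : ∀ w, Commute z w) : (torsionIdeal k I hz).IsTwoSided where
  mul_mem_of_left := by
    rintro w c ⟨f, hf, h⟩
    exact ⟨f, hf, by rw [← mul_assoc]; exact I.mul_mem_right _ h⟩

/-- The comultiplication `X ↦ 1 ⊗ X + X ⊗ 1` of the polynomial ring. -/
noncomputable def polynomialComul (k : Type u) [Field k] : k[X] →ₐ[k] k[X] ⊗[k] k[X] :=
  aeval ((1 : k[X]) ⊗ₜ[k] (X : k[X]) + (X : k[X]) ⊗ₜ[k] (1 : k[X]))

theorem polynomialComul_injective : Function.Injective (polynomialComul k) := by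
  have h : (Algebra.TensorProduct.productMap (AlgHom.id k k[X]) (aeval (0 : k[X]))).comp
      (polynomialComul k) = AlgHom.id k k[X] := by
    ext
    simp [polynomialComul]
  exact fun f g hfg => by
    rw [← AlgHom.id_apply (R := k) f, ← AlgHom.id_apply (R := k) g, ← h, AlgHom.comp_apply, hfg,
      AlgHom.comp_apply]

/-- Primality of the torsion: for `α`, `β` not torsion, `k[z] ⊗ k[z]` acts faithfully on the class
of `α ⊗ β` in `A/I ⊗ A/I`, so that `Δ(f(z)) = f(z ⊗ 1 + 1 ⊗ z)` cannot annihilate it. -/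
theorem mem_torsionIdeal_or_mem [Bialgebra k A] {I : Ideal A} [I.IsTwoSided]
    (hI : (I.restrictScalars k).IsCoideal) {z : A} (hz : ∀ w, Commute z w)
    (hcomul : Coalgebra.comul (R := k) z = 1 ⊗ₜ z + z ⊗ₜ 1) {w α β : A} {P R : A ⊗[k] A}
    (hw : w ∈ torsionIdeal k I hz) (h : P * Coalgebra.comul (R := k) w * R = α ⊗ₜ β) :
    α ∈ torsionIdeal k I hz ∨ β ∈ torsionIdeal k I hz := by
  obtain ⟨f, hf, hfw⟩ := hw
  by_contra! hcon
  let π := Ideal.Quotient.mkₐ k I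
  have hπ : ∀ w, π w = 0 ↔ w ∈ I := fun w => Ideal.Quotient.eq_zero_iff_mem
  let Φ := Algebra.TensorProduct.map π π
  let Z : k[X] →ₐ[k] A := aeval z
  let act (γ : A) : k[X] →ₗ[k] A ⧸ I := π.toLinearMap ∘ₗ LinearMap.mulRight k γ ∘ₗ Z.toLinearMap
  have hact : ∀ γ, γ ∉ torsionIdeal k I hz → Function.Injective (act γ) := by
    intro γ hγ
    rw [injective_iff_map_eq_zero]
    intro g hg
    by_contra hg0
    exact hγ ⟨g, hg0, (hπ _).mp hg⟩
  have hinj : Function.Injective (TensorProduct.map (act α) (act β)) :=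
    TensorProduct.map_injective_of_flat_flat _ _ (hact α hcon.1) (hact β hcon.2)
  have hmap : ∀ t, TensorProduct.map (act α) (act β) t
      = Φ (Algebra.TensorProduct.map Z Z t * α ⊗ₜ β) := by
    intro t
    induction t with
    | zero => simp
    | add s t hs ht => simp only [map_add, add_mul, hs, ht]
    | tmul s t => simp [act, Φ]
  have hcom : ∀ (t : k[X] ⊗[k] k[X]) (s : A ⊗[k] A),
      Commute (Algebra.TensorProduct.map Z Z t) s := by
    intro t s
    induction t with
    | zero => simp
    | add t t' ht ht' => rw [map_add]; exact ht.add_left ht'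
    | tmul c d =>
      induction s with
      | zero => exact Commute.zero_right _
      | add s s' hs hs' => exact hs.add_right hs'
      | tmul c' d' =>
        rw [Commute, SemiconjBy, Algebra.TensorProduct.map_tmul,
          Algebra.TensorProduct.tmul_mul_tmul,
          Algebra.TensorProduct.tmul_mul_tmul, (commute_aeval hz c c').eq,
          (commute_aeval hz d d').eq]
  have hD : ∀ g, Coalgebra.comul (R := k) (Z g)
      = Algebra.TensorProduct.map Z Z (polynomialComul k g) := by
    have : (Bialgebra.comulAlgHom k A).comp Z
        = (Algebra.TensorProduct.map Z Z).comp (polynomialComul k) := by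
      ext
      simp [polynomialComul, Z, hcomul]
    exact fun g => DFunLike.congr_fun this g
  have hΦ : Φ (Coalgebra.comul (R := k) (Z f * w)) = 0 := by
    let j : (A ⧸ I.restrictScalars k) →ₗ[k] A ⧸ I :=
      (I.restrictScalars k).liftQ π.toLinearMap fun w hw => (hπ w).mpr hw
    have e : TensorProduct.map π.toLinearMap π.toLinearMap
        = TensorProduct.map j j ∘ₗ TensorProduct.map (I.restrictScalars k).mkQ
          (I.restrictScalars k).mkQ := by
      rw [← TensorProduct.map_comp]
      rfl
    have h1 := LinearMap.congr_fun e (Coalgebra.comul (R := k) (Z f * w))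
    rw [LinearMap.comp_apply, hI.map_mkQ_comul_eq_zero hfw, map_zero] at h1
    exact h1
  refine hf (polynomialComul_injective (hinj ?_))
  rw [hmap, ← h, ← mul_assoc, ← mul_assoc, (hcom _ P).eq, mul_assoc P, ← hD, ← Bialgebra.comul_mul,
    map_mul, map_mul, hΦ]
  simp

end Torsion

/-! ### Eigenvectors of the group-like element `a` -/

section Eigenvectors

variable {k : Type u} [Field k] {r : k} (hr : IsPrimitiveRoot r 3)

/-- For a third root of unity `c`, the idempotent of `k[a]` projecting onto the eigenspace of `a`
for the eigenvalue `c`. -/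
noncomputable def idem (c : k) : NodalHopf hr :=
  (3 : k)⁻¹ • (1 + c ^ 2 • genA hr + c • genA hr ^ 2)

theorem genA_mul_idem {c : k} (hc : c ^ 3 = 1) : genA hr * idem hr c = c • idem hr c := by
  have h : genA hr * genA hr ^ 2 = 1 := by rw [← pow_succ', (sat hr).aaa]
  simp only [idem, mul_smul_comm, mul_add, mul_one, h, ← pow_two]
  match_scalars
  · linear_combination (-(3 : k)⁻¹) * hc
  · ring
  · ring

theorem genA_sq_mul_idem {c : k} (hc : c ^ 3 = 1) :
    genA hr ^ 2 * idem hr c = c ^ 2 • idem hr c := by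
  rw [pow_two, mul_assoc, genA_mul_idem hr hc, mul_smul_comm, genA_mul_idem hr hc, smul_smul,
    pow_two]

theorem commute_idem {c : k} {w : NodalHopf hr} (h : Commute w (genA hr)) : Commute w (idem hr c) :=
  (((Commute.one_right w).add_right (h.smul_right _)).add_right
    ((h.pow_right 2).smul_right _)).smul_right _

theorem idem_mul_idem {c d : k} (hd : d ^ 3 = 1) :
    idem hr c * idem hr d = (3⁻¹ * (1 + c ^ 2 * d + c * d ^ 2)) • idem hr d := by
  rw [idem, smul_mul_assoc, add_mul, add_mul, one_mul, smul_mul_assoc, smul_mul_assoc,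
    genA_mul_idem hr hd, genA_sq_mul_idem hr hd]
  module

theorem genV_mul_idem (c : k) : genV hr * idem hr c = idem hr (r ^ 2 * c) * genV hr := by
  have h3 : r ^ 3 = 1 := hr.pow_eq_one
  have h1 : genV hr * genA hr = r • (genA hr * genV hr) := by
    rw [(isWeyl_gen hr).av, smul_smul, ← pow_succ', h3, one_smul]
  have h2 : genV hr * genA hr ^ 2 = r ^ 2 • (genA hr ^ 2 * genV hr) := by
    rw [pow_two, ← mul_assoc, h1, smul_mul_assoc, mul_assoc, h1, mul_smul_comm, smul_smul,
      mul_assoc, ← pow_two r]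
  simp only [idem, mul_smul_comm, smul_mul_assoc, mul_add, add_mul, mul_one, one_mul, h1, h2]
  match_scalars
  · ring
  · linear_combination (-(3 : k)⁻¹ * c ^ 2 * r) * h3
  · ring

theorem genU_mul_idem (c : k) : genU hr * idem hr c = idem hr (r * c) * genU hr := by
  have h3 : r ^ 3 = 1 := hr.pow_eq_one
  have h1 : genU hr * genA hr = r ^ 2 • (genA hr * genU hr) := by
    rw [(isWeyl_gen hr).au, smul_smul, ← pow_succ, h3, one_smul]
  have h2 : genU hr * genA hr ^ 2 = r • (genA hr ^ 2 * genU hr) := by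
    rw [pow_two, ← mul_assoc, h1, smul_mul_assoc, mul_assoc, h1, mul_smul_comm, smul_smul,
      mul_assoc]
    congr 1
    linear_combination r * h3
  simp only [idem, mul_smul_comm, smul_mul_assoc, mul_add, add_mul, mul_one, one_mul, h1, h2]
  match_scalars <;> ring

theorem comul_idem_mul (c : k) {d : k} (hd : d ^ 3 = 1) :
    Coalgebra.comul (R := k) (idem hr c) * idem hr d ⊗ₜ[k] (1 : NodalHopf hr)
      = idem hr d ⊗ₜ[k] idem hr (c * d ^ 2) := by
  have h2 : Coalgebra.comul (R := k) (genA hr ^ 2) = (genA hr ^ 2) ⊗ₜ[k] (genA hr ^ 2) := by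
    rw [pow_two, Bialgebra.comul_mul, comul_a, Algebra.TensorProduct.tmul_mul_tmul]
  have e : idem hr (c * d ^ 2)
      = (3 : k)⁻¹ • (1 + (c ^ 2 * d) • genA hr + (c * d ^ 2) • genA hr ^ 2) := by
    rw [idem]
    congr 4
    linear_combination c ^ 2 * d * hd
  rw [e]
  conv_lhs => rw [idem]
  simp only [map_smul, map_add, Bialgebra.comul_one, comul_a, h2, smul_mul_assoc, add_mul,
    Algebra.TensorProduct.one_def, Algebra.TensorProduct.tmul_mul_tmul, one_mul, mul_one,
    genA_mul_idem hr hd, genA_sq_mul_idem hr hd, ← TensorProduct.smul_tmul',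
    TensorProduct.tmul_smul, TensorProduct.tmul_add]
  module

theorem comul_genV :
    Coalgebra.comul (R := k) (genV hr) = 1 ⊗ₜ[k] genV hr + genV hr ⊗ₜ[k] genA hr := by
  have h1 : genA hr * genA hr ^ 2 = 1 := by rw [← pow_succ', (sat hr).aaa]
  have h2 : genA hr ^ 2 * genA hr ^ 2 = genA hr := by
    rw [pow_two, mul_assoc, ← pow_two, h1, mul_one]
  rw [genV, map_smul, Bialgebra.comul_mul, Bialgebra.comul_pow, comul_genF, comul_a,
    Algebra.TensorProduct.tmul_pow, add_mul, Algebra.TensorProduct.tmul_mul_tmul,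
    Algebra.TensorProduct.tmul_mul_tmul, h1, h2, smul_add, TensorProduct.tmul_smul,
    ← TensorProduct.smul_tmul']

theorem tmul_mul_comul_genV_sq :
    (1 : NodalHopf hr) ⊗ₜ[k] (genV hr ^ 2) * Coalgebra.comul (R := k) (genV hr ^ 2)
      = (genV hr ^ 2) ⊗ₜ[k] (genV hr ^ 2 * genA hr ^ 2) := by
  have hv : genV hr ^ 2 * genV hr = 0 := by rw [← pow_succ, (isWeyl_gen hr).vvv]
  have hav : genV hr ^ 2 * genA hr * genV hr = 0 := by
    rw [mul_assoc, (isWeyl_gen hr).av, mul_smul_comm, ← mul_assoc, hv, zero_mul, smul_zero]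
  have h : (1 : NodalHopf hr) ⊗ₜ[k] (genV hr ^ 2) * (1 ⊗ₜ[k] genV hr + genV hr ⊗ₜ[k] genA hr)
      = genV hr ⊗ₜ[k] (genV hr ^ 2 * genA hr) := by
    rw [mul_add, Algebra.TensorProduct.tmul_mul_tmul, Algebra.TensorProduct.tmul_mul_tmul, hv,
      TensorProduct.tmul_zero, zero_add, one_mul]
  rw [Bialgebra.comul_pow, comul_genV, pow_two (_ + _), ← mul_assoc, h, mul_add,
    Algebra.TensorProduct.tmul_mul_tmul, Algebra.TensorProduct.tmul_mul_tmul, hav,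
    TensorProduct.tmul_zero, zero_add, mul_assoc, ← pow_two, ← pow_two]

theorem genU_mul_genV_sq : genU hr * genV hr ^ 2 = r ^ 4 • (genV hr ^ 2 * genU hr)
    + (3 * (1 - r))⁻¹ • (genV hr * (genA hr ^ 2 - r • 1)) := by
  have hW := isWeyl_gen hr
  have h3 : r ^ 3 = 1 := hr.pow_eq_one
  have h : genA hr ^ 2 * genV hr = r • (genV hr * genA hr ^ 2) := by
    rw [pow_two, mul_assoc, hW.av, mul_smul_comm, ← mul_assoc, hW.av, smul_mul_assoc, smul_smul,
      mul_assoc]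
    congr 1
    linear_combination r * h3
  have e : genU hr * genV hr ^ 2 = (genU hr * genV hr) * genV hr := by rw [pow_two, mul_assoc]
  have e' : genV hr * genU hr * genV hr = genV hr * (genU hr * genV hr) := mul_assoc _ _ _
  rw [e, hW.uv, add_mul, smul_mul_assoc, e', hW.uv]
  simp only [mul_add, mul_sub, sub_mul, smul_mul_assoc, mul_smul_comm, mul_one, one_mul, h,
    ← mul_assoc, ← pow_two]
  match_scalars
  · ring
  · linear_combination (3 * (1 - r))⁻¹ * root_quadratic hr
  · linear_combination (-(3 * (1 - r))⁻¹) * root_quadratic hr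

end Eigenvectors

/-! ### Hopf ideals meet `B` nontrivially -/

section HopfIdeals

open Polynomial

variable {k : Type u} [Field k] {r : k} (hr : IsPrimitiveRoot r 3)

theorem commute_genY_sq (w : NodalHopf hr) : Commute (genY hr ^ 2) w := by
  have h : ∀ {w}, Commute (genY hr) w → Commute (genY hr ^ 2) w := fun h => h.pow_left 2
  induction w using induction with
  | hc c => exact (Algebra.commutes c _).symm
  | ha => exact h (commute_genY_genA hr)
  | hb =>
    have hby := (sat hr).bby
    refine Commute.symm (?_ : genB hr * genY hr ^ 2 = genY hr ^ 2 * genB hr)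
    rw [pow_two, ← mul_assoc, hby, neg_mul, mul_assoc, hby, mul_neg, neg_neg, mul_assoc]
  | hx => exact h (commute_genY_genX hr)
  | hy => exact h (Commute.refl _)
  | hadd u v hu hv => exact hu.add_right hv
  | hmul u v hu hv => exact hu.mul_right hv

theorem comul_genY_sq :
    Coalgebra.comul (R := k) (genY hr ^ 2) = 1 ⊗ₜ (genY hr ^ 2) + (genY hr ^ 2) ⊗ₜ 1 := by
  have hb : genB hr * genB hr = 1 := by rw [← pow_two, (sat hr).bb]
  rw [pow_two, Bialgebra.comul_mul, comul_y, add_mul, mul_add, mul_add]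
  simp only [Algebra.TensorProduct.tmul_mul_tmul, one_mul, mul_one, (sat hr).bby, hb,
    TensorProduct.tmul_neg]
  abel

theorem coordHom_zero_coordT {hpq : (0 : k) ^ 2 = 0 ^ 2 + 0 ^ 3} :
    (coordHom hr hpq (coordT k) : NodalHopf hr) = genY hr := by
  rw [coordHom_coordT, zero_smul, add_zero]

theorem genY_commute_coordHom_zero {hpq : (0 : k) ^ 2 = 0 ^ 2 + 0 ^ 3} (g : CoordRing k) :
    Commute (genY hr) (coordHom hr hpq g : NodalHopf hr) := by
  rw [← coordHom_zero_coordT hr (hpq := hpq)]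
  exact congrArg Subtype.val (subB_mul_comm hr 0 0 (coordHom hr hpq (coordT k)) (coordHom hr hpq g))

/-- Injectivity of the discrete Fourier transform on the cyclic group of order three. -/
theorem eq_zero_of_sum_pow_smul (hr : IsPrimitiveRoot r 3) {M : Type*} [AddCommGroup M]
    [Module k M] {f : Fin 3 → M}
    (h : ∀ c : k, (c = 1 ∨ c = r ∨ c = r ^ 2) → ∑ i : Fin 3, c ^ (i : ℕ) • f i = 0) : f = 0 := by
  have h3 := three_ne_zero_of_root hr
  have h2 := root_quadratic hr
  have e1 := h 1 (by simp)
  have e2 := h r (by simp)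
  have e3 := h (r ^ 2) (by simp)
  clear h
  simp only [Fin.sum_univ_three, Fin.val_zero, Fin.val_one, Fin.val_two, pow_zero, pow_one,
    one_pow, one_smul] at e1 e2 e3
  have e : ∀ d : k, (f 0 + f 1 + f 2) + d • (f 0 + r • f 1 + r ^ 2 • f 2)
      + d ^ 2 • (f 0 + r ^ 2 • f 1 + (r ^ 2) ^ 2 • f 2) = 0 := by
    intro d
    rw [e1, e2, e3]
    simp
  clear e1 e2 e3
  -- the coefficient at `i` is recovered by summing against the inverse character, at `d = r^{-i}`
  have e0 : (3 : k) • f 0 = 0 := by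
    rw [← e 1]
    match_scalars <;> grind
  have e1 : (3 : k) • f 1 = 0 := by
    rw [← e (r ^ 2)]
    match_scalars <;> grind
  have e2 : (3 : k) • f 2 = 0 := by
    rw [← e r]
    match_scalars <;> grind
  funext i
  fin_cases i
  · simpa [h3] using e0
  · simpa [h3] using e1
  · simpa [h3] using e2

/-- A nonzero ideal contains an element `v² e (g₀ + b g₁)`, with `e` an idempotent of `k[a]` and
`g₀`, `g₁` in `k[x, y]` not both zero: multiply a nonzero element of the ideal by a power of `v` to
keep only its terms of lowest degree in `v`, and decompose these under the action of `a`. The basis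
is that for `p = q = 0`, whose coefficients commute with `y`. -/
theorem exists_sq_mul_idem_mul_mem {hpq : (0 : k) ^ 2 = 0 ^ 2 + 0 ^ 3} {I : Ideal (NodalHopf hr)}
    (hI : I ≠ ⊥) : ∃ c : k, (c = 1 ∨ c = r ∨ c = r ^ 2) ∧ ∃ g₀ g₁ : CoordRing k, (g₀ ≠ 0 ∨ g₁ ≠ 0) ∧
      genV hr ^ 2 * idem hr c * (coordHom hr hpq g₀ + genB hr * coordHom hr hpq g₁) ∈ I := by
  obtain ⟨w, hw, hw0⟩ := Submodule.exists_mem_ne_zero_of_ne_bot hI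
  obtain ⟨f, rfl⟩ := expand_surjective hr hpq w
  have hf : {l | f l ≠ 0}.Nonempty := by
    by_contra h
    have : f = 0 := funext fun l => by
      by_contra hl
      exact h ⟨l, hl⟩
    exact hw0 (by rw [this, map_zero])
  -- the lowest power of `v` that occurs
  obtain ⟨l, hl, hmin⟩ := wellFounded_lt.has_min _ hf
  have hlow : genV hr ^ (2 - (l : ℕ)) * expand hr hpq f = ∑ m : Fin 3 × Fin 2,
      genV hr ^ 2 * (genA hr ^ (m.1 : ℕ) * genB hr ^ (m.2 : ℕ)
        * coordHom hr hpq (f l m.1 m.2)) := by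
    have e : expand hr hpq f = ∑ n : Fin 3 × Fin 3 × Fin 2,
      monomial hr n.1 n.2.1 n.2.2 * coordHom hr hpq (f n.1 n.2.1 n.2.2) := rfl
    rw [e, Fintype.sum_prod_type, Finset.mul_sum, Finset.sum_eq_single l]
    · rw [Finset.mul_sum]
      refine Finset.sum_congr rfl fun m _ => ?_
      have hl2 : 2 - (l : ℕ) + l = 2 := by omega
      simp only [monomial, ← mul_assoc]
      rw [← pow_add, hl2]
    · intro l' _ hne
      rw [Finset.mul_sum]
      refine Finset.sum_eq_zero fun m _ => ?_
      rcases lt_or_gt_of_ne hne with h | h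
      · have : f l' = 0 := by
          by_contra h'
          exact hmin l' h' h
        simp [this]
      · have hl2 : 3 ≤ 2 - (l : ℕ) + l' := by have : (l : ℕ) < l' := h; omega
        simp only [monomial, ← mul_assoc]
        rw [← pow_add, pow_eq_zero_of_le hl2 (isWeyl_gen hr).vvv]
        simp
    · simp
  have hmem : ∀ c : k, c ^ 3 = 1 → genV hr ^ 2 * idem hr c
      * (coordHom hr hpq (∑ i : Fin 3, c ^ (i : ℕ) • f l i 0)
        + genB hr * coordHom hr hpq (∑ i : Fin 3, c ^ (i : ℕ) • f l i 1)) ∈ I := by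
    intro c hc
    have hvv : idem hr (r ^ 4 * c) * genV hr ^ 2 = genV hr ^ 2 * idem hr c := by
      rw [eq_comm, pow_two, mul_assoc, genV_mul_idem, ← mul_assoc (genV hr), genV_mul_idem,
        mul_assoc, ← mul_assoc (r ^ 2), ← pow_add]
    have hai : ∀ i : ℕ, idem hr c * genA hr ^ i = c ^ i • idem hr c := by
      intro i
      induction i with
      | zero => simp
      | succ i ih =>
        rw [pow_succ, ← mul_assoc, ih, smul_mul_assoc, ← (commute_idem hr (Commute.refl _)).eq,
          genA_mul_idem hr hc, smul_smul, pow_succ]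
    have := I.mul_mem_left (idem hr (r ^ 4 * c)) (I.mul_mem_left (genV hr ^ (2 - (l : ℕ))) hw)
    rw [hlow, Finset.mul_sum] at this
    convert this using 1
    rw [Fintype.sum_prod_type_right, Fin.sum_univ_two, mul_add]
    simp only [← mul_assoc, hvv]
    simp only [mul_assoc (genV hr ^ 2) (idem hr c), hai, map_sum, map_smul, Finset.mul_sum,
      smul_mul_assoc, mul_smul_comm, AddSubmonoidClass.coe_finsetSum, Subalgebra.coe_smul]
    simp [mul_assoc]
  by_contra! hcon
  refine hl (funext fun i => funext fun j => ?_)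
  refine congrFun (eq_zero_of_sum_pow_smul hr (f := fun i => f l i j) fun c hc => ?_) i
  have hr3 : r ^ 3 = 1 := hr.pow_eq_one
  have hc3 : c ^ 3 = 1 := by
    rcases hc with rfl | rfl | rfl
    · simp
    · exact hr3
    · rw [← pow_mul, mul_comm, pow_mul, hr3, one_pow]
  by_contra h
  refine hcon c hc _ _ ?_ (hmem c hc3)
  fin_cases j
  · exact Or.inl h
  · exact Or.inr h

/-- A nonzero ideal contains `v² e` for an idempotent `e` of `k[a]`, up to torsion: the commutator
and the anticommutator with `y` isolate the two terms of `v² e (g₀ + b g₁)`. -/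
theorem exists_sq_mul_idem_mem_torsionIdeal (h2 : (2 : k) ≠ 0) {I : Ideal (NodalHopf hr)}
    [I.IsTwoSided] (hI : I ≠ ⊥) : ∃ c : k, (c = 1 ∨ c = r ∨ c = r ^ 2) ∧
      genV hr ^ 2 * idem hr c ∈ torsionIdeal k I (commute_genY_sq hr) := by
  have hpq : (0 : k) ^ 2 = 0 ^ 2 + 0 ^ 3 := by norm_num
  obtain ⟨c, hc, g₀, g₁, hg, hmem⟩ := exists_sq_mul_idem_mul_mem hr (hpq := hpq) hI
  refine ⟨c, hc, ?_⟩
  have hbE : Commute (genB hr) (genV hr ^ 2 * idem hr c) :=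
    ((commute_genB_genV hr).pow_right 2).mul_right (commute_idem hr (commute_genB_genA hr))
  have hyE : Commute (genY hr) (genV hr ^ 2 * idem hr c) :=
    ((commute_genY_genV hr).pow_right 2).mul_right (commute_idem hr (commute_genY_genA hr))
  have hy₀ := genY_commute_coordHom_zero hr (hpq := hpq) g₀
  have hy₁ := genY_commute_coordHom_zero hr (hpq := hpq) g₁
  have hby : genY hr * genB hr = -(genB hr * genY hr) := by rw [(sat hr).bby, neg_neg]
  obtain ⟨g, hg0, hgI⟩ : ∃ g : CoordRing k, g ≠ 0 ∧
      genV hr ^ 2 * idem hr c * (coordHom hr hpq g * genY hr) ∈ I := by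
    have hl := I.mul_mem_left (genY hr) hmem
    have hr' := I.mul_mem_right (genY hr) hmem
    generalize genV hr ^ 2 * idem hr c = E at hbE hyE hl hr' ⊢
    set K₀ := (coordHom hr hpq g₀ : NodalHopf hr)
    set K₁ := (coordHom hr hpq g₁ : NodalHopf hr)
    have e : genY hr * (E * (K₀ + genB hr * K₁))
        = E * (K₀ * genY hr) - E * (genB hr * (K₁ * genY hr)) := by
      rw [← mul_assoc, hyE.eq, mul_assoc, mul_add, ← mul_assoc (genY hr) (genB hr), hby, neg_mul,
        mul_assoc (genB hr), hy₀.eq, hy₁.eq, ← sub_eq_add_neg, mul_sub]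
    have e' : E * (K₀ + genB hr * K₁) * genY hr
        = E * (K₀ * genY hr) + E * (genB hr * (K₁ * genY hr)) := by
      rw [mul_assoc, add_mul, mul_add, mul_assoc (genB hr)]
    rw [e] at hl
    rw [e'] at hr'
    have half : ∀ w : NodalHopf hr, w + w ∈ I → w ∈ I := by
      intro w hw
      have e2 : w = (2 : k)⁻¹ • (w + w) := by
        rw [← two_smul k w, smul_smul, inv_mul_cancel₀ h2, one_smul]
      rw [e2]
      exact Submodule.smul_of_tower_mem I _ hw
    rcases hg with hg | hg
    · refine ⟨g₀, hg, half _ ?_⟩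
      convert I.add_mem hl hr' using 1
      abel
    · refine ⟨g₁, hg, ?_⟩
      have h : E * (genB hr * (K₁ * genY hr)) ∈ I := by
        refine half _ ?_
        convert I.sub_mem hr' hl using 1
        abel
      have h' := I.mul_mem_left (genB hr) h
      rwa [← mul_assoc, hbE.eq, mul_assoc, ← mul_assoc (genB hr), ← pow_two, (sat hr).bb,
        one_mul] at h'
  have hT0 : coordT k ≠ 0 := by
    intro h
    have := congrArg natDegree (normalization_coordT (k := k))
    rw [h, map_zero, natDegree_zero] at this
    have h3 : (X ^ 3 - X : k[X]).natDegree = 3 := by compute_degree!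
    omega
  obtain ⟨f, hf, h, hfh⟩ := CoordRing.exists_aeval_eq_mul (mul_ne_zero hg0 hT0)
  refine ⟨f, hf, ?_⟩
  have e : aeval (genY hr ^ 2) f = coordHom hr hpq g * genY hr * coordHom hr hpq h := by
    rw [← coordHom_zero_coordT hr (hpq := hpq), ← Subalgebra.coe_mul, ← Subalgebra.coe_mul,
      ← map_mul, ← map_mul, ← hfh, ← aeval_algHom_apply, ← Subalgebra.coe_pow, map_pow]
    exact aeval_algHom_apply (subB hr 0 0).val (coordHom hr hpq (coordT k) ^ 2) f
  rw [(commute_aeval (commute_genY_sq hr) f _).eq, e, ← mul_assoc]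
  exact I.mul_mem_right _ hgI

/-- The torsion modulo a nonzero Hopf ideal contains `v² e` for one eigenvalue of `a`, hence for
both eigenvalues other than `1` by comultiplication. Twisted commutators with `u` lower the power of
`v` until the idempotents themselves, then `1 - a`, `x` and `x² + x³ = y²` are torsion; and an ideal
of torsion elements containing `y²` is everything. -/
theorem one_mem_torsionIdeal (h2 : (2 : k) ≠ 0) {I : Ideal (NodalHopf hr)} [I.IsTwoSided]
    (hco : (I.restrictScalars k).IsCoideal) (hI : I ≠ ⊥) :
    1 ∈ torsionIdeal k I (commute_genY_sq hr) := by
  have h0 := exists_sq_mul_idem_mem_torsionIdeal hr h2 hI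
  have hK : ∀ {w α β P R}, w ∈ torsionIdeal k I (commute_genY_sq hr) →
      P * Coalgebra.comul (R := k) w * R = α ⊗ₜ β → α ∈ torsionIdeal k I (commute_genY_sq hr) ∨
        β ∈ torsionIdeal k I (commute_genY_sq hr) :=
    fun hw h => mem_torsionIdeal_or_mem hco (commute_genY_sq hr) (comul_genY_sq hr) hw h
  have hfin : ∀ w, w = genY hr ^ 2 → w ∈ torsionIdeal k I (commute_genY_sq hr) →
      1 ∈ torsionIdeal k I (commute_genY_sq hr) := by
    rintro _ rfl ⟨f, hf, h⟩
    exact ⟨f * X, mul_ne_zero hf X_ne_zero, by rwa [map_mul, aeval_X, mul_one]⟩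
  have := torsionIdeal_isTwoSided (k := k) I (commute_genY_sq hr)
  generalize torsionIdeal k I (commute_genY_sq hr) = T at *
  have hW := isWeyl_gen hr
  have hq := root_quadratic hr
  have hr3 : r ^ 3 = 1 := hr.pow_eq_one
  have hr1 : r ≠ 1 := hr.ne_one (by norm_num)
  have hr0 : r ≠ 0 := hr.ne_zero (by norm_num)
  have h3 := three_ne_zero_of_root hr
  have hs3 : (r ^ 2) ^ 3 = 1 := by rw [← pow_mul, mul_comm, pow_mul, hr3, one_pow]
  have hκ : (3 * (1 - r))⁻¹ ≠ 0 := inv_ne_zero (mul_ne_zero h3 (one_sub_root_ne_zero hr))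
  have hsmul : ∀ {c : k} {w : NodalHopf hr}, c ≠ 0 → c • w ∈ T → w ∈ T := by
    intro c w hc h
    have := Submodule.smul_of_tower_mem T c⁻¹ h
    rwa [smul_smul, inv_mul_cancel₀ hc, one_smul] at this
  -- `(1 ⊗ v²) Δ(v² e_c) (e_d ⊗ 1)` is a multiple of `v² e_d ⊗ v² e_{c/d}`, and `d² = d⁻¹`
  have hsq : ∀ {c d : k}, c ^ 3 = 1 → d ^ 3 = 1 → genV hr ^ 2 * idem hr c ∈ T →
      genV hr ^ 2 * idem hr d ∈ T ∨ genV hr ^ 2 * idem hr (c * d ^ 2) ∈ T := by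
    intro c d hc hd h
    have hcd : (c * d ^ 2) ^ 3 = 1 := by
      rw [mul_pow, hc, ← pow_mul, mul_comm 2, pow_mul, hd, one_pow, one_mul]
    refine (hK (P := 1 ⊗ₜ (genV hr ^ 2)) (R := idem hr d ⊗ₜ 1) (α := genV hr ^ 2 * idem hr d)
      (β := (c * d ^ 2) ^ 2 • (genV hr ^ 2 * idem hr (c * d ^ 2))) h ?_).imp id
      (hsmul (pow_ne_zero 2 fun h => by simp [h] at hcd))
    rw [Bialgebra.comul_mul, ← mul_assoc, tmul_mul_comul_genV_sq, mul_assoc, comul_idem_mul hr c hd,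
      Algebra.TensorProduct.tmul_mul_tmul, mul_assoc (genV hr ^ 2), genA_sq_mul_idem hr hcd,
      mul_smul_comm]
  have e4 : r ^ 2 * r ^ 2 = r := by linear_combination r * hr3
  have e5 : r * (r ^ 2) ^ 2 = r ^ 2 := by linear_combination r ^ 2 * hr3
  have hsq21 : genV hr ^ 2 * idem hr (r ^ 2) ∈ T → genV hr ^ 2 * idem hr r ∈ T := fun h => by
    have := hsq hs3 hr3 h
    rwa [e4, or_self] at this
  have hsq1 : genV hr ^ 2 * idem hr r ∈ T := by
    obtain ⟨c, rfl | rfl | rfl, h⟩ := h0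
    · have := hsq (by simp) hr3 h
      rw [one_mul] at this
      exact this.elim id hsq21
    · exact h
    · exact hsq21 h
  have hsq2 : genV hr ^ 2 * idem hr (r ^ 2) ∈ T := by
    have := hsq hr3 hs3 hsq1
    rwa [e5, or_self] at this
  -- `u v² - r⁴ v² u` has degree one in `v`
  have hv1 : genV hr * idem hr r ∈ T := by
    have e : ((3 * (1 - r))⁻¹ * (r ^ 2 - r)) • (genV hr * idem hr r)
        = genU hr * (genV hr ^ 2 * idem hr r)
          - r ^ 4 • (genV hr ^ 2 * idem hr (r ^ 2) * genU hr) := by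
      rw [← mul_assoc (genU hr), genU_mul_genV_sq, add_mul, smul_mul_assoc,
        mul_assoc (genV hr ^ 2) (genU hr), genU_mul_idem, ← pow_two r, ← mul_assoc (genV hr ^ 2),
        add_sub_cancel_left, smul_mul_assoc, mul_assoc (genV hr), sub_mul,
        genA_sq_mul_idem hr hr3, smul_mul_assoc, one_mul, ← sub_smul, mul_smul_comm, smul_smul]
    refine hsmul (c := (3 * (1 - r))⁻¹ * (r ^ 2 - r)) (mul_ne_zero hκ ?_) ?_
    · rw [show r ^ 2 - r = r * (r - 1) by ring]
      exact mul_ne_zero hr0 (sub_ne_zero.mpr hr1)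
    · rw [e]
      exact T.sub_mem (T.mul_mem_left _ hsq1)
        (Submodule.smul_of_tower_mem T _ (T.mul_mem_right _ hsq2))
  -- multiplying by `e_r ⊗ 1` kills the summand from `1 ⊗ v` and keeps the one from `v ⊗ a`
  have hv2 : genV hr * idem hr (r ^ 2) ∈ T := by
    have h1 : idem hr r * idem hr (r ^ 2) = 0 := by
      have : (3 : k)⁻¹ * (1 + r ^ 2 * r ^ 2 + r * (r ^ 2) ^ 2) = 0 := by
        rw [e4, e5]
        linear_combination (3 : k)⁻¹ * hq
      rw [idem_mul_idem hr hs3, this, zero_smul]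
    have h2 : idem hr (r ^ 2) * idem hr (r ^ 2) = idem hr (r ^ 2) := by
      have : (3 : k)⁻¹ * (1 + (r ^ 2) ^ 2 * r ^ 2 + r ^ 2 * (r ^ 2) ^ 2) = 1 := by
        field_simp
        linear_combination (2 * r ^ 3 + 2) * hr3
      rw [idem_mul_idem hr hs3, this, one_smul]
    have h3 : idem hr r * (genV hr * idem hr (r ^ 2)) = genV hr * idem hr (r ^ 2) := by
      have : idem hr r * genV hr = genV hr * idem hr (r ^ 2) := by rw [genV_mul_idem, e4]
      rw [← mul_assoc, this, mul_assoc, h2]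
    have h4 : idem hr r ⊗ₜ[k] (1 : NodalHopf hr)
        * Coalgebra.comul (R := k) (genV hr * idem hr r) * idem hr (r ^ 2) ⊗ₜ[k] (1 : NodalHopf hr)
        = (genV hr * idem hr (r ^ 2)) ⊗ₜ[k] (r ^ 2 • idem hr (r ^ 2)) := by
      rw [Bialgebra.comul_mul, mul_assoc, mul_assoc, comul_idem_mul hr r hs3, e5, comul_genV,
        add_mul, mul_add, Algebra.TensorProduct.tmul_mul_tmul, Algebra.TensorProduct.tmul_mul_tmul,
        Algebra.TensorProduct.tmul_mul_tmul, Algebra.TensorProduct.tmul_mul_tmul, one_mul, h1,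
        TensorProduct.zero_tmul, zero_add, h3, one_mul, genA_mul_idem hr hs3]
    exact (hK hv1 h4).elim id fun h => T.mul_mem_left _ (hsmul (pow_ne_zero 2 hr0) h)
  -- `u v - r² v u` has degree zero in `v`
  have he1 : idem hr r ∈ T := by
    have e : ((3 * (1 - r))⁻¹ * (1 - r ^ 2)) • idem hr r
        = genU hr * (genV hr * idem hr r) - r ^ 2 • (genV hr * idem hr (r ^ 2) * genU hr) := by
      rw [← mul_assoc (genU hr), hW.uv, add_mul, smul_mul_assoc, mul_assoc (genV hr) (genU hr),
        genU_mul_idem, ← pow_two r, ← mul_assoc (genV hr), add_sub_cancel_left, smul_mul_assoc,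
        sub_mul, genA_sq_mul_idem hr hr3, one_mul]
      module
    refine hsmul (c := (3 * (1 - r))⁻¹ * (1 - r ^ 2)) (mul_ne_zero hκ ?_) ?_
    · intro h
      exact hr1 (by linear_combination hr3 + r * h)
    · rw [e]
      exact T.sub_mem (T.mul_mem_left _ hv1)
        (Submodule.smul_of_tower_mem T _ (T.mul_mem_right _ hv2))
  have he2 : idem hr (r ^ 2) ∈ T := by
    have h := hK (P := 1) he1 (by rw [one_mul, comul_idem_mul hr r hs3, e5])
    exact h.elim id id
  have ha : 1 - genA hr ∈ T := by
    have h33 : (3 : k) * 3⁻¹ = 1 := mul_inv_cancel₀ h3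
    have e : 1 - genA hr = (1 - r) • idem hr r + (1 - r ^ 2) • idem hr (r ^ 2) := by
      simp only [idem]
      match_scalars
      · linear_combination (-1 : k) * h33 + (3 : k)⁻¹ * hq
      · linear_combination h33 - (3 : k)⁻¹ * hq - (3 : k)⁻¹ * (r - r ^ 3 - 2) * hr3
      · linear_combination (3 : k)⁻¹ * r * hr3
    rw [e]
    exact T.add_mem (Submodule.smul_of_tower_mem T _ he1) (Submodule.smul_of_tower_mem T _ he2)
  -- modulo `1 - a` the relation `x a² + a x a + a² x + a² = 1` becomes `3 x = 0`
  have hx : genX hr ∈ T := by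
    have e : (3 : k) • genX hr = genX hr * ((1 + genA hr) * (1 - genA hr))
        + ((1 - genA hr) * genX hr + genA hr * genX hr * (1 - genA hr))
        + (1 + genA hr) * (1 - genA hr) * genX hr + (1 + genA hr) * (1 - genA hr) := by
      have h := (sat hr).xaa
      have h' : (3 : k) • genX hr = genX hr + genX hr + genX hr
          + (1 - (genX hr * genA hr ^ 2 + genA hr * genX hr * genA hr + genA hr ^ 2 * genX hr
            + genA hr ^ 2)) := by
        rw [h, sub_self, add_zero]
        module
      rw [h']
      noncomm_ring
    refine hsmul h3 ?_
    rw [e]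
    have ha' := T.mul_mem_left (1 + genA hr) ha
    exact T.add_mem (T.add_mem (T.add_mem (T.mul_mem_left _ ha')
      (T.add_mem (T.mul_mem_right _ ha) (T.mul_mem_left _ ha))) (T.mul_mem_right _ ha')) ha'
  refine hfin _ (sat hr).yy.symm (T.add_mem ?_ ?_)
  · exact T.pow_mem_of_mem hx 2 (by norm_num)
  · exact T.pow_mem_of_mem hx 3 (by norm_num)

/-- The element found is a polynomial in `y² = (y + pb)² - p²`; it is nonzero because `t² - p²` is
transcendental in the coordinate ring. -/
theorem exists_mem_subB_mem_ne_zero (h2 : (2 : k) ≠ 0) {p q : k} (hpq : p ^ 2 = q ^ 2 + q ^ 3)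
    {I : Ideal (NodalHopf hr)} [I.IsTwoSided] (hco : (I.restrictScalars k).IsCoideal)
    (hI : I ≠ ⊥) : ∃ z ∈ subB hr p q, z ∈ I ∧ z ≠ 0 := by
  obtain ⟨f, hf, h⟩ := one_mem_torsionIdeal hr h2 hco hI
  rw [mul_one] at h
  set g : CoordRing k := aeval (coordT k ^ 2 - algebraMap k _ (p ^ 2)) f
  have hg : (coordHom hr hpq g : NodalHopf hr) = aeval (genY hr ^ 2) f := by
    have e : (coordHom hr hpq (coordT k ^ 2 - algebraMap k _ (p ^ 2)) : NodalHopf hr)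
        = genY hr ^ 2 := by
      rw [map_sub, map_pow, AlgHom.commutes, Subalgebra.coe_sub, Subalgebra.coe_pow,
        coordHom_coordT, genY_add_sq, Subalgebra.coe_algebraMap, Algebra.algebraMap_eq_smul_one,
        add_sub_cancel_right]
    rw [← e, ← aeval_algHom_apply]
    exact (aeval_algHom_apply (subB hr p q).val _ f).symm
  refine ⟨_, (coordHom hr hpq g).2, by rwa [hg], ?_⟩
  rw [Ne, ZeroMemClass.coe_eq_zero, map_eq_zero_iff _ (coordHom_injective hr hpq)]
  intro h0
  have h1 : f.comp ((X ^ 3 - X) ^ 2 - C (p ^ 2)) = 0 := by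
    have := congrArg (normalization k) h0
    rw [← aeval_algHom_apply, map_zero, map_sub, map_pow, normalization_coordT,
      AlgHom.commutes] at this
    exact this
  have hd : ((X ^ 3 - X) ^ 2 - C (p ^ 2) : k[X]).natDegree = 6 := by compute_degree!
  rcases comp_eq_zero_iff.mp h1 with h | ⟨-, h⟩
  · exact hf h
  · rw [h, natDegree_C] at hd
    omega

end HopfIdeals

end NodalCubic

theorem theorem1 {k : Type u} [Field k] {r : k} (hr : IsPrimitiveRoot r 3) (p q : k)
    (hpq : p ^ 2 = q ^ 2 + q ^ 3) :
    -- (1)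
    (NodalCubic.IsRightCoideal (NodalCubic.subB hr p q) ∧
      (∃ e : NodalCubic.CoordRing k ≃ₐ[k] NodalCubic.subB hr p q,
        (e (Ideal.Quotient.mk _ (MvPolynomial.X 0)) : NodalCubic.NodalHopf hr)
            = NodalCubic.genX hr + q • NodalCubic.genA hr ∧
        (e (Ideal.Quotient.mk _ (MvPolynomial.X 1)) : NodalCubic.NodalHopf hr)
            = NodalCubic.genY hr + p • NodalCubic.genB hr) ∧
      NodalCubic.IsHopfSubalgebra (NodalCubic.subC hr)) ∧
    -- (2)
    (Function.Bijective (Submodule.mulMap (Subalgebra.toSubmodule (NodalCubic.subC hr))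
        (Subalgebra.toSubmodule (NodalCubic.subB hr p q))) ∧
      NodalCubic.IsRightFree (NodalCubic.subB hr p q) ∧
      NodalCubic.IsRightFaithfullyFlat (NodalCubic.subB hr p q) ∧
      ∃ _ : (NodalCubic.leftAug (NodalCubic.subB hr p q)).IsCoideal,
        NodalCubic.IsCoalgebraGalois (NodalCubic.subB hr p q)
          (Coalgebra.Quotient.mkQCoalgHom (NodalCubic.leftAug (NodalCubic.subB hr p q))) ∧
        NodalCubic.HasCleavingMap
          (Coalgebra.Quotient.mkQCoalgHom (NodalCubic.leftAug (NodalCubic.subB hr p q)))) ∧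
    -- (3)
    (ringChar k ≠ 2 → ∀ I : Ideal (NodalCubic.NodalHopf hr), I.IsTwoSided → I.IsHopfIdeal k →
      I ≠ ⊥ → ∃ z ∈ NodalCubic.subB hr p q, z ∈ I ∧ z ≠ 0) := by
  have hB := NodalCubic.subB_isRightCoideal hr p q
  have hC := NodalCubic.subC_comul hr
  have hbij := NodalCubic.mulMap_bijective hr hpq
  have hco := NodalCubic.leftAug_isCoideal hB
  refine ⟨⟨hB, ⟨NodalCubic.coordEquiv hr hpq, NodalCubic.coordHom_coordS hr hpq,
    NodalCubic.coordHom_coordT hr hpq⟩, NodalCubic.subC_isHopfSubalgebra hr⟩,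
    ⟨hbij, NodalCubic.isRightFree hr hpq, NodalCubic.isRightFaithfullyFlat hr hpq, hco,
      NodalCubic.isCoalgebraGalois_of_mulMap_bijective hbij hB hC,
      NodalCubic.hasCleavingMap_of_mulMap_bijective hbij hC⟩, ?_⟩
  intro h2 I hI hHopf hne
  exact NodalCubic.exists_mem_subB_mem_ne_zero hr (Ring.two_ne_zero h2) hpq
    hHopf.toIsCoideal hne
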